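/- Fix integers $p\ge 0$ and $m\ge 1$. For each sample size $n$ let $$x_t=a_{01}x_{t-1}+\dots+a_{0p}x_{t-p}+u_t,\qquad u_t=\tilde h_t\epsilon_t,\qquad \tilde h_t^2=h_t^2+\sum_{i=1}^m\alpha_{0i}u_{t-i}^2,\qquad 1\le t\le n,$$ where $\alpha_{0i}\ge 0$, and $1-\sum_{i=1}^p a_{0i}z^i\neq 0$ for all complex $|z|\le 1$. The initial values $(x_0,\dots,x_{1-p})$ are finite random variables independent of $(\epsilon_t)_{t\ge1}$; they may depend on $n$, in which case they are assumed tight in $n$. Assume: (A1) $h_t=g(t/n)$, where $g:(0,1]\to(0,\infty)$ is measurable and deterministic with $0<\inf_{(0,1]}g\le\sup_{(0,1]}g<\infty$, and $(0,1]$ is a finite union of disjoint intervals on each of which $g$ is Lipschitz; the $\epsilon_t$, $t\in\mathbb Z$, are i.i.d. with $E(\epsilon_t)=0$, $E(\epsilon_t^2)=1$, $E(\epsilon_t^4)>1$ and $E(|\epsilon_t|^s)<\infty$ for some $s>8$; (H$_0$) $\alpha_{0i}=0$ for all $1\le i\le m$. Put $\underline x_{t-1}=(x_{t-1},\dots,x_{t-p})'$,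 $u_t(\theta)=x_t-\theta'\underline x_{t-1}$, and let $$\hat\theta=\Big\{\sum_{t=1}^n h_t^{-2}\underline x_{t-1}\underline x_{t-1}'\Big\}^{-1}\sum_{t=1}^n h_t^{-2}x_t\underline x_{t-1}$$ be the generalized least squares estimator. For $k=4,8$ let $$\bar\omega_k=\frac{n^{-1}\sum_{t=1}^n u_t^k(\hat\theta)}{n^{-1}\sum_{t=1}^n u_t^k(\hat\theta)h_t^{-k}},$$ and for $0\le j\le m$ let $$\hat\gamma(j)=n^{-1}\sum_{t=1+j}^n\{u_t^2(\hat\theta)-E(u_t^2)\}\{u_{t-j}^2(\hat\theta)-E(u_{t-j}^2)\},\qquad \hat r(j)=\hat\gamma(j)/\hat\gamma(0),$$ where $E(u_t^2)=h_t^2$ under H$_0$. Then $$Q^*_{GLS}=\Big\{n(n+2)\sum_{i=1}^m\frac{\hat r^2(i)}{n-i}\Big\}\frac{\bar\omega_4^2}{\bar\omega_8}$$ converges in law, as $n\to\infty$, to the $\chi^2$ distribution with $m$ degrees of freedom. -/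

import Mathlib

open MeasureTheory ProbabilityTheory Filter

namespace SecondOrderDynamics

/-- `g` is piecewise Lipschitz on `(0, 1]`: there are finitely many mutually disjoint intervals
with union `(0, 1]` on each of which `g` is Lipschitz. -/
def PiecewiseLipschitz (g : ℝ → ℝ) : Prop :=
  ∃ (N : ℕ) (I : Fin N → Set ℝ), (∀ l, (I l).OrdConnected) ∧
    Pairwise (fun k l => Disjoint (I k) (I l)) ∧ (⋃ l, I l) = Set.Ioc 0 1 ∧
    ∀ l, ∃ K : NNReal, LipschitzOnWith K g (I l)

/-- The conditions on the volatility function `g`; only its values on `(0, 1]` matter. -/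
structure VolatilityAssumption (g : ℝ → ℝ) : Prop where
  measurable : Measurable fun r : Set.Ioc (0 : ℝ) 1 => g r
  lower : ∃ c : ℝ, 0 < c ∧ ∀ r ∈ Set.Ioc (0 : ℝ) 1, c ≤ g r
  upper : ∃ C : ℝ, ∀ r ∈ Set.Ioc (0 : ℝ) 1, g r ≤ C
  piecewiseLipschitz : PiecewiseLipschitz g

/-- The conditions on the innovations: iid, centred, unit variance, a moment of order `s > 8`,
and `E(ε⁴) > 1` (that is, `ε²` is not almost surely constant). -/
structure NoiseAssumption {Ω : Type*} [MeasurableSpace Ω] (μ : Measure Ω)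
    (ε : ℤ → Ω → ℝ) : Prop where
  measurable : ∀ t, Measurable (ε t)
  indep : iIndepFun ε μ
  identDistrib : ∀ t, IdentDistrib (ε t) (ε 0) μ μ
  moment : ∃ s : ℝ, 8 < s ∧ Integrable (fun ω => |ε 0 ω| ^ s) μ
  mean : ∫ ω, ε 0 ω ∂μ = 0
  variance : ∫ ω, ε 0 ω ^ 2 ∂μ = 1
  fourth : 1 < ∫ ω, ε 0 ω ^ 4 ∂μ

/-- The rescaled volatility `h_t = g (t / n)`. -/
noncomputable def vol (g : ℝ → ℝ) (n : ℕ) (t : ℤ) : ℝ := g ((t : ℝ) / (n : ℝ))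

/-- The autoregression with ARCH-type innovations, for every sample size `n`:
`x_t = a₁ x_{t-1} + … + a_p x_{t-p} + u_t`, `u_t = h̃_t ε_t`,
`h̃_t² = h_t² + α₁ u_{t-1}² + … + α_m u_{t-m}²` for `1 ≤ t ≤ n`, where `a(z) = 1 - ∑ a_i z^i` has
no zero in the closed unit disc and the `α_i` are nonnegative. Coefficient number `i : Fin p`
belongs to lag `i + 1`. The initial values `(x_0, …, x_{1-p})` may depend on `n`; they are
independent of the innovations `ε_1, ε_2, …` and tight in `n`. -/
structure ARModel {Ω : Type*} [MeasurableSpace Ω] (μ : Measure Ω) {p m : ℕ} (g : ℝ → ℝ)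
    (a : Fin p → ℝ) (α : Fin m → ℝ) (ε : ℤ → Ω → ℝ) (x u : ℕ → ℤ → Ω → ℝ) : Prop where
  stable : ∀ z : ℂ, ‖z‖ ≤ 1 → 1 - ∑ i : Fin p, (a i : ℂ) * z ^ ((i : ℕ) + 1) ≠ 0
  alpha_nonneg : ∀ i, 0 ≤ α i
  observation : ∀ (n : ℕ) (t : ℤ), 1 ≤ t → t ≤ n → ∀ ω,
    x n t ω = ∑ i : Fin p, a i * x n (t - ((i : ℕ) + 1)) ω + u n t ω
  innovation : ∀ (n : ℕ) (t : ℤ), 1 ≤ t → t ≤ n → ∀ ω,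
    u n t ω = √(vol g n t ^ 2 + ∑ i : Fin m, α i * u n (t - ((i : ℕ) + 1)) ω ^ 2) * ε t ω
  init_measurable : ∀ (n : ℕ) (i : Fin p), Measurable (x n (-((i : ℕ) : ℤ)))
  init_indep : ∀ n : ℕ, IndepFun (fun ω (i : Fin p) => x n (-((i : ℕ) : ℤ)) ω)
    (fun ω (k : ℕ) => ε ((k : ℤ) + 1) ω) μ
  init_tight : IsTightMeasureSet
    (Set.range fun n : ℕ => μ.map fun ω (i : Fin p) => x n (-((i : ℕ) : ℤ)) ω)

/-- The hypothesis of no second order dynamics. -/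
def NullHypothesis {m : ℕ} (α : Fin m → ℝ) : Prop := ∀ i, α i = 0

/-- The vector `(x_t, …, x_{t-p+1})`. -/
def lagVector (p : ℕ) (x : ℤ → ℝ) (t : ℤ) : Fin p → ℝ := fun i => x (t - (i : ℕ))

/-- The generalized least squares estimator
`(∑ h_t⁻² x̲_{t-1} x̲_{t-1}')⁻¹ ∑ h_t⁻² x_t x̲_{t-1}`, sums over `1 ≤ t ≤ n`. -/
noncomputable def gls (p : ℕ) (h : ℤ → ℝ) (n : ℕ) (x : ℤ → ℝ) : Fin p → ℝ :=
  Matrix.mulVec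
    (∑ t ∈ Finset.Icc (1 : ℤ) n,
      (h t ^ 2)⁻¹ • Matrix.vecMulVec (lagVector p x (t - 1)) (lagVector p x (t - 1)))⁻¹
    (∑ t ∈ Finset.Icc (1 : ℤ) n, ((h t ^ 2)⁻¹ * x t) • lagVector p x (t - 1))

/-- `u_t(θ) = x_t - θ₁ x_{t-1} - … - θ_p x_{t-p}`. -/
def resid {p : ℕ} (x : ℤ → ℝ) (θ : Fin p → ℝ) (t : ℤ) : ℝ :=
  x t - ∑ i : Fin p, θ i * x (t - ((i : ℕ) + 1))

/-- The estimator `n⁻¹ ∑ v_t^k h_t^{-k}` of `E(ε^k)`. -/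
noncomputable def noiseMoment (k n : ℕ) (h v : ℤ → ℝ) : ℝ :=
  (n : ℝ)⁻¹ * ∑ t ∈ Finset.Icc (1 : ℤ) n, v t ^ k * (h t ^ k)⁻¹

/-- The estimator `ω̄_k` of `∫ g^k`. -/
noncomputable def omegaBar (k n : ℕ) (h v : ℤ → ℝ) : ℝ :=
  ((n : ℝ)⁻¹ * ∑ t ∈ Finset.Icc (1 : ℤ) n, v t ^ k) / noiseMoment k n h v

/-- `γ̂(j)`: the autocovariance at lag `j` of the squares `v_t²` with centring constants `c_t`. -/
noncomputable def gammaHat (n : ℕ) (c v : ℤ → ℝ) (j : ℕ) : ℝ :=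
  (n : ℝ)⁻¹ * ∑ t ∈ Finset.Icc (1 + (j : ℤ)) n, (v t ^ 2 - c t) * (v (t - j) ^ 2 - c (t - j))

/-- `r̂(i) = γ̂(i) / γ̂(0)`. -/
noncomputable def rHat (n : ℕ) (c v : ℤ → ℝ) (i : ℕ) : ℝ := gammaHat n c v i / gammaHat n c v 0

/-- The Ljung-Box type statistic `n (n + 2) ∑_{i ≤ m} r̂(i)² / (n - i) · ω̄₄² / ω̄₈` computed from
the volatilities `h`, the centring constants `c` and the residuals `v`. -/
noncomputable def ljungBox (m n : ℕ) (h c v : ℤ → ℝ) : ℝ :=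
  ((n : ℝ) * ((n : ℝ) + 2) * ∑ i ∈ Finset.Icc 1 m, rHat n c v i ^ 2 / ((n : ℝ) - (i : ℝ))) *
    (omegaBar 4 n h v ^ 2 / omegaBar 8 n h v)

/-- The infeasible statistic `Q*_GLS`: GLS residuals, known volatilities, squared residuals centred
at `E(u_t²)`. -/
noncomputable def qStarGLS {Ω : Type*} [MeasurableSpace Ω] (μ : Measure Ω) (p m : ℕ) (g : ℝ → ℝ)
    (x u : ℕ → ℤ → Ω → ℝ) (n : ℕ) (ω : Ω) : ℝ :=
  ljungBox m n (vol g n) (fun t => ∫ ω', u n t ω' ^ 2 ∂μ)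
    (resid (fun t => x n t ω) (gls p (vol g n) n (fun t => x n t ω)))

/-- The chi-squared distribution with `m` degrees of freedom: the law of a sum of the squares of
`m` independent standard normal variables. -/
noncomputable def chiSquared (m : ℕ) : Measure ℝ :=
  (Measure.pi fun _ : Fin m => gaussianReal 0 1).map fun z => ∑ i, z i ^ 2

instance instIsProbabilityMeasureChiSquared (m : ℕ) : IsProbabilityMeasure (chiSquared m) :=
  Measure.isProbabilityMeasure_map
    (Measurable.aemeasurable (by fun_prop : Measurable fun z : Fin m → ℝ => ∑ i, z i ^ 2))

end SecondOrderDynamics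

open SecondOrderDynamics

namespace SecondOrderDynamics

open scoped Topology ENNReal NNReal

section InProbability

variable {Ω : Type*} [MeasurableSpace Ω]

/-- The filter on `ℕ × Ω` of the events whose `n`-th section has a complement of vanishing
probability: convergence along it is convergence in probability. -/
def inProb (μ : Measure Ω) : Filter (ℕ × Ω) where
  sets := {S | Tendsto (fun n => μ {ω | (n, ω) ∉ S}) atTop (𝓝 0)}
  univ_sets := by simp
  sets_of_superset {S T} hS hST :=
    tendsto_of_tendsto_of_tendsto_of_le_of_le tendsto_const_nhds hS (fun _ => zero_le)
      fun n => measure_mono fun _ hω h => hω (hST h)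
  inter_sets {S T} hS hT := by
    refine tendsto_of_tendsto_of_tendsto_of_le_of_le tendsto_const_nhds
      (by simpa using hS.add hT) (fun _ => zero_le) fun n => ?_
    refine (measure_mono fun ω hω => ?_).trans (measure_union_le _ _)
    simp only [Set.mem_ofPred_eq, Set.mem_inter_iff, not_and_or] at hω
    exact hω

lemma eventually_inProb {μ : Measure Ω} {P : ℕ × Ω → Prop} :
    (∀ᶠ q in inProb μ, P q) ↔ Tendsto (fun n => μ {ω | ¬ P (n, ω)}) atTop (𝓝 0) := Iff.rfl

lemma tendsto_fst_inProb (μ : Measure Ω) : Tendsto Prod.fst (inProb μ) atTop := by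
  refine tendsto_atTop.2 fun N => eventually_inProb.2 ?_
  refine tendsto_const_nhds.congr' ?_
  filter_upwards [eventually_ge_atTop N] with n hn
  simp [hn]

lemma eventually_inProb_of_atTop (μ : Measure Ω) {P : ℕ → Prop} (h : ∀ᶠ n in atTop, P n) :
    ∀ᶠ q in inProb μ, P q.1 := (tendsto_fst_inProb μ).eventually h

lemma tendsto_inProb_of_atTop (μ : Measure Ω) {α : Type*} {l : Filter α} {f : ℕ → α}
    (h : Tendsto f atTop l) : Tendsto (fun q : ℕ × Ω => f q.1) (inProb μ) l :=
  h.comp (tendsto_fst_inProb μ)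

lemma tendstoInMeasure_of_tendsto_inProb {μ : Measure Ω} {X : ℕ → Ω → ℝ}
    (h : Tendsto (fun q : ℕ × Ω => X q.1 q.2) (inProb μ) (𝓝 0)) :
    TendstoInMeasure μ X atTop 0 := by
  rw [tendstoInMeasure_iff_norm]
  intro e he
  have := eventually_inProb.1 (h.eventually (Metric.ball_mem_nhds (0 : ℝ) he))
  simpa using this

lemma tendsto_inProb_zero_iff {μ : Measure Ω} {X : ℕ → Ω → ℝ} :
    Tendsto (fun q : ℕ × Ω => X q.1 q.2) (inProb μ) (𝓝 0) ↔
      ∀ e : ℝ, 0 < e → Tendsto (fun n => μ {ω | e ≤ |X n ω|}) atTop (𝓝 0) := by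
  rw [Metric.tendsto_nhds]
  refine forall₂_congr fun e he => ?_
  rw [eventually_inProb]
  simp

/-- Boundedness in probability. -/
def BoundedInProb (μ : Measure Ω) (X : ℕ → Ω → ℝ) : Prop :=
  ∀ e : ℝ, 0 < e → ∃ K : ℝ, ∀ᶠ n in atTop, μ {ω | K < |X n ω|} ≤ ENNReal.ofReal e

lemma BoundedInProb.mul_tendsto {μ : Measure Ω} {X Y : ℕ → Ω → ℝ} (hX : BoundedInProb μ X)
    (hY : Tendsto (fun q : ℕ × Ω => Y q.1 q.2) (inProb μ) (𝓝 0)) :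
    Tendsto (fun q : ℕ × Ω => X q.1 q.2 * Y q.1 q.2) (inProb μ) (𝓝 0) := by
  refine (tendsto_inProb_zero_iff (X := fun n ω => X n ω * Y n ω)).2 fun e he => ?_
  rw [ENNReal.tendsto_nhds_zero]
  intro d hd
  obtain ⟨d', hd', hdd⟩ := ENNReal.lt_iff_exists_real_btwn.1 hd
  have hd0 : 0 < d' := by simpa using hdd.1
  obtain ⟨K, hK⟩ := hX (d' / 2) (by positivity)
  have h2 := (ENNReal.tendsto_nhds_zero.1 (tendsto_inProb_zero_iff.1 hY (e / (|K| + 1))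
    (by positivity))) (ENNReal.ofReal (d' / 2)) (by simpa using hd0)
  filter_upwards [hK, h2] with n h1 h2
  calc μ {ω | e ≤ |X n ω * Y n ω|}
      ≤ μ ({ω | K < |X n ω|} ∪ {ω | e / (|K| + 1) ≤ |Y n ω|}) := by
        refine measure_mono fun ω hω => ?_
        by_contra hcon
        simp only [Set.mem_union, Set.mem_ofPred_eq, not_or, not_lt, not_le] at hcon hω
        rw [abs_mul] at hω
        have h3 : |X n ω| * |Y n ω| ≤ (|K| + 1) * |Y n ω| := by
          gcongr
          linarith [le_abs_self K]
        have h4 := (lt_div_iff₀ (by positivity)).1 hcon.2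
        nlinarith
    _ ≤ _ := measure_union_le _ _
    _ ≤ ENNReal.ofReal (d' / 2) + ENNReal.ofReal (d' / 2) := add_le_add h1 h2
    _ = ENNReal.ofReal d' := by
        rw [← ENNReal.ofReal_add (by positivity) (by positivity)]; congr 1; ring
    _ ≤ d := hdd.2.le

lemma BoundedInProb.div_tendsto {μ : Measure Ω} {X : ℕ → Ω → ℝ} (hX : BoundedInProb μ X)
    {r : ℕ → ℝ} (hr : Tendsto r atTop (𝓝 0)) :
    Tendsto (fun q : ℕ × Ω => X q.1 q.2 * r q.1) (inProb μ) (𝓝 0) :=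
  hX.mul_tendsto (Y := fun n _ => r n) (tendsto_inProb_of_atTop μ hr)

/-- A sequence whose mean absolute values on events of almost full probability are bounded is
bounded in probability. -/
lemma boundedInProb_of_lintegral_le {μ : Measure Ω} {X : ℕ → Ω → ℝ} (B : ℝ → ℕ → Set Ω)
    (hB : ∀ e : ℝ, 0 < e → ∃ K, ∀ n, μ (B K n)ᶜ ≤ ENNReal.ofReal e)
    (hBm : ∀ K n, MeasurableSet (B K n))
    (hXm : ∀ n, AEMeasurable (X n) μ)
    (hX : ∀ K, ∃ C : ℝ, ∀ᶠ n in atTop, ∫⁻ ω in B K n, ‖X n ω‖ₑ ∂μ ≤ ENNReal.ofReal C) :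
    BoundedInProb μ X := by
  intro e he
  obtain ⟨K, hK⟩ := hB (e / 2) (by positivity)
  obtain ⟨C, hC⟩ := hX K
  refine ⟨(|C| + 1) / (e / 2), ?_⟩
  filter_upwards [hC] with n hn
  have hL : 0 < (|C| + 1) / (e / 2) := by positivity
  have hmark : ENNReal.ofReal ((|C| + 1) / (e / 2)) *
      μ.restrict (B K n) {ω | ENNReal.ofReal ((|C| + 1) / (e / 2)) ≤ ‖X n ω‖ₑ} ≤
        ENNReal.ofReal C :=
    (mul_meas_ge_le_lintegral₀ (hXm n).enorm.restrict _).trans hn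
  have hmark' : μ.restrict (B K n) {ω | ENNReal.ofReal ((|C| + 1) / (e / 2)) ≤ ‖X n ω‖ₑ} ≤
      ENNReal.ofReal (e / 2) := by
    rw [← ENNReal.mul_le_mul_iff_right (a := ENNReal.ofReal ((|C| + 1) / (e / 2)))
      (by simpa using hL) ENNReal.ofReal_ne_top]
    refine hmark.trans ?_
    rw [← ENNReal.ofReal_mul hL.le, div_mul_cancel₀ _ (by positivity)]
    exact ENNReal.ofReal_le_ofReal (by linarith [le_abs_self C])
  rw [Measure.restrict_apply' (hBm K n)] at hmark'
  calc μ {ω | (|C| + 1) / (e / 2) < |X n ω|}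
      ≤ μ ((B K n)ᶜ ∪ {ω | ENNReal.ofReal ((|C| + 1) / (e / 2)) ≤ ‖X n ω‖ₑ} ∩ B K n) := by
        refine measure_mono fun ω hω => ?_
        by_cases hb : ω ∈ B K n
        · refine Or.inr ⟨?_, hb⟩
          rw [Set.mem_ofPred_eq, Real.enorm_eq_ofReal_abs]
          exact ENNReal.ofReal_le_ofReal (le_of_lt hω)
        · exact Or.inl hb
    _ ≤ _ := measure_union_le _ _
    _ ≤ ENNReal.ofReal (e / 2) + ENNReal.ofReal (e / 2) := add_le_add (hK n) hmark'
    _ = ENNReal.ofReal e := by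
        rw [← ENNReal.ofReal_add (by positivity) (by positivity)]; congr 1; ring

end InProbability

section SigmaAlgebras

variable {Ω ι : Type*} {mΩ : MeasurableSpace Ω} {μ : Measure Ω}

/-- Functions measurable with respect to disjoint blocks of an independent family of
`σ`-algebras are independent. -/
lemma indepFun_of_measurable_iSup {M : ι → MeasurableSpace Ω} (hle : ∀ r, M r ≤ mΩ)
    (hM : iIndep M μ) {S T : Set ι} (hST : Disjoint S T) {β γ : Type*} [MeasurableSpace β]
    [MeasurableSpace γ] {f : Ω → β} {h : Ω → γ} (hf : Measurable[⨆ r ∈ S, M r] f)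
    (hh : Measurable[⨆ r ∈ T, M r] h) : IndepFun f h μ :=
  indep_of_indep_of_le (indep_iSup_of_disjoint hle hM hST) hf.comap_le hh.comap_le

/-- The `σ`-algebra generated by the variables with index in `S`. -/
abbrev sigmaOf (η : ι → Ω → ℝ) (S : Set ι) : MeasurableSpace Ω :=
  ⨆ r ∈ S, (inferInstance : MeasurableSpace ℝ).comap (η r)

lemma measurable_sigmaOf {η : ι → Ω → ℝ} {S : Set ι} {r : ι} (hr : r ∈ S) :
    Measurable[sigmaOf η S] (η r) :=
  Measurable.mono (comap_measurable (η r))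
    (le_biSup (fun r => (inferInstance : MeasurableSpace ℝ).comap (η r)) hr) le_rfl

lemma sigmaOf_mono {η : ι → Ω → ℝ} {S T : Set ι} (h : S ⊆ T) : sigmaOf η S ≤ sigmaOf η T :=
  biSup_mono fun _ hi => h hi

lemma indepFun_of_measurable_sigmaOf {η : ι → Ω → ℝ} (hm : ∀ r, Measurable (η r))
    (hη : iIndepFun η μ) {S T : Set ι} (hST : Disjoint S T) {β γ : Type*} [MeasurableSpace β]
    [MeasurableSpace γ] {f : Ω → β} {h : Ω → γ} (hf : Measurable[sigmaOf η S] f)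
    (hh : Measurable[sigmaOf η T] h) : IndepFun f h μ :=
  indepFun_of_measurable_iSup (fun r => (hm r).comap_le) hη.iIndep hST hf hh

end SigmaAlgebras

section ElementaryBounds

lemma norm_cexp_I_mul_sub_taylor_le (x : ℝ) :
    ‖Complex.exp (Complex.I * x) - 1 - Complex.I * x + x ^ 2 / 2‖ ≤ 4 * |x| ^ 3 := by
  rcases le_or_gt |x| 1 with h | h
  · have h1 := Complex.exp_bound (x := Complex.I * x) (by simpa using h) (n := 3) (by norm_num)
    simp only [Finset.sum_range_succ, Finset.sum_range_zero, Nat.factorial, norm_mul,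
      Complex.norm_I, one_mul, Complex.norm_real, Real.norm_eq_abs] at h1
    have e : Complex.exp (Complex.I * x) - 1 - Complex.I * x + x ^ 2 / 2 =
        Complex.exp (Complex.I * x) - (0 + (Complex.I * x) ^ 0 / ((1 : ℕ) : ℂ)
          + (Complex.I * x) ^ 1 / (((0 + 1) * 1 : ℕ) : ℂ) +
          (Complex.I * x) ^ 2 / (((1 + 1) * ((0 + 1) * 1) : ℕ) : ℂ)) := by
      push_cast
      have : Complex.I ^ 2 = -1 := Complex.I_sq
      rw [mul_pow Complex.I _ 2, this]
      ring
    rw [e]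
    refine h1.trans ?_
    have : 0 ≤ |x| ^ 3 := by positivity
    push_cast
    nlinarith
  · have e1 : ‖Complex.exp (Complex.I * x)‖ = 1 := Complex.norm_exp_I_mul_ofReal x
    have e2 : ‖Complex.I * (x : ℂ)‖ = |x| := by simp
    have e3 : ‖(x : ℂ) ^ 2 / 2‖ = |x| ^ 2 / 2 := by simp
    calc _ ≤ ‖Complex.exp (Complex.I * x)‖ + ‖(1 : ℂ)‖ + ‖Complex.I * (x : ℂ)‖
          + ‖(x : ℂ) ^ 2 / 2‖ :=
          (norm_add_le _ _).trans (add_le_add_left ((norm_sub_le _ _).trans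
            (add_le_add_left (norm_sub_le _ _) _)) _)
      _ = 2 + |x| + |x| ^ 2 / 2 := by rw [e1, e2, e3, norm_one]; ring
      _ ≤ 4 * |x| ^ 3 := by
        have h2 : 1 ≤ |x| ^ 2 := by nlinarith
        have h3 : |x| ^ 2 ≤ |x| ^ 3 := by nlinarith
        nlinarith

lemma abs_exp_neg_sub_le {b : ℝ} (hb : 0 ≤ b) : |Real.exp (-b) - (1 - b)| ≤ b ^ 2 := by
  rcases le_or_gt b 1 with h | h
  · have := Real.abs_exp_sub_one_sub_id_le (x := -b) (by rw [abs_neg, abs_of_nonneg hb]; exact h)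
    rw [neg_sq] at this
    convert! this using 2
    ring
  · have h1 : Real.exp (-b) ≤ 1 := Real.exp_le_one_iff.2 (by linarith)
    have h2 := Real.exp_pos (-b)
    rw [abs_le]
    constructor <;> nlinarith

lemma norm_cexp_I_sub_le (x y : ℝ) :
    ‖Complex.exp (Complex.I * x) - Complex.exp (Complex.I * y)‖ ≤ |x - y| := by
  have : Complex.exp (Complex.I * x) - Complex.exp (Complex.I * y) =
      Complex.exp (Complex.I * y) * (Complex.exp (Complex.I * ((x - y : ℝ) : ℂ)) - 1) := by
    rw [mul_sub, ← Complex.exp_add, mul_one]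
    congr 2
    push_cast
    ring
  rw [this, norm_mul, Complex.norm_exp_I_mul_ofReal, one_mul]
  exact Real.norm_exp_I_mul_ofReal_sub_one_le

lemma sum_pow_le_card_mul {ι : Type*} (s : Finset ι) (f : ι → ℝ) (hf : ∀ i ∈ s, 0 ≤ f i)
    (n : ℕ) : (∑ i ∈ s, f i) ^ (n + 1) ≤ (s.card : ℝ) ^ n * ∑ i ∈ s, f i ^ (n + 1) := by
  rcases s.eq_empty_or_nonempty with rfl | hs
  · simp
  · have := pow_sum_div_card_le_sum_pow (s := s) hf n
    rwa [div_le_iff₀' (by have := hs.card_pos; positivity)] at this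

lemma norm_prod_exp_recursion {f : ℕ → ℂ} {b : ℕ → ℝ} {e : ℝ} (hb : ∀ s, 0 ≤ b s) (n : ℕ)
    (h0 : f 0 = 1) (h : ∀ s < n, ‖f (s + 1) - f s * (Real.exp (-b s) : ℝ)‖ ≤ e) :
    ‖f n - (Real.exp (-∑ s ∈ Finset.range n, b s) : ℝ)‖ ≤ n * e := by
  induction n with
  | zero => simp [h0]
  | succ n ih =>
    have ih' := ih fun s hs => h s (by omega)
    have e1 : f (n + 1) - (Real.exp (-∑ s ∈ Finset.range (n + 1), b s) : ℝ) =
        (f (n + 1) - f n * (Real.exp (-b n) : ℝ)) +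
          (f n - (Real.exp (-∑ s ∈ Finset.range n, b s) : ℝ)) * (Real.exp (-b n) : ℝ) := by
      rw [Finset.sum_range_succ, neg_add, Real.exp_add]
      push_cast
      ring
    rw [e1]
    refine (norm_add_le _ _).trans ?_
    rw [norm_mul]
    have h2 : ‖((Real.exp (-b n) : ℝ) : ℂ)‖ ≤ 1 := by
      rw [Complex.norm_real, Real.norm_eq_abs, abs_of_pos (Real.exp_pos _)]
      exact Real.exp_le_one_iff.2 (by linarith [hb n])
    have h3 := mul_le_of_le_one_right (norm_nonneg
      (f n - (Real.exp (-∑ s ∈ Finset.range n, b s) : ℝ))) h2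
    have h4 := h n (by omega)
    push_cast
    push_cast at h4 h3 ih'
    linarith

end ElementaryBounds

lemma integrable_pow_of_memLp {Ω : Type*} {mΩ : MeasurableSpace Ω} {μ : Measure Ω}
    [IsFiniteMeasure μ] {f : Ω → ℝ} {n : ℕ} (hf : MemLp f n μ) {k : ℕ} (hk : k ≤ n) :
    Integrable (fun ω => f ω ^ k) μ := by
  rcases Nat.eq_zero_or_pos k with rfl | hk0
  · simp
  · have h1 : MemLp f k μ := hf.mono_exponent (by exact_mod_cast hk)
    have h2 := h1.integrable_norm_pow hk0.ne'
    refine h2.mono (h1.aestronglyMeasurable.pow k) (Eventually.of_forall fun ω => ?_)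
    simp

/-- Independent centred variables with common variance and bounded fourth moments. -/
structure CenteredNoise {Ω : Type*} [MeasurableSpace Ω] (μ : Measure Ω) (η : ℤ → Ω → ℝ)
    (κ M : ℝ) : Prop where
  meas : ∀ r, Measurable (η r)
  indep : iIndepFun η μ
  memLp : ∀ r, MemLp (η r) (4 : ℕ) μ
  mean : ∀ r, ∫ ω, η r ω ∂μ = 0
  var : ∀ r, ∫ ω, η r ω ^ 2 ∂μ = κ
  fourth : ∀ r, ∫ ω, η r ω ^ 4 ∂μ ≤ M

/-- A linear form in the last `m` variables before time `s`. -/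
def lagForm {Ω : Type*} {m : ℕ} (w : ℕ → Fin m → ℝ) (η : ℤ → Ω → ℝ) (s : ℕ) (ω : Ω) : ℝ :=
  ∑ i : Fin m, w s i * η ((s : ℤ) - ((i : ℕ) + 1)) ω

/-- The partial sums of `η s * lagForm w η s`. -/
def quadForm {Ω : Type*} {m : ℕ} (w : ℕ → Fin m → ℝ) (η : ℤ → Ω → ℝ) (k : ℕ) (ω : Ω) : ℝ :=
  ∑ s ∈ Finset.range k, η s ω * lagForm w η s ω

/-- The sum of the absolute values of the last `m` variables before time `s`. -/
def absLag {Ω : Type*} (m : ℕ) (η : ℤ → Ω → ℝ) (s : ℕ) (ω : Ω) : ℝ :=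
  ∑ i : Fin m, |η ((s : ℤ) - ((i : ℕ) + 1)) ω|

section QuadraticForms

variable {Ω : Type*} {mΩ : MeasurableSpace Ω} {μ : Measure Ω}
  {η : ℤ → Ω → ℝ} {κ M : ℝ} {m : ℕ} {w : ℕ → Fin m → ℝ} {ρ : ℝ}

lemma measurable_lagForm_sigmaOf (w : ℕ → Fin m → ℝ) (η : ℤ → Ω → ℝ) (s : ℕ) :
    Measurable[sigmaOf η (Set.Ico ((s : ℤ) - m) s)] (lagForm w η s) := by
  refine Finset.measurable_sum _ fun i _ => Measurable.const_mul (measurable_sigmaOf ?_) _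
  constructor <;> have := i.2 <;> omega

lemma measurable_quadForm_sigmaOf (w : ℕ → Fin m → ℝ) (η : ℤ → Ω → ℝ) (k : ℕ) {j : ℤ}
    (hj : k = 0 ∨ (k : ℤ) ≤ j) : Measurable[sigmaOf η (Set.Iio j)] (quadForm w η k) := by
  rcases hj with rfl | hj
  · have : quadForm w η 0 = fun _ => 0 := by ext; simp [quadForm]
    rw [this]
    exact measurable_const
  refine Finset.measurable_sum _ fun s hs => Measurable.mul (measurable_sigmaOf ?_) ?_
  · have := Finset.mem_range.1 hs
    simp only [Set.mem_Iio]; omega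
  · refine (measurable_lagForm_sigmaOf w η s).mono (sigmaOf_mono ?_) le_rfl
    intro r hr
    have := Finset.mem_range.1 hs
    have := hr.2
    simp only [Set.mem_Iio]; omega

lemma measurable_lagForm (h : CenteredNoise μ η κ M) (s : ℕ) : Measurable (lagForm w η s) :=
  Finset.measurable_sum _ fun _ _ => (h.meas _).const_mul _

lemma measurable_quadForm (h : CenteredNoise μ η κ M) (k : ℕ) : Measurable (quadForm w η k) :=
  Finset.measurable_sum _ fun _ _ => (h.meas _).mul (measurable_lagForm h _)

lemma absLag_nonneg (s : ℕ) (ω : Ω) : 0 ≤ absLag m η s ω :=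
  Finset.sum_nonneg fun _ _ => abs_nonneg _

lemma abs_lagForm_le (hw : ∀ s i, |w s i| ≤ ρ) (s : ℕ) (ω : Ω) :
    |lagForm w η s ω| ≤ ρ * absLag m η s ω := by
  rw [lagForm, absLag, Finset.mul_sum]
  refine (Finset.abs_sum_le_sum_abs _ _).trans (Finset.sum_le_sum fun i _ => ?_)
  rw [abs_mul]
  exact mul_le_mul_of_nonneg_right (hw s i) (abs_nonneg _)

lemma CenteredNoise.memLp_absLag (h : CenteredNoise μ η κ M) (s : ℕ) :
    MemLp (absLag m η s) (4 : ℕ) μ :=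
  memLp_finsetSum _ fun _ _ => (h.memLp _).abs

lemma CenteredNoise.memLp_lagForm (h : CenteredNoise μ η κ M) (s : ℕ) :
    MemLp (lagForm w η s) (4 : ℕ) μ :=
  memLp_finsetSum _ fun _ _ => (h.memLp _).const_mul _

variable [IsProbabilityMeasure μ]

lemma CenteredNoise.integral_absLag_pow_le (h : CenteredNoise μ η κ M) (s : ℕ) :
    ∫ ω, absLag m η s ω ^ 4 ∂μ ≤ m ^ 4 * M := by
  calc ∫ ω, absLag m η s ω ^ 4 ∂μ
      ≤ ∫ ω, (m : ℝ) ^ 3 * ∑ i : Fin m, η ((s : ℤ) - ((i : ℕ) + 1)) ω ^ 4 ∂μ := by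
        refine integral_mono (integrable_pow_of_memLp (h.memLp_absLag s) le_rfl)
          ((integrable_finsetSum _ fun i _ =>
            integrable_pow_of_memLp (h.memLp _) le_rfl).const_mul _) fun ω => ?_
        have := sum_pow_le_card_mul Finset.univ
          (fun i : Fin m => |η ((s : ℤ) - ((i : ℕ) + 1)) ω|) (fun _ _ => abs_nonneg _) 3
        simp only [Even.pow_abs (by decide : Even 4), Finset.card_univ, Fintype.card_fin] at this
        exact this
    _ = (m : ℝ) ^ 3 * ∑ i : Fin m, ∫ ω, η ((s : ℤ) - ((i : ℕ) + 1)) ω ^ 4 ∂μ := by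
        rw [integral_const_mul, integral_finsetSum _ fun i _ =>
            integrable_pow_of_memLp (h.memLp _) le_rfl]
    _ ≤ (m : ℝ) ^ 3 * ∑ i : Fin m, M := by gcongr; exact h.fourth _
    _ = m ^ 4 * M := by simp; ring

lemma CenteredNoise.integral_lagForm_sq (h : CenteredNoise μ η κ M) (s : ℕ) :
    ∫ ω, lagForm w η s ω ^ 2 ∂μ = κ * ∑ i, w s i ^ 2 := by
  have hint : ∀ r r' : ℤ, Integrable (fun ω => η r ω * η r' ω) μ := fun r r' =>
    have h2 : (2 : ℝ≥0∞) ≤ ((4 : ℕ) : ℝ≥0∞) := by norm_num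
    MemLp.integrable_mul (p := 2) (q := 2) ((h.memLp r).mono_exponent h2)
      ((h.memLp r').mono_exponent h2)
  have e : ∀ ω, lagForm w η s ω ^ 2 = ∑ i : Fin m, ∑ j : Fin m, (w s i * w s j) *
      (η ((s : ℤ) - ((i : ℕ) + 1)) ω * η ((s : ℤ) - ((j : ℕ) + 1)) ω) := by
    intro ω
    rw [lagForm, sq, Finset.sum_mul_sum]
    refine Finset.sum_congr rfl fun i _ => Finset.sum_congr rfl fun j _ => by ring
  simp_rw [e]
  rw [integral_finsetSum _ fun i _ => integrable_finsetSum _ fun j _ => (hint _ _).const_mul _,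
    Finset.mul_sum]
  refine Finset.sum_congr rfl fun i _ => ?_
  rw [integral_finsetSum _ fun j _ => (hint _ _).const_mul _, Finset.sum_eq_single i]
  · rw [integral_const_mul, ← h.var ((s : ℤ) - ((i : ℕ) + 1)), mul_comm]
    simp [sq]
  · intro j _ hj
    rw [integral_const_mul, IndepFun.integral_fun_mul_eq_mul_integral
      (h.indep.indepFun (by simpa [Fin.val_inj] using hj.symm))
      (h.meas _).aestronglyMeasurable (h.meas _).aestronglyMeasurable, h.mean, zero_mul, mul_zero]
  · simp

end QuadraticForms

section CharFunRecursion

/-- The unimodular variable `exp (i T)`. -/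
noncomputable def expI {Ω : Type*} (T : Ω → ℝ) (ω : Ω) : ℂ := Complex.exp (Complex.I * T ω)

lemma norm_expI {Ω : Type*} (T : Ω → ℝ) (ω : Ω) : ‖expI T ω‖ = 1 :=
  Complex.norm_exp_I_mul_ofReal _

lemma measurable_expI {Ω : Type*} {m0 : MeasurableSpace Ω} {T : Ω → ℝ} (hT : Measurable T) :
    Measurable (expI T) :=
  Complex.measurable_exp.comp ((Complex.measurable_ofReal.comp hT).const_mul _)

variable {Ω : Type*} {mΩ : MeasurableSpace Ω} {μ : Measure Ω}

lemma integrable_expI_mul {T X : Ω → ℝ} (hT : Measurable T) (hX : Integrable X μ) :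
    Integrable (fun ω => expI T ω * (X ω : ℂ)) μ := by
  have hX' : Integrable (fun ω => (X ω : ℂ)) μ := hX.ofReal
  refine hX'.mono ((measurable_expI hT).aestronglyMeasurable.mul
    hX'.aestronglyMeasurable) (Eventually.of_forall fun ω => ?_)
  simp [norm_expI]

variable {η : ℤ → Ω → ℝ} {κ M : ℝ} {m : ℕ} {w : ℕ → Fin m → ℝ} {ρ : ℝ}

lemma integrable_expI [IsFiniteMeasure μ] {T : Ω → ℝ} (hT : Measurable T) : Integrable (expI T) μ := by
  simpa using integrable_expI_mul (μ := μ) hT (integrable_const (1 : ℝ))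

lemma abs_pow_three_le (x : ℝ) : |x| ^ 3 ≤ 1 + x ^ 4 := by
  have h4 : x ^ 4 = |x| ^ 4 := (Even.pow_abs (by decide) x).symm
  rw [h4]
  have h0 := abs_nonneg x
  rcases le_total |x| 1 with h | h
  · have : |x| ^ 3 ≤ 1 := pow_le_one₀ h0 h
    have : 0 ≤ |x| ^ 4 := by positivity
    linarith
  · have : |x| ^ 3 ≤ |x| ^ 4 := pow_le_pow_right₀ h (by norm_num)
    linarith

lemma CenteredNoise.indepFun_lag (h : CenteredNoise μ η κ M) (s : ℕ) :
    IndepFun (η s) (absLag m η s) μ := by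
  refine indepFun_of_measurable_sigmaOf h.meas h.indep (S := {(s : ℤ)})
    (T := Set.Ico ((s : ℤ) - m) s) (by simp) (measurable_sigmaOf (by simp)) ?_
  refine Finset.measurable_sum _ fun i _ =>
    continuous_abs.measurable.comp (measurable_sigmaOf ?_)
  constructor <;> have := i.2 <;> omega

variable [IsProbabilityMeasure μ]

lemma integral_abs_pow_three_le {f : Ω → ℝ} (hf : MemLp f (4 : ℕ) μ) {A : ℝ}
    (hA : ∫ ω, f ω ^ 4 ∂μ ≤ A) :
    Integrable (fun ω => |f ω| ^ 3) μ ∧ ∫ ω, |f ω| ^ 3 ∂μ ≤ 1 + A := by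
  have hi : Integrable (fun ω => |f ω| ^ 3) μ :=
    integrable_pow_of_memLp (f := fun ω => |f ω|) hf.abs (by norm_num)
  refine ⟨hi, (integral_mono hi ((integrable_const (1 : ℝ)).add
    (integrable_pow_of_memLp hf le_rfl)) fun ω => abs_pow_three_le _).trans ?_⟩
  simp only [Pi.add_apply]
  rw [integral_add (integrable_const _) (integrable_pow_of_memLp hf le_rfl)]
  simpa using hA

/-- The third absolute moments of the summands. -/
lemma CenteredNoise.integral_abs_summand_le (h : CenteredNoise μ η κ M)
    (hρ : 0 ≤ ρ) (hw : ∀ s i, |w s i| ≤ ρ) (s : ℕ) :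
    Integrable (fun ω => |η s ω * lagForm w η s ω| ^ 3) μ ∧
    ∫ ω, |η s ω * lagForm w η s ω| ^ 3 ∂μ ≤ ρ ^ 3 * ((1 + M) * (1 + m ^ 4 * M)) := by
  have h1 := integral_abs_pow_three_le (h.memLp s) (h.fourth s)
  have h2 := integral_abs_pow_three_le (h.memLp_absLag (m := m) s) (h.integral_absLag_pow_le s)
  have hind : IndepFun (fun ω => |η s ω| ^ 3) (fun ω => |absLag m η s ω| ^ 3) μ :=
    (h.indepFun_lag s).comp (φ := fun x => |x| ^ 3) (ψ := fun x => |x| ^ 3)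
      (by fun_prop) (by fun_prop)
  have hint : Integrable (fun ω => ρ ^ 3 * (|η s ω| ^ 3 * |absLag m η s ω| ^ 3)) μ :=
    (hind.integrable_mul h1.1 h2.1).const_mul _
  have hle : ∀ ω, |η s ω * lagForm w η s ω| ^ 3 ≤
      ρ ^ 3 * (|η s ω| ^ 3 * |absLag m η s ω| ^ 3) := by
    intro ω
    rw [abs_mul, mul_pow, abs_of_nonneg (absLag_nonneg s ω), mul_left_comm, ← mul_pow ρ]
    have := abs_lagForm_le (η := η) hw s ω
    gcongr
  have hmeas : Measurable fun ω => |η s ω * lagForm w η s ω| ^ 3 :=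
    ((h.meas s).mul (measurable_lagForm h s)).abs.pow_const 3
  have hint' : Integrable (fun ω => |η s ω * lagForm w η s ω| ^ 3) μ := by
    refine hint.mono' hmeas.aestronglyMeasurable (Eventually.of_forall fun ω => ?_)
    rw [Real.norm_of_nonneg (by positivity)]
    exact hle ω
  refine ⟨hint', (integral_mono hint' hint hle).trans ?_⟩
  rw [integral_const_mul, IndepFun.integral_fun_mul_eq_mul_integral hind
    h1.1.aestronglyMeasurable h2.1.aestronglyMeasurable]
  have h3 : 0 ≤ ∫ ω, |absLag m η s ω| ^ 3 ∂μ := integral_nonneg fun ω => by positivity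
  have h4 : 0 ≤ ∫ ω, |η s ω| ^ 3 ∂μ := integral_nonneg fun ω => by positivity
  exact mul_le_mul_of_nonneg_left (mul_le_mul h1.2 h2.2 h3 (h4.trans h1.2)) (by positivity)

/-- Replacing the last `m` summands in the exponent. -/
lemma CenteredNoise.integral_lag_fluctuation_le (h : CenteredNoise μ η κ M) (hρ : 0 ≤ ρ)
    (hw : ∀ s i, |w s i| ≤ ρ) (s : ℕ) :
    ‖∫ ω, (expI (quadForm w η s) ω - expI (quadForm w η (s - m)) ω) *
      ((lagForm w η s ω ^ 2 - κ * ∑ i, w s i ^ 2 : ℝ) : ℂ) ∂μ‖ ≤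
      ρ ^ 3 * (m * ((1 + κ * m) * (1 + M + 2 * (m ^ 4 * M)))) := by
  have hκ : 0 ≤ κ := (integral_nonneg fun ω => sq_nonneg _).trans (h.var 0).le
  have i4 : ∀ r : ℤ, Integrable (fun ω => η r ω ^ 4) μ := fun r =>
    integrable_pow_of_memLp (h.memLp r) le_rfl
  have j4 : ∀ r : ℕ, Integrable (fun ω => absLag m η r ω ^ 4) μ := fun r =>
    integrable_pow_of_memLp (h.memLp_absLag r) le_rfl
  have hpt : ∀ ω, ‖(expI (quadForm w η s) ω - expI (quadForm w η (s - m)) ω) *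
      ((lagForm w η s ω ^ 2 - κ * ∑ i, w s i ^ 2 : ℝ) : ℂ)‖ ≤
      ∑ r ∈ Finset.Ico (s - m) s, ρ ^ 3 * ((1 + κ * m) *
        (1 + η r ω ^ 4 + absLag m η r ω ^ 4 + absLag m η s ω ^ 4)) := by
    intro ω
    have e1 : quadForm w η s ω - quadForm w η (s - m) ω =
        ∑ r ∈ Finset.Ico (s - m) s, η r ω * lagForm w η r ω := by
      rw [Finset.sum_Ico_eq_sub _ (Nat.sub_le s m)]; rfl
    have e2 : |lagForm w η s ω ^ 2 - κ * ∑ i, w s i ^ 2| ≤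
        ρ ^ 2 * (absLag m η s ω ^ 2 + κ * m) := by
      have h1 : lagForm w η s ω ^ 2 ≤ ρ ^ 2 * absLag m η s ω ^ 2 := by
        rw [← mul_pow, ← sq_abs]
        exact pow_le_pow_left₀ (abs_nonneg _) (abs_lagForm_le hw s ω) 2
      have h2 : ∑ i, w s i ^ 2 ≤ m * ρ ^ 2 := by
        calc ∑ i, w s i ^ 2 ≤ ∑ _i : Fin m, ρ ^ 2 := Finset.sum_le_sum fun i _ => by
              rw [← sq_abs]; exact pow_le_pow_left₀ (abs_nonneg _) (hw s i) 2
          _ = m * ρ ^ 2 := by simp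
      have h3 : 0 ≤ ∑ i, w s i ^ 2 := Finset.sum_nonneg fun _ _ => sq_nonneg _
      have h4 := mul_le_mul_of_nonneg_left h2 hκ
      have h5 := mul_nonneg hκ h3
      have h6 := sq_nonneg (lagForm w η s ω)
      have h7 : 0 ≤ ρ ^ 2 * absLag m η s ω ^ 2 := by positivity
      rw [abs_le]
      constructor <;> nlinarith
    rw [norm_mul, Complex.norm_real, Real.norm_eq_abs]
    calc _ ≤ |quadForm w η s ω - quadForm w η (s - m) ω| *
          (ρ ^ 2 * (absLag m η s ω ^ 2 + κ * m)) :=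
          mul_le_mul (norm_cexp_I_sub_le _ _) e2 (abs_nonneg _) (abs_nonneg _)
      _ ≤ (∑ r ∈ Finset.Ico (s - m) s, |η r ω| * (ρ * absLag m η r ω)) *
          (ρ ^ 2 * (absLag m η s ω ^ 2 + κ * m)) := by
          refine mul_le_mul_of_nonneg_right ?_ (by positivity)
          rw [e1]
          refine (Finset.abs_sum_le_sum_abs _ _).trans (Finset.sum_le_sum fun r _ => ?_)
          rw [abs_mul]
          exact mul_le_mul_of_nonneg_left (abs_lagForm_le hw r ω) (abs_nonneg _)
      _ ≤ _ := by
          rw [Finset.sum_mul]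
          refine Finset.sum_le_sum fun r _ => ?_
          have ha := abs_nonneg (η r ω)
          have hb := absLag_nonneg (m := m) (η := η) r ω
          have hc := absLag_nonneg (m := m) (η := η) s ω
          rw [← Even.pow_abs (by decide : Even 4) (η r ω)]
          generalize |η r ω| = a at *
          generalize absLag m η r ω = b at *
          generalize absLag m η s ω = c at *
          have e3 : a * b * c ^ 2 ≤ a ^ 4 + b ^ 4 + c ^ 4 := by
            nlinarith [sq_nonneg (a * b - c ^ 2), sq_nonneg (a ^ 2 - b ^ 2), sq_nonneg (a * b),
              sq_nonneg (c ^ 2), sq_nonneg (a ^ 2 + b ^ 2)]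
          have e4 : a * b ≤ 1 + a ^ 4 + b ^ 4 := by
            nlinarith [sq_nonneg (a * b - 1), sq_nonneg (a ^ 2 - b ^ 2), sq_nonneg (a * b),
              sq_nonneg (a ^ 2 + b ^ 2)]
          have e5 : a * b * (c ^ 2 + κ * m) ≤ (1 + κ * m) * (1 + a ^ 4 + b ^ 4 + c ^ 4) := by
            have hkm : 0 ≤ κ * m := by positivity
            have h1 := mul_le_mul_of_nonneg_left e4 hkm
            have h2 : 0 ≤ κ * m * c ^ 4 := by positivity
            nlinarith
          calc a * (ρ * b) * (ρ ^ 2 * (c ^ 2 + κ * m)) = ρ ^ 3 * (a * b * (c ^ 2 + κ * m)) := by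
                ring
            _ ≤ _ := mul_le_mul_of_nonneg_left e5 (by positivity)
  refine (norm_integral_le_of_norm_le ?_ (Eventually.of_forall hpt)).trans ?_
  · exact integrable_finsetSum _ fun r _ => (((((integrable_const _).add (i4 _)).add
      (j4 _)).add (j4 _)).const_mul _).const_mul _
  · have k1 : ∀ r : ℕ, Integrable (fun ω => 1 + η r ω ^ 4) μ := fun r =>
      (integrable_const _).add (i4 _)
    have k2 : ∀ r : ℕ, Integrable (fun ω => 1 + η r ω ^ 4 + absLag m η r ω ^ 4) μ := fun r =>
      (k1 r).add (j4 _)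
    have k3 : ∀ r : ℕ, Integrable (fun ω => 1 + η r ω ^ 4 + absLag m η r ω ^ 4 +
        absLag m η s ω ^ 4) μ := fun r => (k2 r).add (j4 _)
    rw [integral_finsetSum _ fun r _ => ((k3 r).const_mul _).const_mul _]
    have hM : 0 ≤ M := (integral_nonneg fun ω => by positivity).trans (h.fourth 0)
    calc _ ≤ ∑ r ∈ Finset.Ico (s - m) s, ρ ^ 3 * ((1 + κ * m) * (1 + M + 2 * (m ^ 4 * M))) := by
          refine Finset.sum_le_sum fun r _ => ?_
          rw [integral_const_mul, integral_const_mul, integral_add (k2 r) (j4 _),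
            integral_add (k1 r) (j4 _), integral_add (integrable_const _) (i4 _)]
          have h1 := h.fourth r
          have h2 := h.integral_absLag_pow_le (m := m) r
          have h3 := h.integral_absLag_pow_le (m := m) s
          simp only [integral_const, probReal_univ, smul_eq_mul, mul_one]
          refine mul_le_mul_of_nonneg_left (mul_le_mul_of_nonneg_left ?_ ?_) ?_
          · linarith
          · positivity
          · positivity
      _ = ((Finset.Ico (s - m) s).card : ℝ) *
            (ρ ^ 3 * ((1 + κ * m) * (1 + M + 2 * (m ^ 4 * M)))) := by
          rw [Finset.sum_const, nsmul_eq_mul]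
      _ ≤ m * (ρ ^ 3 * ((1 + κ * m) * (1 + M + 2 * (m ^ 4 * M)))) := by
          refine mul_le_mul_of_nonneg_right ?_ (by positivity)
          rw [Nat.card_Ico]
          exact_mod_cast (by omega : s - (s - m) ≤ m)
      _ = _ := by ring

/-- The constant in the recursion for the characteristic function. -/
noncomputable def recursionConst (κ M : ℝ) (m : ℕ) : ℝ :=
  4 * ((1 + M) * (1 + m ^ 4 * M)) +
    κ / 2 * (m * ((1 + κ * m) * (1 + M + 2 * (m ^ 4 * M)))) + (κ * (κ * m) / 2) ^ 2

lemma CenteredNoise.charFun_step (h : CenteredNoise μ η κ M) (hρ : 0 ≤ ρ) (hρ1 : ρ ≤ 1)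
    (hw : ∀ s i, |w s i| ≤ ρ) (s : ℕ) :
    ‖∫ ω, expI (quadForm w η (s + 1)) ω ∂μ - (∫ ω, expI (quadForm w η s) ω ∂μ) *
      (Real.exp (-(κ * (κ * ∑ i, w s i ^ 2) / 2)) : ℝ)‖ ≤ ρ ^ 3 * recursionConst κ M m := by
  have hκ : 0 ≤ κ := (integral_nonneg fun ω => sq_nonneg _).trans (h.var 0).le
  set T := quadForm w η s with hT
  set T' := quadForm w η (s - m) with hT'
  set L := lagForm w η s with hL
  set l : ℝ := κ * ∑ i, w s i ^ 2 with hl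
  have mT : Measurable T := measurable_quadForm h s
  have mT' : Measurable T' := measurable_quadForm h _
  have mL : Measurable L := measurable_lagForm h s
  have mη : Measurable (η s) := h.meas s
  have iL2 : Integrable (fun ω => L ω ^ 2) μ :=
    integrable_pow_of_memLp (h.memLp_lagForm s) (by norm_num)
  have iη2 : Integrable (fun ω => η s ω ^ 2) μ := integrable_pow_of_memLp (h.memLp s) (by norm_num)
  have iL : Integrable L μ := by
    simpa using integrable_pow_of_memLp (h.memLp_lagForm s) (k := 1) (by norm_num)
  have iη : Integrable (η s) μ := by
    simpa using integrable_pow_of_memLp (h.memLp s) (k := 1) (by norm_num)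
  have mTs : Measurable[sigmaOf η (Set.Iio (s : ℤ))] T :=
    measurable_quadForm_sigmaOf w η s (Or.inr le_rfl)
  have mLs : Measurable[sigmaOf η (Set.Iio (s : ℤ))] L :=
    (measurable_lagForm_sigmaOf w η s).mono (sigmaOf_mono fun r hr => hr.2) le_rfl
  have hdisj : Disjoint (Set.Iio (s : ℤ)) {(s : ℤ)} := by simp
  have indL : IndepFun L (η s) μ :=
    indepFun_of_measurable_sigmaOf h.meas h.indep hdisj mLs (measurable_sigmaOf (by simp))
  have iD : Integrable (fun ω => η s ω * L ω) μ := indL.symm.integrable_mul iη iL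
  have iD2 : Integrable (fun ω => (η s ω * L ω) ^ 2) μ := by
    simp_rw [mul_pow]
    exact ((indL.comp (φ := fun x => x ^ 2) (ψ := fun x => x ^ 2) (by fun_prop)
      (by fun_prop)).symm.integrable_mul iη2 iL2)
  -- the linear term
  have lin : ∫ ω, expI T ω * ((η s ω * L ω : ℝ) : ℂ) ∂μ = 0 := by
    have hi : IndepFun (fun ω => expI T ω * (L ω : ℂ)) (fun ω => (η s ω : ℂ)) μ :=
      indepFun_of_measurable_sigmaOf h.meas h.indep hdisj
        ((measurable_expI mTs).mul (Complex.measurable_ofReal.comp mLs))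
        (Complex.measurable_ofReal.comp (measurable_sigmaOf (by simp)))
    calc _ = ∫ ω, (expI T ω * (L ω : ℂ)) * (η s ω : ℂ) ∂μ := by
          congr 1; ext ω; push_cast; ring
      _ = _ := IndepFun.integral_fun_mul_eq_mul_integral hi
          (integrable_expI_mul mT iL).aestronglyMeasurable iη.ofReal.aestronglyMeasurable
      _ = 0 := by rw [integral_complex_ofReal, h.mean]; simp
  -- the quadratic term
  have quad : ∫ ω, expI T ω * (((η s ω * L ω) ^ 2 : ℝ) : ℂ) ∂μ =
      κ * ∫ ω, expI T ω * ((L ω ^ 2 : ℝ) : ℂ) ∂μ := by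
    have hi : IndepFun (fun ω => expI T ω * ((L ω ^ 2 : ℝ) : ℂ))
        (fun ω => ((η s ω ^ 2 : ℝ) : ℂ)) μ :=
      indepFun_of_measurable_sigmaOf h.meas h.indep hdisj
        ((measurable_expI mTs).mul (Complex.measurable_ofReal.comp (mLs.pow_const 2)))
        (Complex.measurable_ofReal.comp ((measurable_sigmaOf (by simp)).pow_const 2))
    calc _ = ∫ ω, (expI T ω * ((L ω ^ 2 : ℝ) : ℂ)) * ((η s ω ^ 2 : ℝ) : ℂ) ∂μ := by
          congr 1; ext ω; push_cast; ring
      _ = _ := IndepFun.integral_fun_mul_eq_mul_integral hi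
          (integrable_expI_mul mT iL2).aestronglyMeasurable iη2.ofReal.aestronglyMeasurable
      _ = _ := by rw [integral_complex_ofReal, h.var, mul_comm]
  -- decoupling of the last `m` summands
  have dec : ∫ ω, expI T' ω * ((L ω ^ 2 : ℝ) : ℂ) ∂μ = l * ∫ ω, expI T' ω ∂μ := by
    have hi : IndepFun (expI T') (fun ω => ((L ω ^ 2 : ℝ) : ℂ)) μ := by
      refine indepFun_of_measurable_sigmaOf h.meas h.indep (S := Set.Iio ((s : ℤ) - m))
        (T := Set.Ico ((s : ℤ) - m) s) ?_
        (measurable_expI (measurable_quadForm_sigmaOf w η (s - m) (by omega)))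
        (Complex.measurable_ofReal.comp ((measurable_lagForm_sigmaOf w η s).pow_const 2))
      rw [Set.disjoint_left]
      intro r hr hr'
      exact absurd hr'.1 (not_le.2 hr)
    rw [IndepFun.integral_fun_mul_eq_mul_integral hi (integrable_expI mT').aestronglyMeasurable
      iL2.ofReal.aestronglyMeasurable, integral_complex_ofReal, h.integral_lagForm_sq, mul_comm]
  have i1 := integrable_expI (μ := μ) mT
  have i2 := integrable_expI (μ := μ) mT'
  have i3 := integrable_expI_mul (μ := μ) mT iL2
  have i4 := integrable_expI_mul (μ := μ) mT' iL2
  have fluct : ∫ ω, (expI T ω - expI T' ω) * ((L ω ^ 2 - l : ℝ) : ℂ) ∂μ =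
      ∫ ω, expI T ω * ((L ω ^ 2 : ℝ) : ℂ) ∂μ - l * ∫ ω, expI T ω ∂μ := by
    have e : ∀ ω, (expI T ω - expI T' ω) * ((L ω ^ 2 - l : ℝ) : ℂ) =
        expI T ω * ((L ω ^ 2 : ℝ) : ℂ) - l * expI T ω -
          (expI T' ω * ((L ω ^ 2 : ℝ) : ℂ) - l * expI T' ω) := by
      intro ω; push_cast; ring
    simp_rw [e]
    have k1 : Integrable (fun ω => expI T ω * ((L ω ^ 2 : ℝ) : ℂ) - l * expI T ω) μ :=
      i3.sub (i1.const_mul _)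
    have k2 : Integrable (fun ω => expI T' ω * ((L ω ^ 2 : ℝ) : ℂ) - l * expI T' ω) μ :=
      i4.sub (i2.const_mul _)
    rw [integral_sub k1 k2, integral_sub i3 (i1.const_mul _), integral_sub i4 (i2.const_mul _), dec,
      integral_const_mul, integral_const_mul]
    ring
  -- the remainder of the Taylor expansion
  have i5 := integrable_expI_mul (μ := μ) mT iD
  have i6 := integrable_expI_mul (μ := μ) mT iD2
  have i7 := integrable_expI (μ := μ) (measurable_quadForm (w := w) h (s + 1))
  have hstep : ∀ ω, expI (quadForm w η (s + 1)) ω =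
      expI T ω * Complex.exp (Complex.I * ((η s ω * L ω : ℝ) : ℂ)) := by
    intro ω
    have : quadForm w η (s + 1) ω = T ω + η s ω * L ω := Finset.sum_range_succ _ _
    rw [expI, expI, this, ← Complex.exp_add]
    congr 1
    push_cast
    ring
  have rem : ‖∫ ω, expI (quadForm w η (s + 1)) ω ∂μ - ∫ ω, expI T ω ∂μ +
      1 / 2 * ∫ ω, expI T ω * (((η s ω * L ω) ^ 2 : ℝ) : ℂ) ∂μ‖ ≤
      4 * (ρ ^ 3 * ((1 + M) * (1 + m ^ 4 * M))) := by
    have e : ∫ ω, expI (quadForm w η (s + 1)) ω ∂μ - ∫ ω, expI T ω ∂μ +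
        1 / 2 * ∫ ω, expI T ω * (((η s ω * L ω) ^ 2 : ℝ) : ℂ) ∂μ =
        ∫ ω, (expI (quadForm w η (s + 1)) ω - expI T ω -
          Complex.I * (expI T ω * ((η s ω * L ω : ℝ) : ℂ)) +
          1 / 2 * (expI T ω * (((η s ω * L ω) ^ 2 : ℝ) : ℂ))) ∂μ := by
      have k1 : Integrable (fun ω => expI (quadForm w η (s + 1)) ω - expI T ω) μ := i7.sub i1
      have k2 : Integrable (fun ω => expI (quadForm w η (s + 1)) ω - expI T ω -
          Complex.I * (expI T ω * ((η s ω * L ω : ℝ) : ℂ))) μ := k1.sub (i5.const_mul _)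
      rw [integral_add k2 (i6.const_mul _), integral_sub k1 (i5.const_mul _), integral_sub i7 i1, integral_const_mul,
        integral_const_mul, lin]
      ring
    rw [e]
    have h3 := h.integral_abs_summand_le hρ hw s
    refine (norm_integral_le_of_norm_le (h3.1.const_mul 4) (Eventually.of_forall fun ω => ?_)).trans
      ?_
    · have e2 : expI (quadForm w η (s + 1)) ω - expI T ω -
          Complex.I * (expI T ω * ((η s ω * L ω : ℝ) : ℂ)) +
          1 / 2 * (expI T ω * (((η s ω * L ω) ^ 2 : ℝ) : ℂ)) =
          expI T ω * (Complex.exp (Complex.I * ((η s ω * L ω : ℝ) : ℂ)) - 1 -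
            Complex.I * ((η s ω * L ω : ℝ) : ℂ) + ((η s ω * L ω : ℝ) : ℂ) ^ 2 / 2) := by
        rw [hstep]; push_cast; ring
      rw [e2, norm_mul, norm_expI, one_mul]
      exact norm_cexp_I_mul_sub_taylor_le _
    · rw [integral_const_mul]
      exact mul_le_mul_of_nonneg_left h3.2 (by norm_num)
  have hfl := h.integral_lag_fluctuation_le hρ hw s
  rw [← hT, ← hT', ← hL, ← hl, fluct] at hfl
  have hl0 : 0 ≤ l := mul_nonneg hκ (Finset.sum_nonneg fun _ _ => sq_nonneg _)
  have hl1 : l ≤ κ * (m * ρ ^ 2) := by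
    refine mul_le_mul_of_nonneg_left ?_ hκ
    calc ∑ i, w s i ^ 2 ≤ ∑ _i : Fin m, ρ ^ 2 := Finset.sum_le_sum fun i _ => by
          rw [← sq_abs]; exact pow_le_pow_left₀ (abs_nonneg _) (hw s i) 2
      _ = m * ρ ^ 2 := by simp
  have hexp := abs_exp_neg_sub_le (b := κ * l / 2) (by positivity)
  have hexp2 : (κ * l / 2) ^ 2 ≤ ρ ^ 3 * (κ * (κ * m) / 2) ^ 2 := by
    have h1 : κ * l / 2 ≤ ρ ^ 2 * (κ * (κ * m) / 2) := by
      have := mul_le_mul_of_nonneg_left hl1 hκ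
      nlinarith
    calc (κ * l / 2) ^ 2 ≤ (ρ ^ 2 * (κ * (κ * m) / 2)) ^ 2 :=
          pow_le_pow_left₀ (by positivity) h1 2
      _ = ρ ^ 4 * (κ * (κ * m) / 2) ^ 2 := by ring
      _ ≤ ρ ^ 3 * (κ * (κ * m) / 2) ^ 2 := by
          refine mul_le_mul_of_nonneg_right ?_ (by positivity)
          exact pow_le_pow_of_le_one hρ hρ1 (by norm_num)
  have hφ : ‖∫ ω, expI T ω ∂μ‖ ≤ 1 := by
    refine (norm_integral_le_of_norm_le (integrable_const (1 : ℝ))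
      (Eventually.of_forall fun ω => (norm_expI T ω).le)).trans (by simp)
  have final : ∫ ω, expI (quadForm w η (s + 1)) ω ∂μ - (∫ ω, expI T ω ∂μ) *
      (Real.exp (-(κ * l / 2)) : ℝ) =
      (∫ ω, expI (quadForm w η (s + 1)) ω ∂μ - ∫ ω, expI T ω ∂μ +
        1 / 2 * ∫ ω, expI T ω * (((η s ω * L ω) ^ 2 : ℝ) : ℂ) ∂μ) -
      ((κ / 2 : ℝ) : ℂ) * (∫ ω, expI T ω * ((L ω ^ 2 : ℝ) : ℂ) ∂μ - l * ∫ ω, expI T ω ∂μ) -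
      (∫ ω, expI T ω ∂μ) * ((Real.exp (-(κ * l / 2)) - (1 - κ * l / 2) : ℝ) : ℂ) := by
    rw [quad]; push_cast; ring
  rw [final]
  calc _ ≤ 4 * (ρ ^ 3 * ((1 + M) * (1 + m ^ 4 * M))) +
        κ / 2 * (ρ ^ 3 * (m * ((1 + κ * m) * (1 + M + 2 * (m ^ 4 * M))))) +
        1 * (ρ ^ 3 * (κ * (κ * m) / 2) ^ 2) := by
        refine (norm_sub_le _ _).trans (add_le_add ((norm_sub_le _ _).trans
          (add_le_add rem ?_)) ?_)
        · rw [norm_mul, Complex.norm_real, Real.norm_of_nonneg (by positivity)]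
          exact mul_le_mul_of_nonneg_left hfl (by positivity)
        · rw [norm_mul, Complex.norm_real, Real.norm_eq_abs]
          exact mul_le_mul hφ (hexp.trans hexp2) (abs_nonneg _) (by norm_num)
    _ = _ := by rw [recursionConst]; ring

/-- The characteristic function of the quadratic form is close to the Gaussian one. -/
lemma CenteredNoise.norm_charFun_quadForm_sub_le (h : CenteredNoise μ η κ M) (hρ : 0 ≤ ρ)
    (hρ1 : ρ ≤ 1) (hw : ∀ s i, |w s i| ≤ ρ) (n : ℕ) :
    ‖∫ ω, expI (quadForm w η n) ω ∂μ -
      (Real.exp (-∑ s ∈ Finset.range n, κ * (κ * ∑ i, w s i ^ 2) / 2) : ℝ)‖ ≤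
      n * (ρ ^ 3 * recursionConst κ M m) := by
  have hκ : 0 ≤ κ := (integral_nonneg fun ω => sq_nonneg _).trans (h.var 0).le
  refine norm_prod_exp_recursion (f := fun k => ∫ ω, expI (quadForm w η k) ω ∂μ)
    (b := fun s => κ * (κ * ∑ i, w s i ^ 2) / 2) (fun s => ?_) n ?_
    fun s _ => h.charFun_step hρ hρ1 hw s
  · have : 0 ≤ ∑ i, w s i ^ 2 := Finset.sum_nonneg fun _ _ => sq_nonneg _
    positivity
  · simp [expI, quadForm]

end CharFunRecursion

section CentralLimit

variable {Ω : Type*} {mΩ : MeasurableSpace Ω} {μ : Measure Ω}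
  {η : ℤ → Ω → ℝ} {κ M : ℝ} {m : ℕ}

/-- The normalised weighted sample autocovariances of `η`. -/
noncomputable def autocov (w : ℕ → ℕ → Fin m → ℝ) (η : ℤ → Ω → ℝ) (n : ℕ) (i : Fin m) (ω : Ω) :
    ℝ :=
  (√(n : ℝ))⁻¹ * ∑ s ∈ Finset.range n, w n s i * (η s ω * η ((s : ℤ) - ((i : ℕ) + 1)) ω)

lemma CenteredNoise.measurable_autocov (h : CenteredNoise μ η κ M) (w : ℕ → ℕ → Fin m → ℝ)
    (n : ℕ) (i : Fin m) : Measurable (autocov w η n i) :=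
  (Finset.measurable_sum _ fun _ _ => ((h.meas _).mul (h.meas _)).const_mul _).const_mul _

lemma sum_mul_autocov (w : ℕ → ℕ → Fin m → ℝ) (η : ℤ → Ω → ℝ) (n : ℕ) (c : Fin m → ℝ) (ω : Ω) :
    ∑ i, autocov w η n i ω * c i =
      quadForm (fun s i => c i * (√(n : ℝ))⁻¹ * w n s i) η n ω := by
  simp only [autocov, quadForm, lagForm, Finset.mul_sum, Finset.sum_mul]
  rw [Finset.sum_comm]
  refine Finset.sum_congr rfl fun s _ => Finset.sum_congr rfl fun i _ => by ring

variable [IsProbabilityMeasure μ]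

lemma CenteredNoise.tendsto_charFun (h : CenteredNoise μ η κ M) {w : ℕ → ℕ → Fin m → ℝ} {W : ℝ}
    (hW : ∀ n s i, |w n s i| ≤ W)
    (hlim : ∀ i, Tendsto (fun n : ℕ => (n : ℝ)⁻¹ * ∑ s ∈ Finset.range n, κ ^ 2 * w n s i ^ 2)
      atTop (𝓝 1)) (c : Fin m → ℝ) :
    Tendsto (fun n : ℕ => ∫ ω, expI (fun ω => ∑ i, autocov w η n i ω * c i) ω ∂μ) atTop
      (𝓝 ((Real.exp (-(∑ i, c i ^ 2) / 2) : ℝ) : ℂ)) := by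
  simp_rw [sum_mul_autocov]
  set A : ℝ := (∑ i, |c i|) * |W| with hA
  have hA0 : 0 ≤ A := by positivity
  have hw : ∀ (n s : ℕ) (i : Fin m), |c i * (√(n : ℝ))⁻¹ * w n s i| ≤ A * (√(n : ℝ))⁻¹ := by
    intro n s i
    rw [abs_mul, abs_mul, abs_of_nonneg (inv_nonneg.2 (Real.sqrt_nonneg (n : ℝ))), mul_right_comm]
    refine mul_le_mul_of_nonneg_right ?_ (by positivity)
    refine mul_le_mul ?_ ((hW n s i).trans (le_abs_self W)) (abs_nonneg _) (by positivity)
    exact Finset.single_le_sum (f := fun i => |c i|) (fun _ _ => abs_nonneg _) (Finset.mem_univ i)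
  have hr : Tendsto (fun n : ℕ => (√(n : ℝ))⁻¹) atTop (𝓝 0) :=
    tendsto_inv_atTop_zero.comp (Real.tendsto_sqrt_atTop.comp tendsto_natCast_atTop_atTop)
  have hexp : Tendsto (fun n : ℕ => ((Real.exp (-∑ s ∈ Finset.range n,
      κ * (κ * ∑ i, (c i * (√(n : ℝ))⁻¹ * w n s i) ^ 2) / 2) : ℝ) : ℂ)) atTop
      (𝓝 ((Real.exp (-(∑ i, c i ^ 2) / 2) : ℝ) : ℂ)) := by
    refine (Complex.continuous_ofReal.tendsto _).comp ((Real.continuous_exp.tendsto _).comp ?_)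
    have h1 : Tendsto (fun n : ℕ => -(∑ i, c i ^ 2 * ((n : ℝ)⁻¹ *
        ∑ s ∈ Finset.range n, κ ^ 2 * w n s i ^ 2)) / 2) atTop
        (𝓝 (-(∑ i, c i ^ 2 * 1) / 2)) :=
      ((tendsto_finsetSum _ fun i _ => (hlim i).const_mul _).neg).div_const 2
    simp only [mul_one] at h1
    refine h1.congr fun n => ?_
    rw [neg_div, ← Finset.sum_div]
    congr 2
    simp_rw [Finset.mul_sum]
    rw [Finset.sum_comm]
    refine Finset.sum_congr rfl fun s _ => Finset.sum_congr rfl fun i _ => ?_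
    rw [mul_pow, mul_pow, inv_pow, Real.sq_sqrt (Nat.cast_nonneg n)]
    ring
  have hdiff : Tendsto (fun n : ℕ => ∫ ω, expI (quadForm
      (fun s i => c i * (√(n : ℝ))⁻¹ * w n s i) η n) ω ∂μ - ((Real.exp (-∑ s ∈ Finset.range n,
      κ * (κ * ∑ i, (c i * (√(n : ℝ))⁻¹ * w n s i) ^ 2) / 2) : ℝ) : ℂ)) atTop (𝓝 0) := by
    have hb : Tendsto (fun n : ℕ => (√(n : ℝ))⁻¹ * (A ^ 3 * recursionConst κ M m)) atTop
        (𝓝 0) := by simpa using hr.mul_const (A ^ 3 * recursionConst κ M m)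
    have hρ : ∀ᶠ n : ℕ in atTop, A * (√(n : ℝ))⁻¹ ≤ 1 := by
      have : Tendsto (fun n : ℕ => A * (√(n : ℝ))⁻¹) atTop (𝓝 0) := by simpa using hr.const_mul A
      exact this.eventually_le_const (by norm_num)
    refine squeeze_zero_norm' ?_ hb
    filter_upwards [hρ, eventually_gt_atTop 0] with n hn hn0
    refine (h.norm_charFun_quadForm_sub_le (by positivity) hn (hw n) n).trans (le_of_eq ?_)
    have hs : √(n : ℝ) ^ 2 = n := Real.sq_sqrt (Nat.cast_nonneg n)
    have hs0 : √(n : ℝ) ≠ 0 := by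
      have : (0 : ℝ) < n := by exact_mod_cast hn0
      positivity
    rw [← hs]
    rw [Real.sqrt_sq (Real.sqrt_nonneg _)]
    field_simp
  simpa using hdiff.add hexp

/-- Central limit theorem for the sum of squares of the normalised autocovariances. -/
theorem CenteredNoise.tendstoInDistribution_sum_autocov_sq (h : CenteredNoise μ η κ M)
    {w : ℕ → ℕ → Fin m → ℝ} {W : ℝ} (hW : ∀ n s i, |w n s i| ≤ W)
    (hlim : ∀ i, Tendsto (fun n : ℕ => (n : ℝ)⁻¹ * ∑ s ∈ Finset.range n, κ ^ 2 * w n s i ^ 2)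
      atTop (𝓝 1)) :
    TendstoInDistribution (fun (n : ℕ) ω => ∑ i, autocov w η n i ω ^ 2) atTop
      (id : ℝ → ℝ) (fun _ => μ) (chiSquared m) := by
  let Z : ℕ → Ω → EuclideanSpace ℝ (Fin m) := fun n ω => WithLp.toLp 2 fun i => autocov w η n i ω
  have mZ : ∀ n, Measurable (Z n) := fun n =>
    (WithLp.measurable_toLp 2 (Fin m → ℝ)).comp (measurable_pi_iff.2 fun i =>
      h.measurable_autocov w n i)
  have hZ : TendstoInDistribution Z atTop (id : EuclideanSpace ℝ (Fin m) → _) (fun _ => μ)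
      (stdGaussian (EuclideanSpace ℝ (Fin m))) := by
    refine ⟨fun n => (mZ n).aemeasurable, aemeasurable_id, ?_⟩
    refine ProbabilityMeasure.tendsto_iff_tendsto_charFun.2 fun c => ?_
    have h1 := h.tendsto_charFun hW hlim c
    simp only [ProbabilityMeasure.coe_mk, Measure.map_id, charFun_stdGaussian]
    convert! h1 using 2 with n
    · rw [charFun_apply, integral_map (mZ n).aemeasurable (by fun_prop)]
      refine integral_congr_ae (Eventually.of_forall fun ω => ?_)
      simp only [expI]
      rw [mul_comm]
      congr 3
      simp [Z, PiLp.inner_apply, mul_comm]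
    · have e := EuclideanSpace.norm_sq_eq c
      simp only [Real.norm_eq_abs, sq_abs] at e
      rw [← e]
      push_cast
      rfl
  have hS := hZ.continuous_comp (g := fun z : EuclideanSpace ℝ (Fin m) => ∑ i, z i ^ 2)
    (by fun_prop)
  refine ⟨hS.forall_aemeasurable, aemeasurable_id, ?_⟩
  have e : (⟨(chiSquared m).map id, Measure.isProbabilityMeasure_map aemeasurable_id⟩ :
      ProbabilityMeasure ℝ) = ⟨(stdGaussian (EuclideanSpace ℝ (Fin m))).map
        ((fun z : EuclideanSpace ℝ (Fin m) => ∑ i, z i ^ 2) ∘ id),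
        Measure.isProbabilityMeasure_map hS.aemeasurable_limit⟩ := by
    refine Subtype.ext ?_
    simp only [Measure.map_id, Function.comp_id]
    rw [← map_pi_eq_stdGaussian, Measure.map_map (by fun_prop) (by fun_prop)]
    rfl
  rw [e]
  exact hS.tendsto

end CentralLimit

section Volatility

lemma sum_abs_sub_lag_le (a : ℕ → ℝ) (k n : ℕ) :
    ∑ s ∈ Finset.Ico k n, |a s - a (s - k)| ≤
      k * ∑ r ∈ Finset.range (n - 1), |a (r + 1) - a r| := by
  induction k with
  | zero => simp
  | succ k ih =>
    have h1 : ∑ s ∈ Finset.Ico (k + 1) n, |a (s - k) - a (s - (k + 1))| ≤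
        ∑ r ∈ Finset.range (n - 1), |a (r + 1) - a r| := by
      rw [Finset.sum_Ico_eq_sum_range]
      calc _ = ∑ r ∈ Finset.range (n - (k + 1)), |a (r + 1) - a r| := by
            refine Finset.sum_congr rfl fun r _ => ?_
            congr 3 <;> omega
        _ ≤ _ := Finset.sum_le_sum_of_subset_of_nonneg
            (Finset.range_subset_range.2 (by omega)) fun _ _ _ => abs_nonneg _
    have h2 : ∑ s ∈ Finset.Ico (k + 1) n, |a s - a (s - k)| ≤
        ∑ s ∈ Finset.Ico k n, |a s - a (s - k)| :=
      Finset.sum_le_sum_of_subset_of_nonneg (Finset.Ico_subset_Ico (by omega) le_rfl)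
        fun _ _ _ => abs_nonneg _
    calc _ ≤ ∑ s ∈ Finset.Ico (k + 1) n, (|a s - a (s - k)| + |a (s - k) - a (s - (k + 1))|) :=
          Finset.sum_le_sum fun s _ => abs_sub_le _ _ _
      _ ≤ _ := by
          rw [Finset.sum_add_distrib]
          push_cast
          linarith

lemma div_mem_Ioc {n s : ℕ} (hs : s < n) : (((s : ℝ) + 1) / n) ∈ Set.Ioc (0 : ℝ) 1 := by
  have hn : (0 : ℝ) < n := by exact_mod_cast (by omega : 0 < n)
  refine ⟨by positivity, (div_le_one hn).2 ?_⟩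
  exact_mod_cast hs

/-- The samples of a bounded piecewise Lipschitz function have bounded variation. -/
lemma PiecewiseLipschitz.exists_variation_le {g : ℝ → ℝ} (hg : PiecewiseLipschitz g) {C : ℝ}
    (hC : ∀ r ∈ Set.Ioc (0 : ℝ) 1, |g r| ≤ C) :
    ∃ V : ℝ, ∀ n : ℕ, ∑ s ∈ Finset.range (n - 1),
      |g ((((s + 1 : ℕ) : ℝ) + 1) / n) - g (((s : ℝ) + 1) / n)| ≤ V := by
  obtain ⟨N, I, hord, hdisj, hunion, hlip⟩ := hg
  choose K hK using hlip
  have hC0 : 0 ≤ C := (abs_nonneg _).trans (hC 1 (by simp))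
  refine ⟨∑ l, (K l : ℝ) + N * (2 * C), fun n => ?_⟩
  rcases Nat.eq_zero_or_pos n with rfl | hn
  · simp; positivity
  have hn' : (0 : ℝ) < n := by exact_mod_cast hn
  have hmem : ∀ s : ℕ, ∃ l, s < n → ((s : ℝ) + 1) / n ∈ I l := by
    intro s
    by_cases hs : s < n
    · have := div_mem_Ioc hs
      rw [← hunion] at this
      obtain ⟨l, hl⟩ := Set.mem_iUnion.1 this
      exact ⟨l, fun _ => hl⟩
    · have h1 : (1 : ℝ) ∈ ⋃ l, I l := by rw [hunion]; simp
      obtain ⟨l, -⟩ := Set.mem_iUnion.1 h1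
      exact ⟨l, fun h => absurd h hs⟩
  choose l hl using hmem
  set bad := (Finset.range (n - 1)).filter fun s => l s ≠ l (s + 1) with hbad
  have hcard : bad.card ≤ N := by
    have : bad.card ≤ (Finset.univ : Finset (Fin N)).card := by
      refine Finset.card_le_card_of_injOn l (fun _ _ => Finset.mem_univ _) ?_
      have key : ∀ s ∈ bad, ∀ s' ∈ bad, s < s' → l s ≠ l s' := by
        intro s hs s' hs' hlt heq
        rw [hbad, Finset.mem_filter, Finset.mem_range] at hs hs'
        have h1 := hl s (by omega)
        have h2 := hl s' (by omega)
        rw [← heq] at h2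
        have h3 : (((s + 1 : ℕ) : ℝ) + 1) / n ∈ I (l s) := by
          refine (hord (l s)).out h1 h2 ⟨?_, ?_⟩
          · gcongr
            exact_mod_cast Nat.le_succ s
          · gcongr
            exact_mod_cast hlt
        by_contra _
        exact Set.disjoint_left.1 (hdisj hs.2) h3 (hl (s + 1) (by omega))
      intro s hs s' hs' heq
      rcases lt_trichotomy s s' with h | h | h
      · exact absurd heq (key s hs s' hs' h)
      · exact h
      · exact absurd heq.symm (key s' hs' s hs h)
    simpa using this
  have hterm : ∀ s ∈ Finset.range (n - 1),
      |g ((((s + 1 : ℕ) : ℝ) + 1) / n) - g (((s : ℝ) + 1) / n)| ≤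
      (∑ l, (K l : ℝ)) * (n : ℝ)⁻¹ + if l s ≠ l (s + 1) then 2 * C else 0 := by
    intro s hs
    have hs := Finset.mem_range.1 hs
    split_ifs with hls
    · have h1 := hC _ (div_mem_Ioc (n := n) (s := s) (by omega))
      have h2 := hC _ (div_mem_Ioc (n := n) (s := s + 1) (by omega))
      have h3 : 0 ≤ (∑ l, (K l : ℝ)) * (n : ℝ)⁻¹ := by positivity
      have := abs_sub (g ((((s + 1 : ℕ) : ℝ) + 1) / n)) (g (((s : ℝ) + 1) / n))
      linarith
    · rw [not_not] at hls
      have h1 := hl s (by omega)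
      have h2 := hl (s + 1) (by omega)
      rw [← hls] at h2
      have h3 := (hK (l s)).dist_le_mul _ h2 _ h1
      rw [Real.dist_eq, Real.dist_eq] at h3
      have h4 : |(((s + 1 : ℕ) : ℝ) + 1) / n - ((s : ℝ) + 1) / n| = (n : ℝ)⁻¹ := by
        rw [← sub_div]
        push_cast
        rw [show (s : ℝ) + 1 + 1 - (s + 1) = 1 by ring, abs_of_nonneg (by positivity), one_div]
      rw [h4] at h3
      rw [add_zero]
      refine h3.trans (mul_le_mul_of_nonneg_right ?_ (by positivity))
      exact Finset.single_le_sum (f := fun l => (K l : ℝ)) (fun _ _ => NNReal.coe_nonneg _)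
        (Finset.mem_univ _)
  refine (Finset.sum_le_sum hterm).trans ?_
  rw [Finset.sum_add_distrib, ← Finset.sum_filter, Finset.sum_const, Finset.sum_const,
    Finset.card_range, nsmul_eq_mul, nsmul_eq_mul]
  refine add_le_add ?_ ?_
  · have h1 : ((n - 1 : ℕ) : ℝ) * (n : ℝ)⁻¹ ≤ 1 := by
      rw [← div_eq_mul_inv, div_le_one hn']
      exact_mod_cast Nat.sub_le n 1
    have h2 : 0 ≤ ∑ l, (K l : ℝ) := by positivity
    nlinarith
  · exact mul_le_mul_of_nonneg_right (by exact_mod_cast hcard) (by positivity)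

/-- Replacing a lagged factor in an average of fourth powers. -/
lemma tendsto_average_lag_pow_sub {a : ℕ → ℕ → ℝ} {C V : ℝ} (hC : ∀ n s, s < n → |a n s| ≤ C)
    (hV : ∀ n, ∑ r ∈ Finset.range (n - 1), |a n (r + 1) - a n r| ≤ V) (k : ℕ) :
    Tendsto (fun n : ℕ => (n : ℝ)⁻¹ * ∑ s ∈ Finset.range n,
      (if k ≤ s then a n s ^ 2 * a n (s - k) ^ 2 else 0) ^ 2 -
      (n : ℝ)⁻¹ * ∑ s ∈ Finset.range n, a n s ^ 8) atTop (𝓝 0) := by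
  have hlim : Tendsto (fun n : ℕ => (n : ℝ)⁻¹ * (k * C ^ 8 + 4 * C ^ 7 * (k * V))) atTop
      (𝓝 0) := by
    simpa using (tendsto_inv_atTop_nhds_zero_nat (𝕜 := ℝ)).mul_const
      (k * C ^ 8 + 4 * C ^ 7 * (k * V))
  refine squeeze_zero_norm' ?_ hlim
  filter_upwards [eventually_ge_atTop (k + 1)] with n hn
  have hC0 : 0 ≤ C := (abs_nonneg _).trans (hC n 0 (by omega))
  rw [← mul_sub, ← Finset.sum_sub_distrib, norm_mul, Real.norm_of_nonneg (by positivity)]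
  refine mul_le_mul_of_nonneg_left ?_ (by positivity)
  rw [Real.norm_eq_abs]
  refine (Finset.abs_sum_le_sum_abs _ _).trans ?_
  rw [Finset.range_eq_Ico, ← Finset.sum_Ico_consecutive _ (Nat.zero_le k) (by omega : k ≤ n)]
  refine add_le_add ?_ ?_
  · calc _ ≤ ∑ s ∈ Finset.Ico 0 k, C ^ 8 := by
          refine Finset.sum_le_sum fun s hs => ?_
          have := (Finset.mem_Ico.1 hs).2
          rw [if_neg (by omega), zero_pow (by norm_num), zero_sub, abs_neg, abs_pow]
          exact pow_le_pow_left₀ (abs_nonneg _) (hC n s (by omega)) 8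
      _ = k * C ^ 8 := by simp
  · calc _ ≤ ∑ s ∈ Finset.Ico k n, 4 * C ^ 7 * |a n s - a n (s - k)| := by
          refine Finset.sum_le_sum fun s hs => ?_
          have hs := Finset.mem_Ico.1 hs
          rw [if_pos hs.1]
          have h1 := hC n s hs.2
          have h2 := hC n (s - k) (by omega)
          generalize a n s = x at *
          generalize a n (s - k) = y at *
          have e : (x ^ 2 * y ^ 2) ^ 2 - x ^ 8 =
              x ^ 4 * ((y + x) * (y ^ 2 + x ^ 2)) * (y - x) := by ring
          have h3 : |y + x| ≤ 2 * C := (abs_add_le _ _).trans (by linarith)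
          have h4 : |y ^ 2 + x ^ 2| ≤ 2 * C ^ 2 := by
            rw [abs_of_nonneg (by positivity), ← sq_abs x, ← sq_abs y]
            have := pow_le_pow_left₀ (abs_nonneg _) h1 2
            have := pow_le_pow_left₀ (abs_nonneg _) h2 2
            linarith
          have h5 : |x ^ 4| ≤ C ^ 4 := by
            rw [abs_pow]; exact pow_le_pow_left₀ (abs_nonneg _) h1 4
          rw [e, abs_mul, abs_mul, abs_mul, abs_sub_comm y x]
          refine mul_le_mul_of_nonneg_right ?_ (abs_nonneg _)
          calc _ ≤ C ^ 4 * ((2 * C) * (2 * C ^ 2)) := by gcongr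
            _ = _ := by ring
      _ ≤ _ := by
          rw [← Finset.mul_sum]
          refine mul_le_mul_of_nonneg_left ?_ (by positivity)
          exact (sum_abs_sub_lag_le (a n) k n).trans
            (mul_le_mul_of_nonneg_left (hV n) (by positivity))

end Volatility

section Companion

variable {𝕜 : Type*} [Field 𝕜] {p : ℕ}

/-- The coordinates of a vector, continued by zero, as linear forms. -/
def coord (𝕜 : Type*) [Field 𝕜] (p j : ℕ) : (Fin p → 𝕜) →ₗ[𝕜] 𝕜 :=
  if h : j < p then LinearMap.proj ⟨j, h⟩ else 0

lemma coord_of_lt {j : ℕ} (h : j < p) (c : Fin p → 𝕜) : coord 𝕜 p j c = c ⟨j, h⟩ := by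
  simp [coord, h]

lemma coord_val (i : Fin p) (c : Fin p → 𝕜) : coord 𝕜 p i c = c i := coord_of_lt i.2 c

lemma coord_of_le {j : ℕ} (h : p ≤ j) (c : Fin p → 𝕜) : coord 𝕜 p j c = 0 := by
  simp [coord, not_lt.2 h]

/-- The transposed companion matrix: `c₁ x_t + … + c_p x_{t-p+1}` is
`c₁ u_t + (B c)₁ x_{t-1} + … + (B c)_p x_{t-p}` along the autoregression. -/
def companion (a : Fin p → 𝕜) : (Fin p → 𝕜) →ₗ[𝕜] (Fin p → 𝕜) :=
  LinearMap.pi fun i => a i • coord 𝕜 p 0 + coord 𝕜 p ((i : ℕ) + 1)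

lemma companion_apply (a c : Fin p → 𝕜) (i : Fin p) :
    companion a c i = a i * coord 𝕜 p 0 c + coord 𝕜 p ((i : ℕ) + 1) c := rfl

lemma coord_companion_of_coord_zero {a c : Fin p → 𝕜} (h : coord 𝕜 p 0 c = 0) (j : ℕ) :
    coord 𝕜 p j (companion a c) = coord 𝕜 p (j + 1) c := by
  rcases lt_or_ge j p with hj | hj
  · rw [coord_of_lt hj, companion_apply, h, mul_zero, zero_add]
  · rw [coord_of_le hj, coord_of_le (by omega)]

lemma eq_zero_of_forall_coord_pow_companion {a c : Fin p → 𝕜}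
    (h : ∀ j < p, coord 𝕜 p 0 ((companion a ^ j) c) = 0) : c = 0 := by
  have key : ∀ k ≤ p, ∀ j, coord 𝕜 p j ((companion a ^ k) c) = coord 𝕜 p (j + k) c := by
    intro k
    induction k with
    | zero => intro _ j; rfl
    | succ k ih =>
      intro hk j
      rw [pow_succ', Module.End.mul_apply, coord_companion_of_coord_zero (h k (by omega)),
        ih (by omega), Nat.add_right_comm, Nat.add_assoc]
  ext i
  have := key i i.2.le 0
  rw [h i i.2, zero_add, coord_val] at this
  simpa using this.symm

lemma companion_eigenvalue {a v : Fin p → 𝕜} {z : 𝕜} (hz : z ≠ 0) (hv : v ≠ 0)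
    (h : companion a v = z • v) : 1 - ∑ i : Fin p, a i * z⁻¹ ^ ((i : ℕ) + 1) = 0 := by
  have key : ∀ j ≤ p, coord 𝕜 p j v = coord 𝕜 p 0 v * (z ^ j *
      (1 - ∑ i ∈ Finset.range j, coord 𝕜 p i a * z⁻¹ ^ (i + 1))) := by
    intro j
    induction j with
    | zero => simp
    | succ j ih =>
      intro hj
      have e := congrFun h ⟨j, hj⟩
      rw [companion_apply, Pi.smul_apply, smul_eq_mul, ← coord_of_lt hj a, ← coord_of_lt hj v,
        ih (by omega)] at e
      have hzj : z ^ (j + 1) * z⁻¹ ^ (j + 1) = 1 := by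
        rw [← mul_pow, mul_inv_cancel₀ hz, one_pow]
      rw [Finset.sum_range_succ, eq_sub_of_add_eq' e]
      linear_combination (coord 𝕜 p 0 v * coord 𝕜 p j a) * hzj
  have h1 := key p le_rfl
  rw [coord_of_le le_rfl, Finset.sum_range (fun i => coord 𝕜 p i a * z⁻¹ ^ (i + 1))] at h1
  simp only [coord_val] at h1
  rcases mul_eq_zero.1 h1.symm with h2 | h2
  · refine absurd ?_ hv
    ext i
    rw [← coord_val i v, key i i.2.le, h2, zero_mul]; rfl
  · exact (mul_eq_zero.1 h2).resolve_left (pow_ne_zero _ hz)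

/-- The linear combination `c₁ x_t + … + c_p x_{t-p+1}`. -/
def lagComb (c : Fin p → 𝕜) (x : ℤ → 𝕜) (t : ℤ) : 𝕜 := ∑ i, c i * x (t - (i : ℕ))

lemma lagComb_eq_sum_range (c : Fin p → 𝕜) (x : ℤ → 𝕜) (t : ℤ) {k : ℕ} (hk : p ≤ k) :
    lagComb c x t = ∑ j ∈ Finset.range k, coord 𝕜 p j c * x (t - j) := by
  rw [← Finset.sum_subset (Finset.range_subset_range.2 hk), Finset.sum_range
    (fun j => coord 𝕜 p j c * x (t - j))]
  · simp only [coord_val]; rfl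
  · intro j _ hj
    rw [coord_of_le (by simpa using hj), zero_mul]

lemma lagComb_step {a : Fin p → 𝕜} {x u : ℤ → 𝕜} {t : ℤ}
    (h : x t = ∑ i : Fin p, a i * x (t - ((i : ℕ) + 1)) + u t) (c : Fin p → 𝕜) :
    lagComb c x t = coord 𝕜 p 0 c * u t + lagComb (companion a c) x (t - 1) := by
  rw [lagComb_eq_sum_range c x t (Nat.le_succ p), Finset.sum_range_succ', Nat.cast_zero, sub_zero,
    h, lagComb]
  simp only [companion_apply, add_mul, Finset.sum_add_distrib]
  rw [Finset.sum_range (fun j => coord 𝕜 p (j + 1) c * x (t - ((j + 1 : ℕ) : ℤ))), mul_add,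
    Finset.mul_sum]
  have e1 : ∀ i : Fin p, coord 𝕜 p 0 c * (a i * x (t - ((i : ℕ) + 1))) =
      a i * coord 𝕜 p 0 c * x (t - 1 - (i : ℕ)) := by
    intro i
    rw [show t - (((i : ℕ) : ℤ) + 1) = t - 1 - (i : ℕ) by ring]; ring
  have e2 : ∀ i : Fin p, t - (((i : ℕ) + 1 : ℕ) : ℤ) = t - 1 - (i : ℕ) := by
    intro i; push_cast; ring
  simp only [e1, e2]
  ring

lemma lagComb_iterate {a : Fin p → 𝕜} {x u : ℤ → 𝕜} {n : ℕ}
    (h : ∀ t : ℤ, 1 ≤ t → t ≤ n → x t = ∑ i : Fin p, a i * x (t - ((i : ℕ) + 1)) + u t)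
    (k : ℕ) (hk : k ≤ n) (c : Fin p → 𝕜) :
    lagComb c x k = ∑ j ∈ Finset.range k, coord 𝕜 p 0 ((companion a ^ j) c) * u ((k : ℤ) - j) +
      lagComb ((companion a ^ k) c) x 0 := by
  induction k generalizing c with
  | zero => simp
  | succ k ih =>
    rw [lagComb_step (h ((k + 1 : ℕ) : ℤ) (by push_cast; omega) (by exact_mod_cast hk)) c,
      Finset.sum_range_succ', show ((k + 1 : ℕ) : ℤ) - 1 = (k : ℤ) by push_cast; ring,
      ih (by omega)]
    simp only [pow_succ, Module.End.mul_apply, pow_zero, Module.End.one_apply, Nat.cast_zero,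
      sub_zero]
    have e : ∀ j : ℕ, ((k + 1 : ℕ) : ℤ) - ((j + 1 : ℕ) : ℤ) = (k : ℤ) - j := by
      intro j; push_cast; ring
    simp only [e]
    ring

end Companion

section Stability

variable {p : ℕ}

lemma summable_norm_pow_companion_complex {a : Fin p → ℂ}
    (ha : ∀ z : ℂ, ‖z‖ ≤ 1 → 1 - ∑ i : Fin p, a i * z ^ ((i : ℕ) + 1) ≠ 0) (c : Fin p → ℂ) :
    Summable fun k : ℕ => ‖(companion a ^ k) c‖ := by
  rcases Nat.eq_zero_or_pos p with rfl | hp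
  · have : ∀ k : ℕ, ‖(companion a ^ k) c‖ = 0 := fun k => by
      rw [Subsingleton.elim ((companion a ^ k) c) 0, norm_zero]
    simp only [this]
    exact summable_zero
  have : Nonempty (Fin p) := ⟨⟨0, hp⟩⟩
  let Φ := Module.End.toContinuousLinearMap (𝕜 := ℂ) (Fin p → ℂ)
  set T : (Fin p → ℂ) →L[ℂ] (Fin p → ℂ) := Φ (companion a) with hT
  have hspec : spectralRadius ℂ T < (1 : ℝ≥0) := by
    refine spectrum.spectralRadius_lt_of_forall_lt T fun z hz => ?_
    rw [hT, AlgEquiv.spectrum_eq, ← Module.End.hasEigenvalue_iff_mem_spectrum] at hz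
    obtain ⟨v, hv⟩ := hz.exists_hasEigenvector
    by_contra hcon
    have hz1 : 1 ≤ ‖z‖ := by
      have := not_lt.1 hcon
      exact_mod_cast this
    have hz0 : z ≠ 0 := by
      rintro rfl
      norm_num at hz1
    refine ha z⁻¹ ?_ (companion_eigenvalue hz0 hv.2 hv.apply_eq_smul)
    rw [norm_inv]
    exact inv_le_one_of_one_le₀ hz1
  obtain ⟨r, hr1, hr2⟩ := ENNReal.lt_iff_exists_nnreal_btwn.1 hspec
  have hr2' : r < 1 := by exact_mod_cast hr2
  have hev := (spectrum.pow_nnnorm_pow_one_div_tendsto_nhds_spectralRadius T).eventually_lt_const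
    hr1
  have hsum : Summable fun k : ℕ => (r : ℝ) ^ k * ‖c‖ :=
    (summable_geometric_of_lt_one r.2 (by exact_mod_cast hr2')).mul_right _
  refine Summable.of_norm_bounded_eventually_nat hsum ?_
  filter_upwards [hev, eventually_gt_atTop 0] with k hk hk0
  have h1 : ((‖T ^ k‖₊ : ℝ≥0∞)) ≤ (r : ℝ≥0∞) ^ k := by
    have hk' : (0 : ℝ) < k := by exact_mod_cast hk0
    have h2 := ENNReal.rpow_le_rpow hk.le hk'.le
    rw [← ENNReal.rpow_mul, one_div, inv_mul_cancel₀ hk'.ne', ENNReal.rpow_one,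
      ENNReal.rpow_natCast] at h2
    exact h2
  have h2 : ‖T ^ k‖ ≤ (r : ℝ) ^ k := by exact_mod_cast h1
  have h3 : (companion a ^ k) c = (T ^ k) c := by
    rw [hT, ← map_pow]; rfl
  rw [norm_norm, h3]
  exact ((T ^ k).le_opNorm c).trans (mul_le_mul_of_nonneg_right h2 (norm_nonneg _))

lemma ofReal_pow_companion (a c : Fin p → ℝ) (k : ℕ) :
    (companion (fun i => (a i : ℂ)) ^ k) (fun i => (c i : ℂ)) =
      fun i => (((companion a ^ k) c i : ℝ) : ℂ) := by
  induction k with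
  | zero => rfl
  | succ k ih =>
    rw [pow_succ', pow_succ', Module.End.mul_apply, Module.End.mul_apply, ih]
    have e : ∀ (j : ℕ) (d : Fin p → ℝ), coord ℂ p j (fun i => (d i : ℂ)) = (coord ℝ p j d : ℝ) := by
      intro j d
      rcases lt_or_ge j p with hj | hj
      · rw [coord_of_lt hj, coord_of_lt hj]
      · rw [coord_of_le hj, coord_of_le hj, Complex.ofReal_zero]
    ext i
    rw [companion_apply, companion_apply, e, e]
    push_cast
    ring

/-- The powers of the companion matrix of a stable autoregression are summable. -/
lemma summable_norm_pow_companion {a : Fin p → ℝ}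
    (ha : ∀ z : ℂ, ‖z‖ ≤ 1 → 1 - ∑ i : Fin p, (a i : ℂ) * z ^ ((i : ℕ) + 1) ≠ 0)
    (c : Fin p → ℝ) : Summable fun k : ℕ => ‖(companion a ^ k) c‖ := by
  refine (summable_norm_pow_companion_complex ha fun i => (c i : ℂ)).congr fun k => ?_
  rw [ofReal_pow_companion]
  simp [Pi.norm_def]

/-- A quadratic form which almost dominates its pull-back by the companion matrix plus the square
of the first coordinate is positive definite. -/
lemma exists_quadratic_lower_bound (a : Fin p → ℝ) {σ : ℝ} (hσ : 0 < σ) :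
    ∃ e τ : ℝ, 0 < e ∧ 0 < τ ∧ ∀ q : (Fin p → ℝ) → ℝ, (∀ c, 0 ≤ q c) →
      (∀ c, q (companion a c) + σ * coord ℝ p 0 c ^ 2 - τ * ‖c‖ ^ 2 ≤ q c) →
      ∀ c, e * ‖c‖ ^ 2 ≤ q c := by
  let Ψ : (Fin p → ℝ) →ₗ[ℝ] (Fin p → ℝ) :=
    LinearMap.pi fun j => coord ℝ p 0 ∘ₗ (companion a ^ (j : ℕ))
  have hker : LinearMap.ker Ψ = ⊥ := by
    refine (LinearMap.ker_eq_bot').2 fun c hc => ?_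
    refine eq_zero_of_forall_coord_pow_companion (a := a) fun j hj => ?_
    exact congrFun hc ⟨j, hj⟩
  obtain ⟨K, hK0, hK⟩ := Ψ.exists_antilipschitzWith hker
  have hΨ : ∀ c, ‖c‖ ^ 2 ≤ (K : ℝ) ^ 2 * ∑ j ∈ Finset.range p,
      coord ℝ p 0 ((companion a ^ j) c) ^ 2 := by
    intro c
    have h1 : ‖c‖ ≤ K * ‖Ψ c‖ := by
      have := hK.le_mul_dist c 0
      simpa using this
    have h2 : ‖Ψ c‖ ^ 2 ≤ ∑ j ∈ Finset.range p, coord ℝ p 0 ((companion a ^ j) c) ^ 2 := by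
      rw [Finset.sum_range (fun j => coord ℝ p 0 ((companion a ^ j) c) ^ 2)]
      refine (Real.le_sqrt (norm_nonneg _) (Finset.sum_nonneg fun _ _ => sq_nonneg _)).1
        ((pi_norm_le_iff_of_nonneg (Real.sqrt_nonneg _)).2 fun j => Real.le_sqrt_of_sq_le ?_)
      rw [Real.norm_eq_abs, sq_abs]
      exact Finset.single_le_sum (f := fun j : Fin p => coord ℝ p 0 ((companion a ^ (j : ℕ)) c) ^ 2)
        (fun _ _ => sq_nonneg _) (Finset.mem_univ j)
    calc ‖c‖ ^ 2 ≤ (K * ‖Ψ c‖) ^ 2 := pow_le_pow_left₀ (norm_nonneg _) h1 2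
      _ = (K : ℝ) ^ 2 * ‖Ψ c‖ ^ 2 := by ring
      _ ≤ _ := mul_le_mul_of_nonneg_left h2 (by positivity)
  let T : (Fin p → ℝ) →L[ℝ] (Fin p → ℝ) := LinearMap.toContinuousLinearMap (companion a)
  set L : ℝ := ∑ j ∈ Finset.range p, (‖T‖ ^ j) ^ 2 with hL
  have hT : ∀ (j : ℕ) (c : Fin p → ℝ), ‖(companion a ^ j) c‖ ≤ ‖T‖ ^ j * ‖c‖ := by
    intro j c
    induction j with
    | zero => simp
    | succ j ih =>
      rw [pow_succ', Module.End.mul_apply, pow_succ', mul_assoc]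
      exact (T.le_opNorm _).trans (mul_le_mul_of_nonneg_left ih (norm_nonneg _))
  have hL0 : 0 ≤ L := Finset.sum_nonneg fun _ _ => sq_nonneg _
  have hK0' : (0 : ℝ) < K := hK0
  refine ⟨σ / K ^ 2 / 2, σ / K ^ 2 / 2 / (L + 1), by positivity, by positivity,
    fun q hq0 hq c => ?_⟩
  set τ : ℝ := σ / K ^ 2 / 2 / (L + 1) with hτ
  have hτ0 : 0 < τ := by positivity
  have iter : ∀ k : ℕ, q ((companion a ^ k) c) + ∑ j ∈ Finset.range k,
      (σ * coord ℝ p 0 ((companion a ^ j) c) ^ 2 - τ * ‖(companion a ^ j) c‖ ^ 2) ≤ q c := by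
    intro k
    induction k with
    | zero => simp
    | succ k ih =>
      have := hq ((companion a ^ k) c)
      rw [Finset.sum_range_succ, pow_succ', Module.End.mul_apply]
      linarith
  have h1 := iter p
  rw [Finset.sum_sub_distrib, ← Finset.mul_sum, ← Finset.mul_sum] at h1
  have h2 : ∑ j ∈ Finset.range p, ‖(companion a ^ j) c‖ ^ 2 ≤ L * ‖c‖ ^ 2 := by
    rw [hL, Finset.sum_mul]
    refine Finset.sum_le_sum fun j _ => ?_
    rw [← mul_pow]
    exact pow_le_pow_left₀ (norm_nonneg _) (hT j c) 2
  have h3 := hq0 ((companion a ^ p) c)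
  have h4 := mul_le_mul_of_nonneg_left h2 hτ0.le
  have h5 : σ / K ^ 2 * ‖c‖ ^ 2 ≤ σ * ∑ j ∈ Finset.range p,
      coord ℝ p 0 ((companion a ^ j) c) ^ 2 := by
    rw [div_mul_eq_mul_div, div_le_iff₀ (by positivity), mul_assoc]
    refine mul_le_mul_of_nonneg_left ?_ hσ.le
    rw [mul_comm]
    exact hΨ c
  have h6 : τ * (L * ‖c‖ ^ 2) ≤ σ / K ^ 2 / 2 * ‖c‖ ^ 2 := by
    have e : τ * (L + 1) = σ / K ^ 2 / 2 := by
      rw [hτ, div_mul_cancel₀ _ (by positivity)]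
    have h7 : τ * L ≤ σ / K ^ 2 / 2 := by nlinarith
    calc τ * (L * ‖c‖ ^ 2) = τ * L * ‖c‖ ^ 2 := by ring
      _ ≤ _ := mul_le_mul_of_nonneg_right h7 (sq_nonneg _)
  linarith

end Stability

section LawOfLargeNumbers

variable {Ω : Type*} {mΩ : MeasurableSpace Ω} {μ : Measure Ω}

lemma tendsto_inProb_of_tendsto_integral_abs {X : ℕ → Ω → ℝ} (hX : ∀ n, Integrable (X n) μ)
    (h : Tendsto (fun n => ∫ ω, |X n ω| ∂μ) atTop (𝓝 0)) :
    Tendsto (fun q : ℕ × Ω => X q.1 q.2) (inProb μ) (𝓝 0) := by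
  refine tendsto_inProb_zero_iff.2 fun e he => ?_
  have h1 : TendstoInMeasure μ X atTop (0 : Ω → ℝ) := by
    refine tendstoInMeasure_of_tendsto_eLpNorm one_ne_zero
      (fun n => (hX n).aestronglyMeasurable) aestronglyMeasurable_zero ?_
    have e1 : ∀ n, eLpNorm (X n - 0) 1 μ = ENNReal.ofReal (∫ ω, |X n ω| ∂μ) := by
      intro n
      rw [sub_zero, eLpNorm_one_eq_lintegral_enorm, ← ofReal_integral_norm_eq_lintegral_enorm (hX n)]
      rfl
    simp_rw [e1]
    simpa [Function.comp_def] using (ENNReal.continuous_ofReal.tendsto 0).comp h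
  have h2 := tendstoInMeasure_iff_norm.1 h1 e he
  simpa using h2

variable [IsProbabilityMeasure μ]

lemma integral_abs_average_sub_le {ζ : ℕ → Ω → ℝ} (hm : ∀ s, Measurable (ζ s))
    (hind : Pairwise fun r s => IndepFun (ζ r) (ζ s) μ) {M : ℝ} (hM : ∀ s ω, |ζ s ω| ≤ M)
    {w : ℕ → ℝ} {W : ℝ} (hw : ∀ s, |w s| ≤ W) {e : ℝ} (he : 0 < e) (n : ℕ) (hn : 0 < n) :
    ∫ ω, |(n : ℝ)⁻¹ * ∑ s ∈ Finset.range n, w s * (ζ s ω - ∫ ω', ζ s ω' ∂μ)| ∂μ ≤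
      e + (n : ℝ)⁻¹ * (W * M) ^ 2 / e := by
  have hL : ∀ s, MemLp (ζ s) 2 μ := fun s =>
    MemLp.of_bound (hm s).aestronglyMeasurable M (Eventually.of_forall (hM s))
  have hLw : ∀ s, MemLp (fun ω => w s * ζ s ω) 2 μ := fun s => (hL s).const_mul _
  set S : Ω → ℝ := ∑ s ∈ Finset.range n, fun ω => w s * ζ s ω with hS
  have hS2 : MemLp S 2 μ := memLp_finsetSum' _ fun s _ => hLw s
  have hES : ∫ ω, S ω ∂μ = ∑ s ∈ Finset.range n, w s * ∫ ω, ζ s ω ∂μ := by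
    simp only [hS, Finset.sum_apply]
    rw [integral_finsetSum _ fun s _ => (hLw s).integrable (by norm_num)]
    simp_rw [integral_const_mul]
  have hY : ∀ ω, (n : ℝ)⁻¹ * ∑ s ∈ Finset.range n, w s * (ζ s ω - ∫ ω', ζ s ω' ∂μ) =
      (n : ℝ)⁻¹ * (S ω - ∫ ω', S ω' ∂μ) := by
    intro ω
    rw [hES, hS, Finset.sum_apply, ← Finset.sum_sub_distrib]
    simp_rw [mul_sub]
  have hvar : ∫ ω, (S ω - ∫ ω', S ω' ∂μ) ^ 2 ∂μ ≤ n * (W * M) ^ 2 := by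
    rw [← variance_eq_integral hS2.aemeasurable, hS, IndepFun.variance_sum (fun s _ => hLw s)]
    · calc _ ≤ ∑ s ∈ Finset.range n, (W * M) ^ 2 := by
            refine Finset.sum_le_sum fun s _ => ?_
            refine (variance_le_expectation_sq (hLw s).aestronglyMeasurable).trans ?_
            refine (integral_mono (hLw s).integrable_sq (integrable_const ((W * M) ^ 2))
              fun ω => ?_).trans (by simp)
            change (w s * ζ s ω) ^ 2 ≤ _
            rw [← sq_abs, abs_mul]
            exact pow_le_pow_left₀ (by positivity) (mul_le_mul (hw s) (hM s ω) (abs_nonneg _)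
              ((abs_nonneg _).trans (hw s))) 2
        _ = _ := by simp
    · intro r _ s _ hrs
      exact (hind hrs).comp (measurable_const_mul (w r)) (measurable_const_mul (w s))
  have hint : Integrable (fun ω => (S ω - ∫ ω', S ω' ∂μ) ^ 2) μ :=
    (hS2.sub (memLp_const _)).integrable_sq
  have hn' : (0 : ℝ) < n := by exact_mod_cast hn
  simp_rw [hY]
  have hi1 : Integrable (fun ω => |(n : ℝ)⁻¹ * (S ω - ∫ ω', S ω' ∂μ)|) μ :=
    (((hS2.integrable (by norm_num)).sub (integrable_const _)).const_mul _).abs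
  have hi2 : Integrable (fun ω => e + ((n : ℝ)⁻¹ ^ 2 / e) * (S ω - ∫ ω', S ω' ∂μ) ^ 2) μ :=
    (integrable_const _).add (hint.const_mul _)
  refine (integral_mono hi1 hi2 fun ω => ?_).trans ?_
  · set y := (n : ℝ)⁻¹ * (S ω - ∫ ω', S ω' ∂μ) with hy
    have e1 : ((n : ℝ)⁻¹ ^ 2 / e) * (S ω - ∫ ω', S ω' ∂μ) ^ 2 = y ^ 2 / e := by
      rw [hy]; ring
    simp only [e1]
    rw [← sq_abs y, ← sub_le_iff_le_add', le_div_iff₀ he]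
    nlinarith [abs_nonneg y, sq_nonneg (|y| - e)]
  · rw [integral_add (integrable_const _) (hint.const_mul _), integral_const_mul]
    simp only [integral_const, probReal_univ, smul_eq_mul, one_mul]
    refine add_le_add le_rfl ?_
    calc _ ≤ (n : ℝ)⁻¹ ^ 2 / e * (n * (W * M) ^ 2) :=
          mul_le_mul_of_nonneg_left hvar (by positivity)
      _ = _ := by field_simp

/-- Weak law of large numbers with bounded weights. -/
theorem tendsto_inProb_weighted_average {ξ : ℕ → Ω → ℝ} (hm : ∀ s, Measurable (ξ s))
    (hind : Pairwise fun r s => IndepFun (ξ r) (ξ s) μ)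
    (hid : ∀ s, IdentDistrib (ξ s) (ξ 0) μ μ) (hint : Integrable (ξ 0) μ)
    {w : ℕ → ℕ → ℝ} {W : ℝ} (hw : ∀ n s, |w n s| ≤ W) :
    Tendsto (fun q : ℕ × Ω => (q.1 : ℝ)⁻¹ * ∑ s ∈ Finset.range q.1,
      w q.1 s * (ξ s q.2 - ∫ ω, ξ 0 ω ∂μ)) (inProb μ) (𝓝 0) := by
  have hints : ∀ s, Integrable (ξ s) μ := fun s => (hid s).integrable_iff.2 hint
  refine tendsto_inProb_of_tendsto_integral_abs
    (X := fun n ω => (n : ℝ)⁻¹ * ∑ s ∈ Finset.range n, w n s * (ξ s ω - ∫ ω', ξ 0 ω' ∂μ))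
    (fun n => (integrable_finsetSum _ fun s _ =>
      ((hints s).sub (integrable_const _)).const_mul _).const_mul _) ?_
  have hW0 : 0 ≤ W := (abs_nonneg _).trans (hw 0 0)
  -- truncation
  let f : ℝ → ℝ → ℝ := fun M x => if |x| ≤ M then x else 0
  have hf : ∀ M, Measurable (f M) := fun M =>
    Measurable.ite (measurableSet_le measurable_norm measurable_const) measurable_id
      measurable_const
  have hfb : ∀ M, 0 ≤ M → ∀ x, |f M x| ≤ M := by
    intro M hM x
    by_cases h : |x| ≤ M <;> simp [f, h, hM]
  have htr : Tendsto (fun M : ℕ => ∫ ω, |ξ 0 ω - f M (ξ 0 ω)| ∂μ) atTop (𝓝 0) := by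
    have : Tendsto (fun M : ℕ => ∫ ω, |ξ 0 ω - f M (ξ 0 ω)| ∂μ) atTop (𝓝 (∫ _, (0 : ℝ) ∂μ)) := by
      refine tendsto_integral_of_dominated_convergence (fun ω => |ξ 0 ω|)
        (fun M => ((hm 0).sub ((hf M).comp (hm 0))).abs.aestronglyMeasurable)
        hint.abs (fun M => Eventually.of_forall fun ω => ?_) (Eventually.of_forall fun ω => ?_)
      · by_cases h : |ξ 0 ω| ≤ M <;> simp [f, h]
      · refine tendsto_const_nhds.congr' ?_
        obtain ⟨N, hN⟩ := exists_nat_ge |ξ 0 ω|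
        filter_upwards [eventually_ge_atTop N] with M hM
        have : |ξ 0 ω| ≤ M := hN.trans (by exact_mod_cast hM)
        simp [f, this]
    simpa using this
  rw [Metric.tendsto_atTop']
  intro e he
  obtain ⟨M, hM⟩ := (htr.eventually_lt_const
    (show (0 : ℝ) < e / (8 * (W + 1)) by positivity)).exists
  set d := ∫ ω, |ξ 0 ω - f M (ξ 0 ω)| ∂μ with hd
  have hlim : Tendsto (fun n : ℕ => e / 4 + (n : ℝ)⁻¹ * (W * M) ^ 2 / (e / 4)) atTop
      (𝓝 (e / 4 + 0 * (W * M) ^ 2 / (e / 4))) :=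
    (((tendsto_inv_atTop_nhds_zero_nat (𝕜 := ℝ)).mul_const _).div_const _).const_add _
  have hev := (hlim.eventually_lt_const (show e / 4 + 0 * (W * M) ^ 2 / (e / 4) < e / 2 by
    rw [zero_mul, zero_div, add_zero]; linarith)).and (eventually_gt_atTop 0)
  obtain ⟨N, hN⟩ := eventually_atTop.1 hev
  refine ⟨N, fun n hn => ?_⟩
  obtain ⟨hn1, hn0⟩ := hN n hn.le
  have hn' : (0 : ℝ) < n := by exact_mod_cast hn0
  have hfi : ∀ s, Integrable (fun ω => f M (ξ s ω)) μ := fun s =>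
    (MemLp.of_bound ((hf M).comp (hm s)).aestronglyMeasurable (M : ℝ)
      (Eventually.of_forall fun ω => hfb M (Nat.cast_nonneg M) _) : MemLp _ 1 μ).integrable le_rfl
  have hds : ∀ s, ∫ ω, |ξ s ω - f M (ξ s ω)| ∂μ = d := fun s =>
    ((hid s).comp (u := fun x => |x - f M x|) ((measurable_id.sub (hf M)).abs)).integral_eq
  have hEξ : ∀ s, ∫ ω, ξ s ω ∂μ = ∫ ω, ξ 0 ω ∂μ := fun s => (hid s).integral_eq
  have hB := integral_abs_average_sub_le (μ := μ) (ζ := fun s ω => f M (ξ s ω))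
    (fun s => (hf M).comp (hm s)) (fun r s hrs => (hind hrs).comp (hf M) (hf M))
    (fun s ω => hfb M (Nat.cast_nonneg M) _) (hw n) (show 0 < e / 4 by positivity) n hn0
  have hdec : ∀ ω, |(n : ℝ)⁻¹ * ∑ s ∈ Finset.range n, w n s * (ξ s ω - ∫ ω', ξ 0 ω' ∂μ)| ≤
      |(n : ℝ)⁻¹ * ∑ s ∈ Finset.range n, w n s * (f M (ξ s ω) - ∫ ω', f M (ξ s ω') ∂μ)| +
      (n : ℝ)⁻¹ * ∑ s ∈ Finset.range n, W * (|ξ s ω - f M (ξ s ω)| + d) := by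
    intro ω
    have e1 : (n : ℝ)⁻¹ * ∑ s ∈ Finset.range n, w n s * (ξ s ω - ∫ ω', ξ 0 ω' ∂μ) =
        (n : ℝ)⁻¹ * ∑ s ∈ Finset.range n, w n s * (f M (ξ s ω) - ∫ ω', f M (ξ s ω') ∂μ) +
        (n : ℝ)⁻¹ * ∑ s ∈ Finset.range n, w n s * ((ξ s ω - f M (ξ s ω)) -
          ∫ ω', (ξ s ω' - f M (ξ s ω')) ∂μ) := by
      rw [← mul_add, ← Finset.sum_add_distrib]
      congr 1
      refine Finset.sum_congr rfl fun s _ => ?_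
      rw [integral_sub (hints s) (hfi s), hEξ s]
      ring
    rw [e1]
    refine (abs_add_le _ _).trans (add_le_add le_rfl ?_)
    rw [abs_mul, abs_of_nonneg (by positivity : (0 : ℝ) ≤ (n : ℝ)⁻¹)]
    refine mul_le_mul_of_nonneg_left ((Finset.abs_sum_le_sum_abs _ _).trans
      (Finset.sum_le_sum fun s _ => ?_)) (by positivity)
    rw [abs_mul]
    refine mul_le_mul (hw n s) ((abs_sub _ _).trans (add_le_add le_rfl ?_)) (abs_nonneg _) hW0
    rw [← hds s]
    exact abs_integral_le_integral_abs
  have hi1 : Integrable (fun ω => |(n : ℝ)⁻¹ * ∑ s ∈ Finset.range n,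
      w n s * (ξ s ω - ∫ ω', ξ 0 ω' ∂μ)|) μ :=
    ((integrable_finsetSum _ fun s _ =>
      ((hints s).sub (integrable_const _)).const_mul _).const_mul _).abs
  have hi2 : Integrable (fun ω => |(n : ℝ)⁻¹ * ∑ s ∈ Finset.range n,
      w n s * (f M (ξ s ω) - ∫ ω', f M (ξ s ω') ∂μ)|) μ :=
    ((integrable_finsetSum _ fun s _ =>
      ((hfi s).sub (integrable_const _)).const_mul _).const_mul _).abs
  have hi3 : ∀ s, Integrable (fun ω => W * (|ξ s ω - f M (ξ s ω)| + d)) μ := fun s =>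
    (((hints s).sub (hfi s)).abs.add (integrable_const _)).const_mul _
  have hi4 : Integrable (fun ω => (n : ℝ)⁻¹ * ∑ s ∈ Finset.range n,
      W * (|ξ s ω - f M (ξ s ω)| + d)) μ :=
    (integrable_finsetSum _ fun s _ => hi3 s).const_mul _
  have hrest : ∫ ω, (n : ℝ)⁻¹ * ∑ s ∈ Finset.range n, W * (|ξ s ω - f M (ξ s ω)| + d) ∂μ =
      W * (2 * d) := by
    rw [integral_const_mul, integral_finsetSum _ fun s _ => hi3 s]
    have : ∀ s, ∫ ω, W * (|ξ s ω - f M (ξ s ω)| + d) ∂μ = W * (2 * d) := by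
      intro s
      have hi : Integrable (fun ω => |ξ s ω - f M (ξ s ω)|) μ := ((hints s).sub (hfi s)).abs
      rw [integral_const_mul, integral_add hi (integrable_const _), hds s]
      simp only [integral_const, probReal_univ, smul_eq_mul, one_mul]
      ring
    simp only [this, Finset.sum_const, Finset.card_range, nsmul_eq_mul]
    field_simp
  have htot := integral_mono hi1 (hi2.add hi4) hdec
  simp only [Pi.add_apply] at htot
  rw [integral_add hi2 hi4, hrest] at htot
  have hd0 : 0 ≤ d := integral_nonneg fun _ => abs_nonneg _
  have hWd : W * (2 * d) ≤ e / 4 := by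
    have h1 : d * (8 * (W + 1)) < e := (lt_div_iff₀ (by positivity)).1 hM
    nlinarith
  rw [Real.dist_eq, sub_zero, abs_of_nonneg (integral_nonneg fun _ => abs_nonneg _)]
  linarith

end LawOfLargeNumbers

section Independence

variable {Ω ι : Type*} {mΩ : MeasurableSpace Ω} {μ : Measure Ω}

/-- Adding one independent `σ`-algebra to an independent family. -/
lemma iIndep_option_elim [IsProbabilityMeasure μ] {m₀ : MeasurableSpace Ω}
    {M : ι → MeasurableSpace Ω} (h₀ : Indep m₀ (⨆ k, M k) μ) (hM : iIndep M μ) :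
    iIndep (fun o : Option ι => o.elim m₀ M) μ := by
  classical
  have key : ∀ (t : Finset ι) (A : Set Ω) (f : ι → Set Ω), MeasurableSet[m₀] A →
      (∀ k ∈ t, MeasurableSet[M k] (f k)) →
      μ (A ∩ ⋂ k ∈ t, f k) = μ A * ∏ k ∈ t, μ (f k) := by
    intro t A f hA hf
    rw [(Indep_iff _ _ _).1 h₀ A _ hA, hM.meas_biInter hf]
    exact Finset.measurableSet_biInter t fun k hk => le_iSup M k _ (hf k hk)
  rw [iIndep_iff]
  intro s f hf
  have hf' : ∀ k ∈ Finset.eraseNone s, MeasurableSet[M k] (f (some k)) := fun k hk =>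
    hf (some k) (Finset.mem_eraseNone.1 hk)
  by_cases hs : none ∈ s
  · have e : s = Finset.insertNone (Finset.eraseNone s) := by
      rw [Finset.insertNone_eraseNone, Finset.insert_eq_self.2 hs]
    have h1 := key (Finset.eraseNone s) (f none) (fun k => f (some k)) (hf none hs) hf'
    have h2 : ⋂ i ∈ s, f i = f none ∩ ⋂ k ∈ Finset.eraseNone s, f (some k) := by
      ext ω
      simp only [Set.mem_iInter, Set.mem_inter_iff, Finset.mem_eraseNone]
      refine ⟨fun h => ⟨h _ hs, fun k hk => h _ hk⟩, fun h o ho => ?_⟩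
      cases o with
      | none => exact h.1
      | some k => exact h.2 k ho
    rw [h2, h1]
    conv_rhs => rw [e]
    rw [Finset.prod_insertNone]
  · have e : s = (Finset.eraseNone s).map Function.Embedding.some := by
      rw [Finset.map_some_eraseNone, Finset.erase_eq_of_notMem hs]
    have h1 := key (Finset.eraseNone s) Set.univ (fun k => f (some k)) MeasurableSet.univ hf'
    have h2 : ⋂ i ∈ s, f i = Set.univ ∩ ⋂ k ∈ Finset.eraseNone s, f (some k) := by
      ext ω
      simp only [Set.mem_iInter, Set.mem_inter_iff, Finset.mem_eraseNone, Set.mem_univ, true_and]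
      refine ⟨fun h k hk => h _ hk, fun h o ho => ?_⟩
      cases o with
      | none => exact absurd ho hs
      | some k => exact h k ho
    rw [h2, h1, measure_univ, one_mul]
    conv_rhs => rw [e]
    rw [Finset.prod_map]
    rfl

end Independence

section Martingale

variable {Ω : Type*} {mΩ : MeasurableSpace Ω} {μ : Measure Ω}

/-- The second moment of a martingale transform. -/
lemma integral_sq_martingale_transform_le {F : ℕ → MeasurableSpace Ω} (hF : Monotone F)
    (hle : ∀ s, F s ≤ mΩ) {ζ Y : ℕ → Ω → ℝ} (hζF : ∀ s, Measurable[F (s + 1)] (ζ s))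
    (hind : ∀ (s : ℕ) (f : Ω → ℝ), Measurable[F s] f → IndepFun f (ζ s) μ)
    (hζ : ∀ s, MemLp (ζ s) 2 μ) (hmean : ∀ s, ∫ ω, ζ s ω ∂μ = 0) {v : ℝ}
    (hvar : ∀ s, ∫ ω, ζ s ω ^ 2 ∂μ = v) {n : ℕ} (hYF : ∀ s < n, Measurable[F s] (Y s))
    (hY : ∀ s < n, MemLp (Y s) 2 μ) {C : ℝ} (hC : ∀ s < n, ∫ ω, Y s ω ^ 2 ∂μ ≤ C) :
    Measurable[F n] (fun ω => ∑ s ∈ Finset.range n, ζ s ω * Y s ω) ∧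
    MemLp (fun ω => ∑ s ∈ Finset.range n, ζ s ω * Y s ω) 2 μ ∧
    ∫ ω, (∑ s ∈ Finset.range n, ζ s ω * Y s ω) ^ 2 ∂μ ≤ n * (v * C) := by
  have hv : 0 ≤ v := by rw [← hvar 0]; exact integral_nonneg fun _ => sq_nonneg _
  induction n with
  | zero =>
    simp
  | succ n ih =>
    obtain ⟨hm, hL, hb⟩ := ih (fun s hs => hYF s (by omega)) (fun s hs => hY s (by omega))
      (fun s hs => hC s (by omega))
    have hYm := hYF n (Nat.lt_succ_self n)
    have hYL := hY n (Nat.lt_succ_self n)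
    set S : Ω → ℝ := fun ω => ∑ s ∈ Finset.range n, ζ s ω * Y s ω with hS
    have hζm : Measurable (ζ n) := (hζF n).mono (hle _) le_rfl
    have hYm' : Measurable (Y n) := hYm.mono (hle _) le_rfl
    have hsq : Integrable (fun ω => (ζ n ω * Y n ω) ^ 2) μ := by
      simp_rw [mul_pow]
      exact ((hind n _ hYm).comp (φ := fun x => x ^ 2) (ψ := fun x => x ^ 2) (by fun_prop)
        (by fun_prop)).symm.integrable_mul (hζ n).integrable_sq hYL.integrable_sq
    have hsqE : ∫ ω, (ζ n ω * Y n ω) ^ 2 ∂μ = v * ∫ ω, Y n ω ^ 2 ∂μ := by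
      simp_rw [mul_pow]
      rw [← hvar n]
      exact IndepFun.integral_fun_mul_eq_mul_integral (((hind n _ hYm).comp
        (φ := fun x => x ^ 2) (ψ := fun x => x ^ 2) (by fun_prop) (by fun_prop)).symm)
        (hζ n).integrable_sq.aestronglyMeasurable hYL.integrable_sq.aestronglyMeasurable
    have hD : MemLp (fun ω => ζ n ω * Y n ω) 2 μ :=
      (memLp_two_iff_integrable_sq (hζm.mul hYm').aestronglyMeasurable).2 hsq
    have hSY : Integrable (fun ω => S ω * Y n ω) μ := MemLp.integrable_mul hL hYL
    have hcross : ∫ ω, S ω * (ζ n ω * Y n ω) ∂μ = 0 := by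
      have hi := hind n (fun ω => S ω * Y n ω) (hm.mul hYm)
      calc _ = ∫ ω, (S ω * Y n ω) * ζ n ω ∂μ := by congr 1; ext ω; ring
        _ = _ := IndepFun.integral_fun_mul_eq_mul_integral hi hSY.aestronglyMeasurable
            hζm.aestronglyMeasurable
        _ = 0 := by rw [hmean n, mul_zero]
    have hSD : Integrable (fun ω => S ω * (ζ n ω * Y n ω)) μ := MemLp.integrable_mul hL hD
    have e : (fun ω => ∑ s ∈ Finset.range (n + 1), ζ s ω * Y s ω) =
        fun ω => S ω + ζ n ω * Y n ω := by
      ext ω; rw [Finset.sum_range_succ]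
    refine ⟨?_, ?_, ?_⟩
    · rw [e]
      exact (hm.mono (hF (Nat.le_succ n)) le_rfl).add
        ((hζF n).mul (hYm.mono (hF (Nat.le_succ n)) le_rfl))
    · rw [e]; exact hL.add hD
    · have e2 : ∀ ω, (∑ s ∈ Finset.range (n + 1), ζ s ω * Y s ω) ^ 2 =
          S ω ^ 2 + 2 * (S ω * (ζ n ω * Y n ω)) + (ζ n ω * Y n ω) ^ 2 := by
        intro ω; rw [Finset.sum_range_succ]; ring
      have i1 : Integrable (fun ω => S ω ^ 2 + 2 * (S ω * (ζ n ω * Y n ω))) μ :=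
        hL.integrable_sq.add (hSD.const_mul 2)
      simp_rw [e2]
      rw [integral_add i1 hsq, integral_add hL.integrable_sq (hSD.const_mul 2), integral_const_mul,
        hcross, hsqE, mul_zero, add_zero]
      have := mul_le_mul_of_nonneg_left (hC n (Nat.lt_succ_self n)) hv
      push_cast
      linarith

lemma lintegral_enorm_pow_le_of_eLpNorm_le {ν : Measure Ω} {f : Ω → ℝ} {k : ℕ} (hk : k ≠ 0)
    {C : ℝ≥0∞} (h : eLpNorm f k ν ≤ C) : ∫⁻ ω, ‖f ω‖ₑ ^ k ∂ν ≤ C ^ k := by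
  have hk' : (k : ℝ≥0∞) ≠ 0 := by exact_mod_cast hk
  rw [eLpNorm_eq_lintegral_rpow_enorm_toReal hk' (ENNReal.natCast_ne_top k)] at h
  simp only [ENNReal.toReal_natCast, ENNReal.rpow_natCast] at h
  have h2 := ENNReal.rpow_le_rpow h (Nat.cast_nonneg (α := ℝ) k)
  rwa [← ENNReal.rpow_mul, one_div, inv_mul_cancel₀ (by exact_mod_cast hk), ENNReal.rpow_one,
    ENNReal.rpow_natCast] at h2

end Martingale

section MomentTools

variable {Ω : Type*} {mΩ : MeasurableSpace Ω} {μ : Measure Ω}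

lemma memLp_and_integral_abs_pow_le {ν : Measure Ω} {f : Ω → ℝ}
    (hf : AEStronglyMeasurable f ν) {k : ℕ} (hk : k ≠ 0) {D : ℝ} (hD : 0 ≤ D)
    (h : eLpNorm f k ν ≤ ENNReal.ofReal D) : MemLp f k ν ∧ ∫ ω, |f ω| ^ k ∂ν ≤ D ^ k := by
  refine ⟨⟨hf, h.trans_lt ENNReal.ofReal_lt_top⟩, ?_⟩
  have h1 := lintegral_enorm_pow_le_of_eLpNorm_le hk h
  rw [integral_eq_lintegral_of_nonneg_ae (Eventually.of_forall fun ω => by positivity)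
    (show AEStronglyMeasurable (fun ω => |f ω| ^ k) ν from
      (continuous_abs.comp_aestronglyMeasurable hf).pow k)]
  refine ENNReal.toReal_le_of_le_ofReal (by positivity) ?_
  rw [ENNReal.ofReal_pow hD]
  refine le_trans (le_of_eq (lintegral_congr fun ω => ?_)) h1
  rw [ENNReal.ofReal_pow (abs_nonneg _), ← Real.enorm_eq_ofReal_abs]

lemma boundedInProb_of_integral_le {X : ℕ → Ω → ℝ} (B : ℝ → ℕ → Set Ω)
    (hB : ∀ e : ℝ, 0 < e → ∃ K, ∀ n, μ (B K n)ᶜ ≤ ENNReal.ofReal e)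
    (hBm : ∀ K n, MeasurableSet (B K n)) (hXm : ∀ n, AEMeasurable (X n) μ)
    (hX : ∀ K, ∃ C : ℝ, ∀ᶠ n in atTop, Integrable (X n) (μ.restrict (B K n)) ∧
      ∫ ω in B K n, |X n ω| ∂μ ≤ C) : BoundedInProb μ X := by
  refine boundedInProb_of_lintegral_le B hB hBm hXm fun K => ?_
  obtain ⟨C, hC⟩ := hX K
  refine ⟨C, ?_⟩
  filter_upwards [hC] with n hn
  rw [← ofReal_integral_norm_eq_lintegral_enorm hn.1]
  exact ENNReal.ofReal_le_ofReal hn.2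

end MomentTools

/-- The autoregression without second order dynamics. -/
structure NullAR {Ω : Type*} [MeasurableSpace Ω] (μ : Measure Ω) {p : ℕ} (a : Fin p → ℝ)
    (h : ℕ → ℤ → ℝ) (c C : ℝ) (ε : ℤ → Ω → ℝ) (x : ℕ → ℤ → Ω → ℝ) : Prop where
  noise : NoiseAssumption μ ε
  pos : 0 < c
  lower : ∀ (n : ℕ) (t : ℤ), 1 ≤ t → t ≤ n → c ≤ h n t
  upper : ∀ (n : ℕ) (t : ℤ), 1 ≤ t → t ≤ n → h n t ≤ C
  stable : ∀ z : ℂ, ‖z‖ ≤ 1 → 1 - ∑ i : Fin p, (a i : ℂ) * z ^ ((i : ℕ) + 1) ≠ 0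
  observation : ∀ (n : ℕ) (t : ℤ), 1 ≤ t → t ≤ n → ∀ ω,
    x n t ω = ∑ i : Fin p, a i * x n (t - ((i : ℕ) + 1)) ω + h n t * ε t ω
  init_measurable : ∀ (n : ℕ) (i : Fin p), Measurable (x n (-((i : ℕ) : ℤ)))
  init_indep : ∀ n : ℕ, IndepFun (fun ω (i : Fin p) => x n (-((i : ℕ) : ℤ)) ω)
    (fun ω (k : ℕ) => ε ((k : ℤ) + 1) ω) μ
  init_tight : IsTightMeasureSet
    (Set.range fun n : ℕ => μ.map fun ω (i : Fin p) => x n (-((i : ℕ) : ℤ)) ω)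

section Past

variable {Ω : Type*}

/-- The `σ`-algebras of the initial values and of the innovations. -/
abbrev sourceAlgebra (p : ℕ) (ε : ℤ → Ω → ℝ) (x : ℕ → ℤ → Ω → ℝ) (n : ℕ) (o : Option ℕ) :
    MeasurableSpace Ω :=
  o.elim ((inferInstance : MeasurableSpace (Fin p → ℝ)).comap
    fun ω (i : Fin p) => x n (-((i : ℕ) : ℤ)) ω)
    fun k => (inferInstance : MeasurableSpace ℝ).comap (ε ((k : ℤ) + 1))

/-- The sources which are known at time `s`. -/
def sourcesBefore (s : ℕ) : Set (Option ℕ) := {o | ∀ k, o = some k → k < s}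

/-- The `σ`-algebra of the past: the initial values and `ε_1, …, ε_s`. -/
abbrev past (p : ℕ) (ε : ℤ → Ω → ℝ) (x : ℕ → ℤ → Ω → ℝ) (n s : ℕ) : MeasurableSpace Ω :=
  ⨆ o ∈ sourcesBefore s, sourceAlgebra p ε x n o

/-- The event that the initial values are bounded by `K`. -/
def initBall (p : ℕ) (x : ℕ → ℤ → Ω → ℝ) (K : ℝ) (n : ℕ) : Set Ω :=
  {ω | ∀ i : Fin p, |x n (-((i : ℕ) : ℤ)) ω| ≤ K}

lemma past_mono (p : ℕ) (ε : ℤ → Ω → ℝ) (x : ℕ → ℤ → Ω → ℝ) (n : ℕ) :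
    Monotone (past p ε x n) := fun _ _ hst =>
  biSup_mono fun _ ho k hk => (ho k hk).trans_le hst

lemma measurable_eps_past (p : ℕ) (ε : ℤ → Ω → ℝ) (x : ℕ → ℤ → Ω → ℝ) (n : ℕ) {k s : ℕ}
    (hk : k < s) : Measurable[past p ε x n s] (ε ((k : ℤ) + 1)) := by
  refine Measurable.mono (comap_measurable (ε ((k : ℤ) + 1)))
    (le_biSup (sourceAlgebra p ε x n) (i := some k) ?_) le_rfl
  intro j hj
  rwa [← Option.some.inj hj]

lemma measurable_init_past (p : ℕ) (ε : ℤ → Ω → ℝ) (x : ℕ → ℤ → Ω → ℝ) (n s : ℕ) (i : Fin p) :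
    Measurable[past p ε x n s] (x n (-((i : ℕ) : ℤ))) := by
  have h1 : Measurable[past p ε x n s] fun ω (i : Fin p) => x n (-((i : ℕ) : ℤ)) ω :=
    Measurable.mono (comap_measurable _)
      (le_biSup (sourceAlgebra p ε x n) (i := none) (by simp [sourcesBefore])) le_rfl
  exact (measurable_pi_apply i).comp h1

lemma measurableSet_initBall_past (p : ℕ) (ε : ℤ → Ω → ℝ) (x : ℕ → ℤ → Ω → ℝ) (K : ℝ) (n s : ℕ) :
    MeasurableSet[past p ε x n s] (initBall p x K n) := by
  have e : initBall p x K n = ⋂ i : Fin p, {ω | |x n (-((i : ℕ) : ℤ)) ω| ≤ K} := by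
    ext ω; simp [initBall]
  rw [e]
  exact MeasurableSet.iInter fun i =>
    (continuous_abs.measurable.comp (measurable_init_past p ε x n s i)) measurableSet_Iic

end Past

section Model

variable {Ω : Type*} [mΩ : MeasurableSpace Ω] {μ : Measure Ω} {p : ℕ} {a : Fin p → ℝ}
  {h : ℕ → ℤ → ℝ} {c C : ℝ} {ε : ℤ → Ω → ℝ} {x : ℕ → ℤ → Ω → ℝ}

namespace NullAR

lemma sourceAlgebra_le (H : NullAR μ a h c C ε x) (n : ℕ) (o : Option ℕ) :
    sourceAlgebra p ε x n o ≤ mΩ := by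
  cases o with
  | none => exact (measurable_pi_iff.2 fun i => H.init_measurable n i).comap_le
  | some k => exact (H.noise.measurable _).comap_le

lemma past_le (H : NullAR μ a h c C ε x) (n s : ℕ) : past p ε x n s ≤ mΩ :=
  iSup₂_le fun o _ => H.sourceAlgebra_le n o

lemma iIndep_source [IsProbabilityMeasure μ] (H : NullAR μ a h c C ε x) (n : ℕ) :
    iIndep (sourceAlgebra p ε x n) μ := by
  refine iIndep_option_elim ?_ ?_
  · have h1 := H.init_indep n
    rw [IndepFun_iff_Indep] at h1
    refine indep_of_indep_of_le_right h1 (iSup_le fun k => ?_)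
    have : Measurable[MeasurableSpace.pi.comap fun ω (k : ℕ) => ε ((k : ℤ) + 1) ω]
        (ε ((k : ℤ) + 1)) := (measurable_pi_apply k).comp
          (comap_measurable fun ω (k : ℕ) => ε ((k : ℤ) + 1) ω)
    exact this.comap_le
  · have h2 : iIndepFun (fun k : ℕ => ε ((k : ℤ) + 1)) μ :=
      H.noise.indep.precomp (g := fun k : ℕ => (k : ℤ) + 1) fun i j hij => by
        simpa using hij
    exact h2.iIndep

lemma indepFun_eps [IsProbabilityMeasure μ] (H : NullAR μ a h c C ε x) (n s : ℕ) {f : Ω → ℝ}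
    (hf : Measurable[past p ε x n s] f) : IndepFun f (ε ((s : ℤ) + 1)) μ := by
  refine indepFun_of_measurable_iSup (H.sourceAlgebra_le n) (H.iIndep_source n)
    (S := sourcesBefore s) (T := {some s}) ?_ hf ?_
  · rw [Set.disjoint_singleton_right]
    exact fun hs => lt_irrefl s (hs s rfl)
  · exact Measurable.mono (comap_measurable (ε ((s : ℤ) + 1)))
      (le_biSup (sourceAlgebra p ε x n) (i := some s) rfl) le_rfl

lemma measurable_x_past (H : NullAR μ a h c C ε x) (n s : ℕ) (hs : s ≤ n) :
    ∀ t : ℤ, -(p : ℤ) < t → t ≤ s → Measurable[past p ε x n s] (x n t) := by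
  induction s with
  | zero =>
    intro t ht ht0
    obtain ⟨k, rfl⟩ : ∃ k : ℕ, t = -(k : ℤ) := ⟨t.natAbs, by
      have : t ≤ 0 := by simpa using ht0
      omega⟩
    exact measurable_init_past p ε x n 0 ⟨k, by omega⟩
  | succ s ih =>
    intro t ht hts
    have ih' : ∀ t : ℤ, -(p : ℤ) < t → t ≤ s → Measurable[past p ε x n (s + 1)] (x n t) :=
      fun t h1 h2 => (ih (by omega) t h1 h2).mono (past_mono p ε x n (Nat.le_succ s)) le_rfl
    rcases lt_or_eq_of_le hts with hlt | rfl
    · exact ih' t ht (by push_cast at hlt; omega)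
    · have e : x n ((s + 1 : ℕ) : ℤ) = fun ω => ∑ i : Fin p,
          a i * x n (((s + 1 : ℕ) : ℤ) - ((i : ℕ) + 1)) ω +
            h n ((s + 1 : ℕ) : ℤ) * ε ((s : ℤ) + 1) ω := by
        ext ω
        rw [H.observation n _ (by push_cast; omega) (by exact_mod_cast hs) ω]
        push_cast
        rfl
      rw [e]
      refine Measurable.add (Finset.measurable_sum _ fun i _ => Measurable.const_mul
        (ih' _ ?_ ?_) _) (Measurable.const_mul (measurable_eps_past p ε x n (Nat.lt_succ_self s)) _)
      · have := i.2; push_cast; omega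
      · push_cast; omega

lemma measurable_x (H : NullAR μ a h c C ε x) (n : ℕ) {t : ℤ} (h1 : -(p : ℤ) < t) (h2 : t ≤ n) :
    Measurable (x n t) :=
  (H.measurable_x_past n n le_rfl t h1 h2).mono (H.past_le n n) le_rfl

lemma measurableSet_initBall (H : NullAR μ a h c C ε x) (K : ℝ) (n : ℕ) :
    MeasurableSet (initBall p x K n) :=
  H.past_le n 0 _ (measurableSet_initBall_past p ε x K n 0)

lemma exists_initBall_compl_le (H : NullAR μ a h c C ε x) (e : ℝ) (he : 0 < e) :
    ∃ K, ∀ n, μ (initBall p x K n)ᶜ ≤ ENNReal.ofReal e := by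
  obtain ⟨S, hS, hμ⟩ := isTightMeasureSet_iff_exists_isCompact_measure_compl_le.1 H.init_tight
    (ENNReal.ofReal e) (by simpa using he)
  obtain ⟨K, hK⟩ := hS.isBounded.exists_norm_le
  refine ⟨K, fun n => ?_⟩
  have hm : Measurable fun ω (i : Fin p) => x n (-((i : ℕ) : ℤ)) ω :=
    measurable_pi_iff.2 fun i => H.init_measurable n i
  have h1 := hμ _ ⟨n, rfl⟩
  rw [Measure.map_apply hm hS.measurableSet.compl] at h1
  refine le_trans (measure_mono ?_) h1
  intro ω hω hcon
  refine hω fun i => ?_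
  exact (norm_le_pi_norm (fun i : Fin p => x n (-((i : ℕ) : ℤ)) ω) i).trans (hK _ hcon)

end NullAR

end Model

/-- The `L⁸` seminorm of `f` is at most `D`. -/
structure EighthBound {Ω : Type*} [MeasurableSpace Ω] (ν : Measure Ω) (f : Ω → ℝ) (D : ℝ) :
    Prop where
  meas : AEStronglyMeasurable f ν
  nonneg : 0 ≤ D
  le : eLpNorm f (8 : ℕ) ν ≤ ENNReal.ofReal D

namespace EighthBound

variable {Ω : Type*} {mΩ : MeasurableSpace Ω} {ν : Measure Ω} {f f' : Ω → ℝ} {D D' : ℝ}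

lemma mono (hf : EighthBound ν f D) (h : D ≤ D') : EighthBound ν f D' :=
  ⟨hf.meas, hf.nonneg.trans h, hf.le.trans (ENNReal.ofReal_le_ofReal h)⟩

lemma add (hf : EighthBound ν f D) (hf' : EighthBound ν f' D') :
    EighthBound ν (fun ω => f ω + f' ω) (D + D') := by
  refine ⟨hf.meas.add hf'.meas, add_nonneg hf.nonneg hf'.nonneg, ?_⟩
  refine (eLpNorm_add_le hf.meas hf'.meas (by norm_num)).trans ?_
  rw [ENNReal.ofReal_add hf.nonneg hf'.nonneg]
  exact add_le_add hf.le hf'.le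

lemma const_mul (hf : EighthBound ν f D) (r : ℝ) :
    EighthBound ν (fun ω => r * f ω) (|r| * D) := by
  refine ⟨hf.meas.const_mul r, mul_nonneg (abs_nonneg r) hf.nonneg, ?_⟩
  have := eLpNorm_const_smul r f (8 : ℕ) ν
  refine (le_of_eq this).trans ?_
  rw [ENNReal.ofReal_mul (abs_nonneg r), Real.enorm_eq_ofReal_abs]
  exact mul_le_mul_right hf.le _

lemma abs (hf : EighthBound ν f D) : EighthBound ν (fun ω => |f ω|) D := by
  refine ⟨continuous_abs.comp_aestronglyMeasurable hf.meas, hf.nonneg, ?_⟩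
  exact (eLpNorm_norm f).trans_le hf.le

lemma of_bound (hν : ν Set.univ ≤ 1) (hm : AEStronglyMeasurable f ν) (hD : 0 ≤ D)
    (h : ∀ᵐ ω ∂ν, |f ω| ≤ D) : EighthBound ν f D := by
  refine ⟨hm, hD, (eLpNorm_le_of_ae_bound h).trans ?_⟩
  refine mul_le_of_le_one_left zero_le ?_
  exact ENNReal.rpow_le_one hν (by positivity)

lemma sum {ι : Type*} {s : Finset ι} {F : ι → Ω → ℝ} {d : ι → ℝ}
    (h : ∀ i ∈ s, EighthBound ν (F i) (d i)) :
    EighthBound ν (fun ω => ∑ i ∈ s, F i ω) (∑ i ∈ s, d i) := by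
  classical
  induction s using Finset.induction_on with
  | empty =>
    simp only [Finset.sum_empty]
    exact ⟨aestronglyMeasurable_const, le_rfl, by simp⟩
  | insert i s hi ih =>
    simp only [Finset.sum_insert hi]
    exact (h i (Finset.mem_insert_self i s)).add
      (ih fun j hj => h j (Finset.mem_insert_of_mem hj))

lemma integral_le (hf : EighthBound ν f D) :
    MemLp f (8 : ℕ) ν ∧ ∫ ω, |f ω| ^ 8 ∂ν ≤ D ^ 8 :=
  memLp_and_integral_abs_pow_le hf.meas (by norm_num) hf.nonneg hf.le

end EighthBound

section Noise

variable {Ω : Type*} [MeasurableSpace Ω] {μ : Measure Ω} [IsProbabilityMeasure μ] {ε : ℤ → Ω → ℝ}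

lemma NoiseAssumption.memLp (h : NoiseAssumption μ ε) (t : ℤ) : MemLp (ε t) (8 : ℕ) μ := by
  obtain ⟨s, hs, hint⟩ := h.moment
  rw [(h.identDistrib t).memLp_iff]
  have h1 : MemLp (ε 0) (ENNReal.ofReal s) μ := by
    rw [← integrable_norm_rpow_iff (h.measurable 0).aestronglyMeasurable
      (by simp; linarith) ENNReal.ofReal_ne_top, ENNReal.toReal_ofReal (by linarith)]
    exact hint
  refine h1.mono_exponent ?_
  rw [← ENNReal.ofReal_natCast]
  exact ENNReal.ofReal_le_ofReal (by push_cast; linarith)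

lemma NoiseAssumption.exists_eighthBound (h : NoiseAssumption μ ε) :
    ∃ E, ∀ t, EighthBound μ (ε t) E := by
  refine ⟨(eLpNorm (ε 0) (8 : ℕ) μ).toReal, fun t =>
    ⟨(h.measurable t).aestronglyMeasurable, ENNReal.toReal_nonneg, ?_⟩⟩
  rw [(h.identDistrib t).eLpNorm_eq, ENNReal.ofReal_toReal (h.memLp 0).eLpNorm_ne_top]

end Noise

section Envelope

variable {Ω : Type*} {p : ℕ} {x : ℕ → ℤ → Ω → ℝ}

lemma abs_lagComb_init_le {d : Fin p → ℝ} {K : ℝ} {n : ℕ} {ω : Ω} (hω : ω ∈ initBall p x K n) :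
    |lagComb d (fun t => x n t ω) 0| ≤ p * ‖d‖ * |K| := by
  calc |lagComb d (fun t => x n t ω) 0| ≤ ∑ i : Fin p, ‖d‖ * |K| := by
        refine (Finset.abs_sum_le_sum_abs _ _).trans (Finset.sum_le_sum fun i _ => ?_)
        rw [abs_mul, zero_sub]
        exact mul_le_mul (norm_le_pi_norm d i) ((hω i).trans (le_abs_self K)) (abs_nonneg _)
          (norm_nonneg _)
    _ = p * ‖d‖ * |K| := by simp [mul_assoc]

/-- A variable dominating the innovation and the lagged observations at time `s + 1`. -/
def envelope (p : ℕ) (h : ℕ → ℤ → ℝ) (ε : ℤ → Ω → ℝ) (x : ℕ → ℤ → Ω → ℝ) (n s : ℕ) (ω : Ω) : ℝ :=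
  1 + |h n ((s : ℤ) + 1) * ε ((s : ℤ) + 1) ω| + ∑ i : Fin p, |x n ((s : ℤ) - (i : ℕ)) ω|

lemma one_le_envelope (p : ℕ) (h : ℕ → ℤ → ℝ) (ε : ℤ → Ω → ℝ) (x : ℕ → ℤ → Ω → ℝ) (n s : ℕ)
    (ω : Ω) : 1 ≤ envelope p h ε x n s ω := by
  have h1 := abs_nonneg (h n ((s : ℤ) + 1) * ε ((s : ℤ) + 1) ω)
  have h2 : 0 ≤ ∑ i : Fin p, |x n ((s : ℤ) - (i : ℕ)) ω| :=
    Finset.sum_nonneg fun _ _ => abs_nonneg _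
  rw [envelope]; linarith

lemma abs_innovation_le_envelope (p : ℕ) (h : ℕ → ℤ → ℝ) (ε : ℤ → Ω → ℝ) (x : ℕ → ℤ → Ω → ℝ)
    (n s : ℕ) (ω : Ω) : |h n ((s : ℤ) + 1) * ε ((s : ℤ) + 1) ω| ≤ envelope p h ε x n s ω := by
  have h2 : 0 ≤ ∑ i : Fin p, |x n ((s : ℤ) - (i : ℕ)) ω| :=
    Finset.sum_nonneg fun _ _ => abs_nonneg _
  rw [envelope]; linarith

lemma sum_abs_le_envelope (p : ℕ) (h : ℕ → ℤ → ℝ) (ε : ℤ → Ω → ℝ) (x : ℕ → ℤ → Ω → ℝ)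
    (n s : ℕ) (ω : Ω) : ∑ i : Fin p, |x n ((s : ℤ) - (i : ℕ)) ω| ≤ envelope p h ε x n s ω := by
  have h1 := abs_nonneg (h n ((s : ℤ) + 1) * ε ((s : ℤ) + 1) ω)
  rw [envelope]; linarith

lemma abs_le_envelope (h : ℕ → ℤ → ℝ) (ε : ℤ → Ω → ℝ) (x : ℕ → ℤ → Ω → ℝ)
    (n s : ℕ) (i : Fin p) (ω : Ω) : |x n ((s : ℤ) - (i : ℕ)) ω| ≤ envelope p h ε x n s ω :=
  (Finset.single_le_sum (f := fun i : Fin p => |x n ((s : ℤ) - (i : ℕ)) ω|)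
    (fun _ _ => abs_nonneg _) (Finset.mem_univ i)).trans (sum_abs_le_envelope p h ε x n s ω)

end Envelope

section Dynamics

variable {Ω : Type*} [mΩ : MeasurableSpace Ω] {μ : Measure Ω} {p : ℕ}
  {a : Fin p → ℝ} {h : ℕ → ℤ → ℝ} {c C : ℝ} {ε : ℤ → Ω → ℝ} {x : ℕ → ℤ → Ω → ℝ}

lemma EighthBound.restrict {f : Ω → ℝ} {D : ℝ} (hf : EighthBound μ f D) (B : Set Ω) :
    EighthBound (μ.restrict B) f D :=
  ⟨hf.meas.restrict, hf.nonneg, (eLpNorm_mono_measure _ Measure.restrict_le_self).trans hf.le⟩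

namespace NullAR

lemma x_eq (H : NullAR μ a h c C ε x) (n k : ℕ) (hk : k + 1 ≤ n) (ω : Ω) :
    x n ((k : ℤ) + 1) ω = (∑ j ∈ Finset.range k, coord ℝ p 0 ((companion a ^ j) a) *
      (h n ((k : ℤ) - j) * ε ((k : ℤ) - j) ω) +
      lagComb ((companion a ^ k) a) (fun t => x n t ω) 0) +
      h n ((k : ℤ) + 1) * ε ((k : ℤ) + 1) ω := by
  have h1 : ∀ t : ℤ, 1 ≤ t → t ≤ n → (fun t => x n t ω) t =
      ∑ i : Fin p, a i * (fun t => x n t ω) (t - ((i : ℕ) + 1)) +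
        (fun t => h n t * ε t ω) t := fun t ht1 ht2 => H.observation n t ht1 ht2 ω
  rw [← lagComb_iterate h1 k (by omega) a, H.observation n _ (by omega) (by omega) ω, lagComb]
  simp only [add_sub_add_right_eq_sub]

lemma measurable_envelope (H : NullAR μ a h c C ε x) {n s : ℕ} (hs : s < n) :
    Measurable (envelope p h ε x n s) := by
  refine Measurable.add (Measurable.add measurable_const
    (((H.noise.measurable _).const_mul _).abs)) (Finset.measurable_sum _ fun i _ =>
      (H.measurable_x n ?_ ?_).abs)
  · have := i.2; omega
  · omega

end NullAR

end Dynamics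

section Moments

variable {Ω : Type*} [mΩ : MeasurableSpace Ω] {μ : Measure Ω} [IsProbabilityMeasure μ] {p : ℕ}
  {a : Fin p → ℝ} {h : ℕ → ℤ → ℝ} {c C : ℝ} {ε : ℤ → Ω → ℝ} {x : ℕ → ℤ → Ω → ℝ}

lemma restrict_univ_le_one (B : Set Ω) : μ.restrict B Set.univ ≤ 1 := by
  rw [Measure.restrict_apply_univ]; exact prob_le_one

namespace NullAR

lemma exists_eighthBound_innovation (H : NullAR μ a h c C ε x) :
    ∃ D, ∀ (n : ℕ) (t : ℤ), 1 ≤ t → t ≤ n → EighthBound μ (fun ω => h n t * ε t ω) D := by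
  obtain ⟨E, hE⟩ := H.noise.exists_eighthBound
  refine ⟨C * E, fun n t h1 h2 => ((hE t).const_mul (h n t)).mono ?_⟩
  refine mul_le_mul_of_nonneg_right ?_ (hE t).nonneg
  rw [abs_of_pos (H.pos.trans_le (H.lower n t h1 h2))]
  exact H.upper n t h1 h2

lemma exists_eighthBound_x (H : NullAR μ a h c C ε x) (K : ℝ) :
    ∃ D, ∀ (n : ℕ) (t : ℤ), -(p : ℤ) < t → t ≤ n →
      EighthBound (μ.restrict (initBall p x K n)) (x n t) D := by
  obtain ⟨E, hE⟩ := H.exists_eighthBound_innovation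
  have hS := summable_norm_pow_companion H.stable a
  set S := ∑' k, ‖(companion a ^ k) a‖ with hSdef
  have hS0 : 0 ≤ S := tsum_nonneg fun _ => norm_nonneg _
  have hSk : ∀ k, ‖(companion a ^ k) a‖ ≤ S := fun k => hS.le_tsum k fun _ _ => norm_nonneg _
  have hcoord : ∀ d : Fin p → ℝ, |coord ℝ p 0 d| ≤ ‖d‖ := by
    intro d
    rcases Nat.eq_zero_or_pos p with rfl | hp
    · simp [coord_of_le]
    · rw [coord_of_lt hp]; exact norm_le_pi_norm d _
  refine ⟨|K| + (S * |E| + p * S * |K| + |E|), fun n t h1 h2 => ?_⟩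
  have hB := H.measurableSet_initBall K n
  rcases le_or_gt t 0 with ht | ht
  · obtain ⟨k, rfl⟩ : ∃ k : ℕ, t = -(k : ℤ) := ⟨t.natAbs, by omega⟩
    refine (EighthBound.of_bound (restrict_univ_le_one _)
      (H.measurable_x n h1 h2).aestronglyMeasurable (abs_nonneg K) ?_).mono
      (le_add_of_nonneg_right (by positivity))
    refine (ae_restrict_iff' hB).2 (Eventually.of_forall fun ω hω => ?_)
    exact (hω ⟨k, by omega⟩).trans (le_abs_self K)
  · obtain ⟨k, rfl⟩ : ∃ k : ℕ, t = (k : ℤ) + 1 := ⟨(t - 1).toNat, by omega⟩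
    have hk : k + 1 ≤ n := by exact_mod_cast h2
    rw [show x n ((k : ℤ) + 1) = _ from funext (H.x_eq n k hk)]
    have i1 : EighthBound (μ.restrict (initBall p x K n)) (fun ω => ∑ j ∈ Finset.range k,
        coord ℝ p 0 ((companion a ^ j) a) * (h n ((k : ℤ) - j) * ε ((k : ℤ) - j) ω))
        (S * |E|) := by
      refine (EighthBound.sum (s := Finset.range k)
        (F := fun (j : ℕ) ω => coord ℝ p 0 ((companion a ^ j) a) *
          (h n ((k : ℤ) - (j : ℤ)) * ε ((k : ℤ) - (j : ℤ)) ω))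
        (d := fun j : ℕ => |coord ℝ p 0 ((companion a ^ j) a)| * E)
        fun j hj => ((hE n ((k : ℤ) - (j : ℤ)) ?_ ?_).restrict _).const_mul _).mono ?_
      · have := Finset.mem_range.1 hj; omega
      · have := Finset.mem_range.1 hj; omega
      · rw [← Finset.sum_mul]
        refine (mul_le_mul_of_nonneg_left (le_abs_self E)
          (Finset.sum_nonneg fun _ _ => abs_nonneg _)).trans
          (mul_le_mul_of_nonneg_right ?_ (abs_nonneg E))
        exact (Finset.sum_le_sum fun j _ => hcoord _).trans
          (hS.sum_le_tsum _ fun _ _ => norm_nonneg _)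
    have i2 : EighthBound (μ.restrict (initBall p x K n))
        (fun ω => lagComb ((companion a ^ k) a) (fun t => x n t ω) 0) (p * S * |K|) := by
      refine EighthBound.of_bound (restrict_univ_le_one _) ?_ (by positivity) ?_
      · refine (Finset.measurable_sum _ fun i _ => Measurable.const_mul
          (H.measurable_x n ?_ ?_) _).aestronglyMeasurable
        · have := i.2; omega
        · omega
      · refine (ae_restrict_iff' hB).2 (Eventually.of_forall fun ω hω => ?_)
        refine (abs_lagComb_init_le hω).trans ?_
        have := hSk k
        gcongr
    have i3 : EighthBound (μ.restrict (initBall p x K n))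
        (fun ω => h n ((k : ℤ) + 1) * ε ((k : ℤ) + 1) ω) |E| :=
      ((hE n _ (by omega) (by omega)).restrict _).mono (le_abs_self E)
    exact ((i1.add i2).add i3).mono (le_add_of_nonneg_left (abs_nonneg K))

end NullAR

namespace NullAR

lemma exists_eighthBound_envelope (H : NullAR μ a h c C ε x) (K : ℝ) :
    ∃ D, ∀ n s : ℕ, s < n →
      EighthBound (μ.restrict (initBall p x K n)) (envelope p h ε x n s) D := by
  obtain ⟨E, hE⟩ := H.exists_eighthBound_innovation
  obtain ⟨D, hD⟩ := H.exists_eighthBound_x K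
  refine ⟨1 + E + ∑ _i : Fin p, D, fun n s hs => ?_⟩
  refine EighthBound.add (EighthBound.add ?_ ?_) (EighthBound.sum fun i _ => ?_)
  · exact EighthBound.of_bound (restrict_univ_le_one _) aestronglyMeasurable_const zero_le_one
      (by simp)
  · exact ((hE n _ (by omega) (by omega)).restrict _).abs
  · exact (hD n _ (by have := i.2; omega) (by omega)).abs

lemma exists_integral_envelope_le (H : NullAR μ a h c C ε x) (K : ℝ) :
    ∃ D, ∀ n s : ℕ, s < n →
      Integrable (fun ω => envelope p h ε x n s ω ^ 8) (μ.restrict (initBall p x K n)) ∧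
      ∫ ω in initBall p x K n, envelope p h ε x n s ω ^ 8 ∂μ ≤ D := by
  obtain ⟨D, hD⟩ := H.exists_eighthBound_envelope K
  refine ⟨D ^ 8, fun n s hs => ?_⟩
  obtain ⟨h1, h2⟩ := (hD n s hs).integral_le
  refine ⟨integrable_pow_of_memLp h1 le_rfl, ?_⟩
  simpa only [Even.pow_abs (by decide : Even 8)] using h2

lemma boundedInProb_average_envelope (H : NullAR μ a h c C ε x) :
    BoundedInProb μ fun n ω => (n : ℝ)⁻¹ * ∑ s ∈ Finset.range n, envelope p h ε x n s ω ^ 8 := by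
  refine boundedInProb_of_integral_le (initBall p x) H.exists_initBall_compl_le
    H.measurableSet_initBall (fun n => ?_) fun K => ?_
  · exact ((Finset.measurable_sum _ fun s hs => (H.measurable_envelope
      (Finset.mem_range.1 hs)).pow_const 8).const_mul _).aemeasurable
  · obtain ⟨D, hD⟩ := H.exists_integral_envelope_le K
    refine ⟨D, ?_⟩
    filter_upwards [eventually_gt_atTop 0] with n hn
    have hi : ∀ s ∈ Finset.range n, Integrable (fun ω => envelope p h ε x n s ω ^ 8)
        (μ.restrict (initBall p x K n)) := fun s hs => (hD n s (Finset.mem_range.1 hs)).1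
    refine ⟨(integrable_finsetSum _ hi).const_mul _, ?_⟩
    have e : ∀ ω, |(n : ℝ)⁻¹ * ∑ s ∈ Finset.range n, envelope p h ε x n s ω ^ 8| =
        (n : ℝ)⁻¹ * ∑ s ∈ Finset.range n, envelope p h ε x n s ω ^ 8 := fun ω =>
      abs_of_nonneg (mul_nonneg (by positivity) (Finset.sum_nonneg fun s _ =>
        Even.pow_nonneg (by decide) _))
    simp_rw [e]
    rw [integral_const_mul, integral_finsetSum _ hi]
    have hn' : (0 : ℝ) < n := by exact_mod_cast hn
    rw [inv_mul_le_iff₀ hn']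
    refine (Finset.sum_le_sum fun s hs => (hD n s (Finset.mem_range.1 hs)).2).trans ?_
    simp

lemma boundedInProb_endpoint (H : NullAR μ a h c C ε x) :
    BoundedInProb μ fun n ω => ∑ i : Fin p, x n ((n : ℤ) - (i : ℕ)) ω ^ 2 := by
  have hm : ∀ (n : ℕ) (i : Fin p), Measurable (x n ((n : ℤ) - (i : ℕ))) := fun n i =>
    H.measurable_x n (by have := i.2; omega) (by omega)
  refine boundedInProb_of_integral_le (initBall p x) H.exists_initBall_compl_le
    H.measurableSet_initBall (fun n => ?_) fun K => ?_
  · exact (Finset.measurable_sum _ fun i _ => (hm n i).pow_const 2).aemeasurable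
  · obtain ⟨D, hD⟩ := H.exists_eighthBound_x K
    refine ⟨∑ _i : Fin p, (1 + D ^ 8), Eventually.of_forall fun n => ?_⟩
    have hb := fun i : Fin p => (hD n ((n : ℤ) - (i : ℕ)) (by have := i.2; omega)
      (by omega)).integral_le
    have hi : ∀ i ∈ (Finset.univ : Finset (Fin p)), Integrable
        (fun ω => x n ((n : ℤ) - (i : ℕ)) ω ^ 2) (μ.restrict (initBall p x K n)) := fun i _ =>
      integrable_pow_of_memLp (hb i).1 (by norm_num)
    refine ⟨integrable_finsetSum _ hi, ?_⟩
    have e : ∀ ω, |∑ i : Fin p, x n ((n : ℤ) - (i : ℕ)) ω ^ 2| =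
        ∑ i : Fin p, x n ((n : ℤ) - (i : ℕ)) ω ^ 2 := fun ω =>
      abs_of_nonneg (Finset.sum_nonneg fun _ _ => sq_nonneg _)
    simp_rw [e]
    rw [integral_finsetSum _ hi]
    refine Finset.sum_le_sum fun i _ => ?_
    have h8 : Integrable (fun ω => |x n ((n : ℤ) - (i : ℕ)) ω| ^ 8)
        (μ.restrict (initBall p x K n)) :=
      integrable_pow_of_memLp (f := fun ω => |x n ((n : ℤ) - (i : ℕ)) ω|) (hb i).1.abs le_rfl
    have h1 : Integrable (fun _ : Ω => (1 : ℝ)) (μ.restrict (initBall p x K n)) :=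
      integrable_const _
    refine (integral_mono (hi i (Finset.mem_univ i)) (h1.add h8) fun ω => ?_).trans ?_
    · simp only [Pi.add_apply]
      rw [← sq_abs]
      have h0 := abs_nonneg (x n ((n : ℤ) - (i : ℕ)) ω)
      rcases le_total |x n ((n : ℤ) - (i : ℕ)) ω| 1 with h | h
      · have := pow_le_one₀ h0 h (n := 2)
        have : 0 ≤ |x n ((n : ℤ) - (i : ℕ)) ω| ^ 8 := by positivity
        linarith
      · have := pow_le_pow_right₀ h (show 2 ≤ 8 by norm_num)
        linarith
    · simp only [Pi.add_apply]
      rw [integral_add h1 h8]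
      refine add_le_add ?_ (hb i).2
      simp only [integral_const, smul_eq_mul, mul_one]
      rw [Measure.real]
      exact ENNReal.toReal_le_of_le_ofReal zero_le_one
        (by simpa using restrict_univ_le_one (μ := μ) (initBall p x K n))

end NullAR

end Moments

section MartingaleBound

variable {Ω : Type*} [mΩ : MeasurableSpace Ω] {μ : Measure Ω} [IsProbabilityMeasure μ] {p : ℕ}
  {a : Fin p → ℝ} {h : ℕ → ℤ → ℝ} {c C : ℝ} {ε : ℤ → Ω → ℝ} {x : ℕ → ℤ → Ω → ℝ}

namespace NullAR

lemma exists_integral_sq_transform_le (H : NullAR μ a h c C ε x) {φ : ℝ → ℝ} (hφ : Measurable φ)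
    (hφ2 : MemLp (fun ω => φ (ε 0 ω)) 2 μ) (hφ0 : ∫ ω, φ (ε 0 ω) ∂μ = 0)
    {Y : ℕ → ℕ → Ω → ℝ} (hYm : ∀ n, ∀ s < n, Measurable[past p ε x n s] (Y n s)) {D₀ : ℝ}
    (hY : ∀ n, ∀ s < n, ∃ r < n, ∀ ω,
      Y n s ω ^ 2 ≤ D₀ * (envelope p h ε x n s ω ^ 8 + envelope p h ε x n r ω ^ 8)) (K : ℝ) :
    ∃ D, ∀ n : ℕ,
      Integrable (fun ω => (∑ s ∈ Finset.range n, φ (ε ((s : ℤ) + 1) ω) * Y n s ω) ^ 2)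
        (μ.restrict (initBall p x K n)) ∧
      ∫ ω in initBall p x K n, (∑ s ∈ Finset.range n, φ (ε ((s : ℤ) + 1) ω) * Y n s ω) ^ 2 ∂μ ≤
        n * D := by
  obtain ⟨D, hD⟩ := H.exists_integral_envelope_le K
  refine ⟨(∫ ω, φ (ε 0 ω) ^ 2 ∂μ) * (D₀ * (D + D)), fun n => ?_⟩
  set B := initBall p x K n with hBdef
  have hB : MeasurableSet B := H.measurableSet_initBall K n
  have hid : ∀ t, IdentDistrib (fun ω => φ (ε t ω)) (fun ω => φ (ε 0 ω)) μ μ := fun t =>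
    (H.noise.identDistrib t).comp hφ
  have hYB : ∀ s < n, IntegrableOn (fun ω => Y n s ω ^ 2) B μ ∧
      ∫ ω in B, Y n s ω ^ 2 ∂μ ≤ D₀ * (D + D) := by
    intro s hs
    obtain ⟨r, hr, hle⟩ := hY n s hs
    have i1 := ((hD n s hs).1.add (hD n r hr).1).const_mul D₀
    have i2 : IntegrableOn (fun ω => Y n s ω ^ 2) B μ := by
      refine i1.mono' ?_ (Eventually.of_forall fun ω => ?_)
      · exact (((hYm n s hs).mono (H.past_le n s) le_rfl).pow_const 2).aestronglyMeasurable
      · rw [Real.norm_of_nonneg (sq_nonneg _)]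
        exact hle ω
    refine ⟨i2, (integral_mono i2 i1 hle).trans ?_⟩
    simp only [Pi.add_apply]
    rw [integral_const_mul, integral_add (hD n s hs).1 (hD n r hr).1]
    have hD0 : 0 ≤ D₀ := by
      obtain ⟨ω⟩ : Nonempty Ω := μ.nonempty_of_neZero
      have h1 := (sq_nonneg _).trans (hle ω)
      have h2 := one_le_pow₀ (n := 8) (one_le_envelope p h ε x n s ω)
      have h3 := one_le_pow₀ (n := 8) (one_le_envelope p h ε x n r ω)
      by_contra hneg
      nlinarith
    exact mul_le_mul_of_nonneg_left (add_le_add (hD n s hs).2 (hD n r hr).2) hD0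
  have hsq : ∀ s, (fun ω => B.indicator (Y n s) ω ^ 2) = B.indicator fun ω => Y n s ω ^ 2 := by
    intro s
    ext ω
    by_cases hω : ω ∈ B <;> simp [hω]
  have key := integral_sq_martingale_transform_le (μ := μ) (past_mono p ε x n) (H.past_le n)
    (ζ := fun s ω => φ (ε ((s : ℤ) + 1) ω)) (Y := fun s => B.indicator (Y n s))
    (fun s => hφ.comp (measurable_eps_past p ε x n (Nat.lt_succ_self s)))
    (fun s f hf => (H.indepFun_eps n s hf).comp measurable_id hφ)
    (fun s => (hid _).memLp_iff.2 hφ2) (fun s => (hid _).integral_eq.trans hφ0)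
    (v := ∫ ω, φ (ε 0 ω) ^ 2 ∂μ)
    (fun s => ((hid ((s : ℤ) + 1)).comp (u := fun y : ℝ => y ^ 2)
      (measurable_id.pow_const 2)).integral_eq)
    (n := n) (fun s hs => (hYm n s hs).indicator (measurableSet_initBall_past p ε x K n s))
    (fun s hs => by
      refine (memLp_two_iff_integrable_sq ?_).2 ?_
      · exact (((hYm n s hs).mono (H.past_le n s) le_rfl).indicator hB).aestronglyMeasurable
      · rw [hsq]; exact (integrable_indicator_iff hB).2 (hYB s hs).1)
    (C := D₀ * (D + D)) (fun s hs => by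
      rw [hsq, integral_indicator hB]; exact (hYB s hs).2)
  have e : (fun ω => (∑ s ∈ Finset.range n, φ (ε ((s : ℤ) + 1) ω) * B.indicator (Y n s) ω) ^ 2) =
      B.indicator fun ω => (∑ s ∈ Finset.range n, φ (ε ((s : ℤ) + 1) ω) * Y n s ω) ^ 2 := by
    ext ω
    by_cases hω : ω ∈ B <;> simp [hω]
  have k1 := key.2.1.integrable_sq
  have k2 := key.2.2
  rw [e] at k1 k2
  rw [integral_indicator hB] at k2
  exact ⟨(integrable_indicator_iff hB).1 k1, k2⟩

/-- Normalized martingale transforms of functions of the noise are bounded in probability. -/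
lemma boundedInProb_transform (H : NullAR μ a h c C ε x) {φ : ℝ → ℝ} (hφ : Measurable φ)
    (hφ2 : MemLp (fun ω => φ (ε 0 ω)) 2 μ) (hφ0 : ∫ ω, φ (ε 0 ω) ∂μ = 0)
    {Y : ℕ → ℕ → Ω → ℝ} (hYm : ∀ n, ∀ s < n, Measurable[past p ε x n s] (Y n s)) {D₀ : ℝ}
    (hY : ∀ n, ∀ s < n, ∃ r < n, ∀ ω,
      Y n s ω ^ 2 ≤ D₀ * (envelope p h ε x n s ω ^ 8 + envelope p h ε x n r ω ^ 8)) :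
    BoundedInProb μ fun n ω =>
      (√(n : ℝ))⁻¹ * ∑ s ∈ Finset.range n, φ (ε ((s : ℤ) + 1) ω) * Y n s ω := by
  have hm : ∀ n : ℕ, Measurable fun ω =>
      (√(n : ℝ))⁻¹ * ∑ s ∈ Finset.range n, φ (ε ((s : ℤ) + 1) ω) * Y n s ω := fun n =>
    (Finset.measurable_sum _ fun s hs => (hφ.comp (H.noise.measurable _)).mul
      ((hYm n s (Finset.mem_range.1 hs)).mono (H.past_le n s) le_rfl)).const_mul _
  refine boundedInProb_of_integral_le (initBall p x) H.exists_initBall_compl_le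
    H.measurableSet_initBall (fun n => (hm n).aemeasurable) fun K => ?_
  obtain ⟨D, hD⟩ := H.exists_integral_sq_transform_le hφ hφ2 hφ0 hYm hY K
  refine ⟨1 + D, ?_⟩
  filter_upwards [eventually_gt_atTop 0] with n hn
  have hn' : (0 : ℝ) < n := by exact_mod_cast hn
  set Z : Ω → ℝ := fun ω => ∑ s ∈ Finset.range n, φ (ε ((s : ℤ) + 1) ω) * Y n s ω with hZ
  have h2 : Integrable (fun ω => 1 + (n : ℝ)⁻¹ * Z ω ^ 2) (μ.restrict (initBall p x K n)) :=
    (integrable_const _).add ((hD n).1.const_mul _)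
  have hle : ∀ ω, |(√(n : ℝ))⁻¹ * Z ω| ≤ 1 + (n : ℝ)⁻¹ * Z ω ^ 2 := by
    intro ω
    have e : (n : ℝ)⁻¹ * Z ω ^ 2 = |(√(n : ℝ))⁻¹ * Z ω| ^ 2 := by
      rw [sq_abs, mul_pow, inv_pow, Real.sq_sqrt hn'.le]
    rw [e]
    nlinarith [sq_nonneg (|(√(n : ℝ))⁻¹ * Z ω| - 1), abs_nonneg ((√(n : ℝ))⁻¹ * Z ω)]
  have h1 : Integrable (fun ω => (√(n : ℝ))⁻¹ * Z ω) (μ.restrict (initBall p x K n)) :=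
    h2.mono' (hm n).aestronglyMeasurable (Eventually.of_forall hle)
  refine ⟨h1, (integral_mono h1.abs h2 hle).trans ?_⟩
  rw [integral_add (integrable_const _) ((hD n).1.const_mul _), integral_const_mul]
  refine add_le_add ?_ ?_
  · simp only [integral_const, smul_eq_mul, mul_one]
    exact ENNReal.toReal_le_of_le_ofReal zero_le_one
      (by simpa using restrict_univ_le_one (μ := μ) (initBall p x K n))
  · rw [inv_mul_le_iff₀ hn']
    exact (hD n).2

end NullAR

/-- `ε² - 1` is square integrable and centred. -/
lemma NoiseAssumption.sq_sub_one (h : NoiseAssumption μ ε) :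
    MemLp (fun ω => ε 0 ω ^ 2 - 1) 2 μ ∧ ∫ ω, (ε 0 ω ^ 2 - 1) ∂μ = 0 := by
  have i2 : Integrable (fun ω => ε 0 ω ^ 2) μ := integrable_pow_of_memLp (h.memLp 0) (by norm_num)
  have i4 : Integrable (fun ω => ε 0 ω ^ 4) μ := integrable_pow_of_memLp (h.memLp 0) (by norm_num)
  refine ⟨MemLp.sub ?_ (memLp_const 1), ?_⟩
  · refine (memLp_two_iff_integrable_sq ((h.measurable 0).pow_const 2).aestronglyMeasurable).2 ?_
    simpa only [← pow_mul] using i4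
  · rw [integral_sub i2 (integrable_const _), h.variance]
    simp

lemma NoiseAssumption.memLp_two (h : NoiseAssumption μ ε) : MemLp (ε 0) 2 μ :=
  (h.memLp 0).mono_exponent (by norm_num)

end MartingaleBound

section LeastSquares

variable {p : ℕ}

lemma sum_Icc_eq_sum_range (f : ℤ → ℝ) (n : ℕ) :
    ∑ t ∈ Finset.Icc (1 : ℤ) n, f t = ∑ s ∈ Finset.range n, f ((s : ℤ) + 1) := by
  symm
  refine Finset.sum_nbij (fun s : ℕ => (s : ℤ) + 1) ?_ ?_ ?_ fun _ _ => rfl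
  · intro s hs
    have := Finset.mem_range.1 hs
    exact Finset.mem_Icc.2 ⟨by omega, by omega⟩
  · intro r _ s _ hrs
    simpa using hrs
  · intro t ht
    obtain ⟨h1, h2⟩ := Finset.mem_Icc.1 ht
    exact ⟨(t - 1).toNat, Finset.mem_coe.2 (Finset.mem_range.2 (by omega)), by simp only; omega⟩

lemma abs_lagComb_le (d : Fin p → ℝ) (x : ℤ → ℝ) (t : ℤ) :
    |lagComb d x t| ≤ ‖d‖ * ∑ i : Fin p, |x (t - (i : ℕ))| := by
  rw [lagComb, Finset.mul_sum]
  refine (Finset.abs_sum_le_sum_abs _ _).trans (Finset.sum_le_sum fun i _ => ?_)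
  rw [abs_mul]
  exact mul_le_mul_of_nonneg_right (norm_le_pi_norm d i) (abs_nonneg _)

lemma lagComb_sq_le (d : Fin p → ℝ) (x : ℤ → ℝ) (t : ℤ) :
    lagComb d x t ^ 2 ≤ ‖d‖ ^ 2 * (p * ∑ i : Fin p, x (t - (i : ℕ)) ^ 2) := by
  rw [← sq_abs]
  refine (pow_le_pow_left₀ (abs_nonneg _) (abs_lagComb_le d x t) 2).trans ?_
  rw [mul_pow]
  refine mul_le_mul_of_nonneg_left ?_ (sq_nonneg _)
  have := sq_sum_le_card_mul_sum_sq (s := (Finset.univ : Finset (Fin p)))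
    (f := fun i => |x (t - (i : ℕ))|)
  simpa using this

/-- The normal matrix of generalized least squares. -/
noncomputable def normalMatrix (p : ℕ) (h : ℤ → ℝ) (n : ℕ) (x : ℤ → ℝ) : Matrix (Fin p) (Fin p) ℝ :=
  ∑ t ∈ Finset.Icc (1 : ℤ) n,
    (h t ^ 2)⁻¹ • Matrix.vecMulVec (lagVector p x (t - 1)) (lagVector p x (t - 1))

lemma normalMatrix_mulVec (h : ℤ → ℝ) (n : ℕ) (x : ℤ → ℝ) (d : Fin p → ℝ) (k : Fin p) :
    (normalMatrix p h n x).mulVec d k =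
      ∑ s ∈ Finset.range n, (h ((s : ℤ) + 1) ^ 2)⁻¹ * (x ((s : ℤ) - (k : ℕ)) * lagComb d x s) := by
  have e := sum_Icc_eq_sum_range
    (fun t => (h t ^ 2)⁻¹ * (x (t - 1 - (k : ℕ)) * lagComb d x (t - 1))) n
  simp only [add_sub_cancel_right] at e
  rw [← e]
  simp only [Matrix.mulVec, dotProduct, normalMatrix, Matrix.sum_apply, Matrix.smul_apply,
    Matrix.vecMulVec_apply, lagVector, smul_eq_mul, Finset.sum_mul]
  rw [Finset.sum_comm]
  refine Finset.sum_congr rfl fun t _ => ?_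
  rw [lagComb, Finset.mul_sum, Finset.mul_sum]
  exact Finset.sum_congr rfl fun i _ => by ring

lemma dotProduct_normalMatrix_mulVec (h : ℤ → ℝ) (n : ℕ) (x : ℤ → ℝ) (d : Fin p → ℝ) :
    d ⬝ᵥ (normalMatrix p h n x).mulVec d =
      ∑ s ∈ Finset.range n, (h ((s : ℤ) + 1) ^ 2)⁻¹ * lagComb d x s ^ 2 := by
  simp only [dotProduct, normalMatrix_mulVec, Finset.mul_sum]
  rw [Finset.sum_comm]
  refine Finset.sum_congr rfl fun s _ => ?_
  have e : lagComb d x (s : ℤ) ^ 2 =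
      (∑ i : Fin p, d i * x ((s : ℤ) - (i : ℕ))) * lagComb d x s := by rw [sq]; rfl
  rw [e, Finset.sum_mul, Finset.mul_sum]
  exact Finset.sum_congr rfl fun i _ => by ring

/-- If the normal matrix is bounded below, then the least squares error is bounded by the score. -/
lemma norm_gls_sub_le {a : Fin p → ℝ} {h x u : ℤ → ℝ} {n : ℕ}
    (hx : ∀ t : ℤ, 1 ≤ t → t ≤ n → x t = ∑ i : Fin p, a i * x (t - ((i : ℕ) + 1)) + u t)
    {κ : ℝ} (hκ : 0 < κ) (hlow : ∀ d : Fin p → ℝ, κ * ‖d‖ ^ 2 ≤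
      ∑ s ∈ Finset.range n, (h ((s : ℤ) + 1) ^ 2)⁻¹ * lagComb d x s ^ 2) :
    ‖gls p h n x - a‖ ≤ κ⁻¹ * ∑ k : Fin p, |∑ s ∈ Finset.range n,
      (h ((s : ℤ) + 1) ^ 2)⁻¹ * u ((s : ℤ) + 1) * x ((s : ℤ) - (k : ℕ))| := by
  set M := normalMatrix p h n x with hM
  set S : Fin p → ℝ := fun k => ∑ s ∈ Finset.range n,
      (h ((s : ℤ) + 1) ^ 2)⁻¹ * u ((s : ℤ) + 1) * x ((s : ℤ) - (k : ℕ)) with hS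
  have hinj : Function.Injective M.mulVec := by
    intro d d' hdd
    have h1 : M.mulVec (d - d') = 0 := by rw [Matrix.mulVec_sub, hdd, sub_self]
    have h2 := hlow (d - d')
    rw [← dotProduct_normalMatrix_mulVec, ← hM, h1, dotProduct_zero] at h2
    have h3 : ‖d - d'‖ ^ 2 ≤ 0 := by
      by_contra hcon
      push Not at hcon
      nlinarith [mul_pos hκ hcon]
    have h4 : ‖d - d'‖ = 0 := by
      have := sq_nonneg ‖d - d'‖
      exact pow_eq_zero_iff (two_ne_zero) |>.1 (le_antisymm h3 this)
    exact sub_eq_zero.1 (norm_eq_zero.1 h4)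
  have hunit : IsUnit M := Matrix.mulVec_injective_iff_isUnit.1 hinj
  have hdet : IsUnit M.det := (Matrix.isUnit_iff_isUnit_det M).1 hunit
  have hrhs : ∑ t ∈ Finset.Icc (1 : ℤ) n, ((h t ^ 2)⁻¹ * x t) • lagVector p x (t - 1) =
      M.mulVec a + S := by
    ext k
    rw [Pi.add_apply, hM, normalMatrix_mulVec, Finset.sum_apply]
    simp only [Pi.smul_apply, smul_eq_mul, lagVector]
    rw [sum_Icc_eq_sum_range (fun t => (h t ^ 2)⁻¹ * x t * x (t - 1 - (k : ℕ))) n, hS,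
      ← Finset.sum_add_distrib]
    refine Finset.sum_congr rfl fun s hs => ?_
    have hs' := Finset.mem_range.1 hs
    rw [add_sub_cancel_right, hx _ (by omega) (by omega), lagComb]
    simp only [add_sub_add_right_eq_sub]
    ring
  set δ := gls p h n x - a with hδ
  have hMδ : M.mulVec δ = S := by
    have e1 : gls p h n x = M⁻¹.mulVec (M.mulVec a + S) := by rw [← hrhs]; rfl
    rw [hδ, e1, Matrix.mulVec_sub, Matrix.mulVec_mulVec, Matrix.mul_nonsing_inv _ hdet,
      Matrix.one_mulVec, add_sub_cancel_left]
  have h1 := hlow δ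
  rw [← dotProduct_normalMatrix_mulVec, ← hM, hMδ] at h1
  have h2 : δ ⬝ᵥ S ≤ ‖δ‖ * ∑ k, |S k| := by
    rw [dotProduct, Finset.mul_sum]
    refine Finset.sum_le_sum fun k _ => (le_abs_self _).trans ?_
    rw [abs_mul]
    exact mul_le_mul_of_nonneg_right (norm_le_pi_norm δ k) (abs_nonneg _)
  rw [le_inv_mul_iff₀ hκ]
  rcases (norm_nonneg δ).eq_or_lt with h0 | h0
  · rw [← h0, mul_zero]
    exact Finset.sum_nonneg fun _ _ => abs_nonneg _
  · have h3 : ‖δ‖ * (κ * ‖δ‖) ≤ ‖δ‖ * ∑ k, |S k| := by nlinarith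
    exact le_of_mul_le_mul_left h3 h0

/-- The empirical second moment form is nearly invariant under the companion matrix. -/
lemma average_lagComb_sq_ge {a : Fin p → ℝ} {x u : ℤ → ℝ} {n : ℕ}
    (hx : ∀ t : ℤ, 1 ≤ t → t ≤ n → x t = ∑ i : Fin p, a i * x (t - ((i : ℕ) + 1)) + u t)
    {b : ℝ} (hb : ∀ d, ‖companion a d‖ ≤ b * ‖d‖) (d : Fin p → ℝ) :
    (n : ℝ)⁻¹ * ∑ s ∈ Finset.range n, lagComb (companion a d) x s ^ 2 +
      ((n : ℝ)⁻¹ * ∑ s ∈ Finset.range n, u ((s : ℤ) + 1) ^ 2) * coord ℝ p 0 d ^ 2 -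
      (2 * b * ∑ k : Fin p, |(n : ℝ)⁻¹ *
        ∑ s ∈ Finset.range n, u ((s : ℤ) + 1) * x ((s : ℤ) - (k : ℕ))| +
        (n : ℝ)⁻¹ * (p * ∑ k : Fin p, x ((n : ℤ) - (k : ℕ)) ^ 2)) * ‖d‖ ^ 2 ≤
      (n : ℝ)⁻¹ * ∑ s ∈ Finset.range n, lagComb d x s ^ 2 := by
  set B := companion a d with hB
  set R : Fin p → ℝ := fun k => (n : ℝ)⁻¹ *
    ∑ s ∈ Finset.range n, u ((s : ℤ) + 1) * x ((s : ℤ) - (k : ℕ)) with hR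
  have hstep : ∀ s ∈ Finset.range n, lagComb d x ((s : ℤ) + 1) ^ 2 =
      lagComb B x s ^ 2 + (coord ℝ p 0 d ^ 2 * u ((s : ℤ) + 1) ^ 2 +
        2 * coord ℝ p 0 d * ∑ k : Fin p, B k * (u ((s : ℤ) + 1) * x ((s : ℤ) - (k : ℕ)))) := by
    intro s hs
    have hs' := Finset.mem_range.1 hs
    rw [lagComb_step (hx _ (by omega) (by omega)), add_sub_cancel_right, ← hB]
    have e : ∑ k : Fin p, B k * (u ((s : ℤ) + 1) * x ((s : ℤ) - (k : ℕ))) =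
        u ((s : ℤ) + 1) * lagComb B x s := by
      rw [lagComb, Finset.mul_sum]
      exact Finset.sum_congr rfl fun _ _ => by ring
    rw [e]; ring
  have htel : ∑ s ∈ Finset.range n, lagComb d x ((s : ℤ) + 1) ^ 2 -
      ∑ s ∈ Finset.range n, lagComb d x s ^ 2 = lagComb d x n ^ 2 - lagComb d x 0 ^ 2 := by
    have := Finset.sum_range_sub (fun s : ℕ => lagComb d x (s : ℤ) ^ 2) n
    rw [Finset.sum_sub_distrib] at this
    push_cast at this
    exact this
  have hcross : ∑ s ∈ Finset.range n, ∑ k : Fin p, B k *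
      (u ((s : ℤ) + 1) * x ((s : ℤ) - (k : ℕ))) =
      ∑ k : Fin p, B k * ∑ s ∈ Finset.range n, u ((s : ℤ) + 1) * x ((s : ℤ) - (k : ℕ)) := by
    rw [Finset.sum_comm]
    exact Finset.sum_congr rfl fun k _ => (Finset.mul_sum _ _ _).symm
  have hRB : (n : ℝ)⁻¹ * ∑ s ∈ Finset.range n, ∑ k : Fin p, B k *
      (u ((s : ℤ) + 1) * x ((s : ℤ) - (k : ℕ))) = ∑ k, B k * R k := by
    rw [hcross, Finset.mul_sum]
    exact Finset.sum_congr rfl fun k _ => by rw [hR]; ring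
  have hc0 : |coord ℝ p 0 d| ≤ ‖d‖ := by
    rcases Nat.eq_zero_or_pos p with rfl | hp
    · simp [coord_of_le]
    · rw [coord_of_lt hp]; exact norm_le_pi_norm d _
  have hBR : |∑ k, B k * R k| ≤ b * ‖d‖ * ∑ k, |R k| := by
    rw [Finset.mul_sum]
    refine (Finset.abs_sum_le_sum_abs _ _).trans (Finset.sum_le_sum fun k _ => ?_)
    rw [abs_mul]
    exact mul_le_mul_of_nonneg_right ((norm_le_pi_norm B k).trans (hb d)) (abs_nonneg _)
  have hprod : -(coord ℝ p 0 d * ∑ k, B k * R k) ≤ b * (∑ k, |R k|) * ‖d‖ ^ 2 := by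
    refine (neg_le_abs _).trans ?_
    rw [abs_mul]
    refine (mul_le_mul hc0 hBR (abs_nonneg _) (norm_nonneg _)).trans (le_of_eq ?_)
    ring
  have hend := mul_le_mul_of_nonneg_left (lagComb_sq_le d x n)
    (inv_nonneg.2 (Nat.cast_nonneg (α := ℝ) n))
  have hsum := congrArg (fun y => (n : ℝ)⁻¹ * y) (Finset.sum_congr rfl hstep)
  simp only [Finset.sum_add_distrib, ← Finset.mul_sum, mul_add] at hsum
  rw [show (n : ℝ)⁻¹ * (2 * coord ℝ p 0 d * ∑ s ∈ Finset.range n, ∑ k : Fin p, B k *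
      (u ((s : ℤ) + 1) * x ((s : ℤ) - (k : ℕ)))) = 2 * coord ℝ p 0 d * ∑ k, B k * R k by
    rw [← hRB]; ring] at hsum
  have htel' := congrArg (fun y => (n : ℝ)⁻¹ * y) htel
  simp only [mul_sub] at htel'
  have h0 : 0 ≤ (n : ℝ)⁻¹ * lagComb d x 0 ^ 2 := by positivity
  nlinarith

end LeastSquares

section Rate

variable {Ω : Type*} [mΩ : MeasurableSpace Ω] {μ : Measure Ω} [IsProbabilityMeasure μ] {p : ℕ}
  {a : Fin p → ℝ} {h : ℕ → ℤ → ℝ} {c C : ℝ} {ε : ℤ → Ω → ℝ} {x : ℕ → ℤ → Ω → ℝ}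

lemma NoiseAssumption.tendsto_average_pow (H : NoiseAssumption μ ε) {k : ℕ} (hk : k ≤ 8)
    {w : ℕ → ℕ → ℝ} {W : ℝ} (hw : ∀ n, ∀ s < n, |w n s| ≤ W) :
    Tendsto (fun q : ℕ × Ω => (q.1 : ℝ)⁻¹ * ∑ s ∈ Finset.range q.1,
      w q.1 s * (ε ((s : ℤ) + 1) q.2 ^ k - ∫ ω, ε 0 ω ^ k ∂μ)) (inProb μ) (𝓝 0) := by
  have hpow : Measurable fun y : ℝ => y ^ k := by fun_prop
  have hid : ∀ t, IdentDistrib (fun ω => ε t ω ^ k) (fun ω => ε 0 ω ^ k) μ μ := fun t =>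
    (H.identDistrib t).comp hpow
  have h1 := tendsto_inProb_weighted_average (μ := μ) (ξ := fun s ω => ε ((s : ℤ) + 1) ω ^ k)
    (fun s => (H.measurable _).pow_const k)
    (fun r s hrs => (H.indep.indepFun (i := (r : ℤ) + 1) (j := (s : ℤ) + 1)
      (by simpa using hrs)).comp hpow hpow)
    (fun s => (hid _).trans (hid _).symm) (integrable_pow_of_memLp (H.memLp _) hk)
    (w := fun n s => if s < n then w n s else 0) (W := |W|) (fun n s => by
      split_ifs with hs
      · exact (hw n s hs).trans (le_abs_self W)
      · simp)
  have e : ∫ ω, ε (((0 : ℕ) : ℤ) + 1) ω ^ k ∂μ = ∫ ω, ε 0 ω ^ k ∂μ := (hid _).integral_eq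
  simp only [e] at h1
  refine h1.congr fun q => ?_
  congr 1
  exact Finset.sum_congr rfl fun s hs => by rw [if_pos (Finset.mem_range.1 hs)]

namespace NullAR

lemma boundedInProb_score (H : NullAR μ a h c C ε x) {w : ℕ → ℕ → ℝ} {W : ℝ}
    (hw : ∀ n, ∀ s < n, |w n s| ≤ W) (k : Fin p) :
    BoundedInProb μ fun n ω => (√(n : ℝ))⁻¹ * ∑ s ∈ Finset.range n,
      ε ((s : ℤ) + 1) ω * (w n s * x n ((s : ℤ) - (k : ℕ)) ω) := by
  refine H.boundedInProb_transform (φ := id) measurable_id H.noise.memLp_two H.noise.mean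
    (Y := fun n s ω => w n s * x n ((s : ℤ) - (k : ℕ)) ω) (D₀ := W ^ 2) ?_ ?_
  · intro n s hs
    exact (H.measurable_x_past n s hs.le _ (by have := k.2; omega) (by omega)).const_mul _
  · intro n s hs
    refine ⟨s, hs, fun ω => ?_⟩
    have h1 := one_le_envelope p h ε x n s ω
    have h2 := pow_le_pow_left₀ (abs_nonneg _) (abs_le_envelope h ε x n s k ω) 2
    have h3 := pow_le_pow_right₀ h1 (show 2 ≤ 8 by norm_num)
    have h4 := pow_le_pow_left₀ (abs_nonneg _) (hw n s hs) 2
    rw [sq_abs] at h2 h4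
    rw [mul_pow]
    refine mul_le_mul h4 ?_ (sq_nonneg _) (sq_nonneg _)
    have : 0 ≤ envelope p h ε x n s ω ^ 8 := by positivity
    linarith

lemma tendsto_average_score (H : NullAR μ a h c C ε x) (k : Fin p) :
    Tendsto (fun q : ℕ × Ω => (q.1 : ℝ)⁻¹ * ∑ s ∈ Finset.range q.1,
      h q.1 ((s : ℤ) + 1) * ε ((s : ℤ) + 1) q.2 * x q.1 ((s : ℤ) - (k : ℕ)) q.2)
      (inProb μ) (𝓝 0) := by
  have h1 := (H.boundedInProb_score (w := fun n s => h n ((s : ℤ) + 1)) (W := C)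
    (fun n s hs => by
      rw [abs_of_pos (H.pos.trans_le (H.lower n _ (by omega) (by omega)))]
      exact H.upper n _ (by omega) (by omega)) k).div_tendsto
    (r := fun n => (√(n : ℝ))⁻¹) (by
      exact tendsto_inv_atTop_zero.comp (Real.tendsto_sqrt_atTop.comp tendsto_natCast_atTop_atTop))
  refine h1.congr fun q => ?_
  rw [mul_right_comm, ← mul_inv, Real.mul_self_sqrt (Nat.cast_nonneg _)]
  congr 1
  exact Finset.sum_congr rfl fun s _ => by ring

lemma eventually_average_innovation_sq_ge (H : NullAR μ a h c C ε x) :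
    ∀ᶠ q : ℕ × Ω in inProb μ, c ^ 2 / 2 ≤ (q.1 : ℝ)⁻¹ * ∑ s ∈ Finset.range q.1,
      (h q.1 ((s : ℤ) + 1) * ε ((s : ℤ) + 1) q.2) ^ 2 := by
  have hc := H.pos
  have h1 := H.noise.tendsto_average_pow (k := 2) (by norm_num)
    (w := fun n s => h n ((s : ℤ) + 1) ^ 2) (W := C ^ 2) (fun n s hs => by
      have h1 := H.lower n ((s : ℤ) + 1) (by omega) (by omega)
      have h2 := H.upper n ((s : ℤ) + 1) (by omega) (by omega)
      rw [abs_of_nonneg (sq_nonneg _)]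
      exact pow_le_pow_left₀ (H.pos.le.trans h1) h2 2)
  have h2 := h1.eventually_const_lt (show -(c ^ 2 / 2) < 0 by have := H.pos; nlinarith)
  filter_upwards [h2, eventually_inProb_of_atTop μ (eventually_gt_atTop 0)] with q hq hq0
  have hn : (0 : ℝ) < q.1 := by exact_mod_cast hq0
  have h3 : c ^ 2 ≤ (q.1 : ℝ)⁻¹ * ∑ s ∈ Finset.range q.1, h q.1 ((s : ℤ) + 1) ^ 2 := by
    rw [le_inv_mul_iff₀ hn]
    calc (q.1 : ℝ) * c ^ 2 = ∑ s ∈ Finset.range q.1, c ^ 2 := by simp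
      _ ≤ _ := Finset.sum_le_sum fun s hs => pow_le_pow_left₀ hc.le
        (H.lower q.1 _ (by omega) (by have := Finset.mem_range.1 hs; omega)) 2
  have e : (q.1 : ℝ)⁻¹ * ∑ s ∈ Finset.range q.1, (h q.1 ((s : ℤ) + 1) * ε ((s : ℤ) + 1) q.2) ^ 2 =
      (q.1 : ℝ)⁻¹ * ∑ s ∈ Finset.range q.1, h q.1 ((s : ℤ) + 1) ^ 2 *
        (ε ((s : ℤ) + 1) q.2 ^ 2 - ∫ ω, ε 0 ω ^ 2 ∂μ) +
      (q.1 : ℝ)⁻¹ * ∑ s ∈ Finset.range q.1, h q.1 ((s : ℤ) + 1) ^ 2 := by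
    rw [H.noise.variance, ← mul_add, ← Finset.sum_add_distrib]
    congr 1
    exact Finset.sum_congr rfl fun s _ => by ring
  rw [e]
  linarith

lemma exists_eventually_average_lagComb_sq_ge (H : NullAR μ a h c C ε x) :
    ∃ e : ℝ, 0 < e ∧ ∀ᶠ q : ℕ × Ω in inProb μ, ∀ d : Fin p → ℝ, e * ‖d‖ ^ 2 ≤
      (q.1 : ℝ)⁻¹ * ∑ s ∈ Finset.range q.1, lagComb d (fun t => x q.1 t q.2) s ^ 2 := by
  obtain ⟨e, τ, he, hτ, hq⟩ := exists_quadratic_lower_bound a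
    (show 0 < c ^ 2 / 2 by have := H.pos; positivity)
  refine ⟨e, he, ?_⟩
  set b := ‖LinearMap.toContinuousLinearMap (companion a)‖ with hb
  have hbb : ∀ d, ‖companion a d‖ ≤ b * ‖d‖ := fun d =>
    (LinearMap.toContinuousLinearMap (companion a)).le_opNorm d
  have h1 : Tendsto (fun q : ℕ × Ω => 2 * b * ∑ k : Fin p, |(q.1 : ℝ)⁻¹ *
      ∑ s ∈ Finset.range q.1,
        h q.1 ((s : ℤ) + 1) * ε ((s : ℤ) + 1) q.2 * x q.1 ((s : ℤ) - (k : ℕ)) q.2|)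
      (inProb μ) (𝓝 (2 * b * ∑ _k : Fin p, |(0 : ℝ)|)) :=
    (tendsto_finsetSum _ fun k _ => (H.tendsto_average_score k).abs).const_mul _
  have h2 : Tendsto (fun q : ℕ × Ω => p * ((∑ k : Fin p, x q.1 ((q.1 : ℤ) - (k : ℕ)) q.2 ^ 2) *
      (q.1 : ℝ)⁻¹)) (inProb μ) (𝓝 (p * 0)) :=
    (H.boundedInProb_endpoint.div_tendsto tendsto_inv_atTop_nhds_zero_nat).const_mul _
  have h3 := (h1.add h2).eventually_lt_const (show _ < τ by simpa using hτ)
  filter_upwards [h3, H.eventually_average_innovation_sq_ge] with q hq1 hq2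
  refine hq _ (fun d => mul_nonneg (by positivity) (Finset.sum_nonneg fun _ _ => sq_nonneg _))
    fun d => ?_
  have h4 := average_lagComb_sq_ge (x := fun t => x q.1 t q.2)
    (u := fun t => h q.1 t * ε t q.2) (n := q.1)
    (fun t ht1 ht2 => H.observation q.1 t ht1 ht2 q.2) hbb d
  refine le_trans ?_ h4
  have h5 := mul_le_mul_of_nonneg_right hq2 (sq_nonneg (coord ℝ p 0 d))
  have h6 := mul_le_mul_of_nonneg_right hq1.le (sq_nonneg ‖d‖)
  rw [show (p : ℝ) * ((∑ k : Fin p, x q.1 ((q.1 : ℤ) - (k : ℕ)) q.2 ^ 2) * (q.1 : ℝ)⁻¹) =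
    (q.1 : ℝ)⁻¹ * (p * ∑ k : Fin p, x q.1 ((q.1 : ℤ) - (k : ℕ)) q.2 ^ 2) by ring] at h6
  linarith

/-- The rate of the generalized least squares estimator. -/
lemma tendsto_gls_rate (H : NullAR μ a h c C ε x) :
    Tendsto (fun q : ℕ × Ω => √√(q.1 : ℝ) * ‖gls p (h q.1) q.1 (fun t => x q.1 t q.2) - a‖)
      (inProb μ) (𝓝 0) := by
  obtain ⟨e, he, hq⟩ := H.exists_eventually_average_lagComb_sq_ge
  have hc := H.pos
  have hC : 0 < C := hc.trans_le ((H.lower 1 1 le_rfl le_rfl).trans (H.upper 1 1 le_rfl le_rfl))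
  have hr : Tendsto (fun n : ℕ => (√√(n : ℝ))⁻¹) atTop (𝓝 0) :=
    tendsto_inv_atTop_zero.comp (Real.tendsto_sqrt_atTop.comp
      (Real.tendsto_sqrt_atTop.comp tendsto_natCast_atTop_atTop))
  have hb : ∀ k : Fin p, BoundedInProb μ fun n ω => (√(n : ℝ))⁻¹ * ∑ s ∈ Finset.range n,
      ε ((s : ℤ) + 1) ω * ((h n ((s : ℤ) + 1))⁻¹ * x n ((s : ℤ) - (k : ℕ)) ω) := by
    refine H.boundedInProb_score (w := fun n s => (h n ((s : ℤ) + 1))⁻¹) (W := c⁻¹)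
      fun n s hs => ?_
    have h1 := H.lower n ((s : ℤ) + 1) (by omega) (by omega)
    rw [abs_of_pos (inv_pos.2 (hc.trans_le h1))]
    exact inv_anti₀ hc h1
  have hb' := fun k => (hb k).div_tendsto hr
  have h1 : Tendsto (fun q : ℕ × Ω => (e * (C ^ 2)⁻¹)⁻¹ * ∑ k : Fin p, |((√(q.1 : ℝ))⁻¹ *
      ∑ s ∈ Finset.range q.1, ε ((s : ℤ) + 1) q.2 * ((h q.1 ((s : ℤ) + 1))⁻¹ *
        x q.1 ((s : ℤ) - (k : ℕ)) q.2)) * (√√(q.1 : ℝ))⁻¹|)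
      (inProb μ) (𝓝 ((e * (C ^ 2)⁻¹)⁻¹ * ∑ _k : Fin p, |(0 : ℝ)|)) := by
    exact (tendsto_finsetSum _ fun k _ => (hb' k).abs).const_mul _
  refine squeeze_zero' (Eventually.of_forall fun q => by positivity) ?_
    (by simpa only [abs_zero, Finset.sum_const_zero, mul_zero] using h1)
  filter_upwards [hq, eventually_inProb_of_atTop μ (eventually_gt_atTop 0)] with q hq hq0
  have hn : (0 : ℝ) < q.1 := by exact_mod_cast hq0
  have hκ : 0 < q.1 * (e * (C ^ 2)⁻¹) := by positivity
  have h2 := norm_gls_sub_le (x := fun t => x q.1 t q.2) (h := h q.1)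
    (u := fun t => h q.1 t * ε t q.2) (n := q.1)
    (fun t ht1 ht2 => H.observation q.1 t ht1 ht2 q.2) hκ (fun d => by
      have h3 := hq d
      rw [le_inv_mul_iff₀ hn] at h3
      calc q.1 * (e * (C ^ 2)⁻¹) * ‖d‖ ^ 2 = (C ^ 2)⁻¹ * (q.1 * (e * ‖d‖ ^ 2)) := by ring
        _ ≤ (C ^ 2)⁻¹ * ∑ s ∈ Finset.range q.1, lagComb d (fun t => x q.1 t q.2) s ^ 2 :=
          mul_le_mul_of_nonneg_left h3 (by positivity)
        _ ≤ _ := by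
          rw [Finset.mul_sum]
          refine Finset.sum_le_sum fun s hs => mul_le_mul_of_nonneg_right ?_ (sq_nonneg _)
          have hs' := Finset.mem_range.1 hs
          have h4 := H.lower q.1 ((s : ℤ) + 1) (by omega) (by omega)
          have h5 := H.upper q.1 ((s : ℤ) + 1) (by omega) (by omega)
          have h6 := hc.trans_le h4
          exact inv_anti₀ (by positivity) (pow_le_pow_left₀ h6.le h5 2))
  refine (mul_le_mul_of_nonneg_left h2 (by positivity)).trans (le_of_eq ?_)
  have hsn : 0 < √√(q.1 : ℝ) := Real.sqrt_pos.2 (Real.sqrt_pos.2 hn)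
  have e1 : √(q.1 : ℝ) = √√(q.1 : ℝ) * √√(q.1 : ℝ) := (Real.mul_self_sqrt (Real.sqrt_nonneg _)).symm
  have e2 : (q.1 : ℝ) = √(q.1 : ℝ) * √(q.1 : ℝ) := (Real.mul_self_sqrt hn.le).symm
  have e3 : √√(q.1 : ℝ) * (q.1 * (e * (C ^ 2)⁻¹))⁻¹ =
      (e * (C ^ 2)⁻¹)⁻¹ * ((√(q.1 : ℝ))⁻¹ * (√√(q.1 : ℝ))⁻¹) := by
    rw [mul_inv]
    nth_rw 2 [e2]
    rw [mul_inv]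
    nth_rw 2 [e1]
    field_simp
  rw [← mul_assoc, e3, mul_assoc, Finset.mul_sum]
  congr 1
  refine Finset.sum_congr rfl fun k _ => ?_
  rw [mul_right_comm, abs_mul, abs_mul, abs_of_pos (inv_pos.2 (Real.sqrt_pos.2 hn)),
    abs_of_pos (inv_pos.2 hsn)]
  congr 3
  refine Finset.sum_congr rfl fun s hs => ?_
  have hs' := Finset.mem_range.1 hs
  have h4 := hc.trans_le (H.lower q.1 ((s : ℤ) + 1) (by omega) (by omega))
  field_simp

end NullAR

end Rate

section Ratio

variable {α : Type*} {l : Filter α} {X G : α → ℝ} {b : ℝ}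

lemma tendsto_div_of_tendsto_sub (hb : 0 < b) (hG : ∀ᶠ q in l, b ≤ G q)
    (h : Tendsto (fun q => X q - G q) l (𝓝 0)) : Tendsto (fun q => X q / G q) l (𝓝 1) := by
  have h1 : Tendsto (fun q => X q / G q - 1) l (𝓝 0) := by
    refine squeeze_zero_norm' (a := fun q => |X q - G q| * b⁻¹) ?_
      (by simpa using h.abs.mul_const b⁻¹)
    filter_upwards [hG] with q hq
    have hG0 := hb.trans_le hq
    rw [div_sub_one hG0.ne', Real.norm_eq_abs, abs_div, abs_of_pos hG0, div_eq_mul_inv]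
    exact mul_le_mul_of_nonneg_left (inv_anti₀ hb hq) (abs_nonneg _)
  simpa using h1.add_const 1

end Ratio

section Residuals

/-- The residuals of generalized least squares. -/
noncomputable def glsResid {Ω : Type*} (p : ℕ) (h : ℕ → ℤ → ℝ) (x : ℕ → ℤ → Ω → ℝ) (n : ℕ)
    (ω : Ω) : ℤ → ℝ :=
  resid (fun t => x n t ω) (gls p (h n) n (fun t => x n t ω))

/-- The estimation error of generalized least squares. -/
noncomputable def glsError {Ω : Type*} {p : ℕ} (a : Fin p → ℝ) (h : ℕ → ℤ → ℝ)
    (x : ℕ → ℤ → Ω → ℝ) (n : ℕ) (ω : Ω) : Fin p → ℝ :=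
  gls p (h n) n (fun t => x n t ω) - a

lemma abs_pow_sub_pow_le_envelope {u v H D : ℝ} (hH : 1 ≤ H) (hD0 : 0 ≤ D) (hD : D ≤ 1)
    (hu : |u| ≤ H) (hv : |v - u| ≤ D * H) {k : ℕ} (hk : k ≤ 8) :
    |v ^ k - u ^ k| ≤ D * (k * 2 ^ k) * H ^ 8 := by
  rcases k with _ | k
  · simp
  have hH0 : 0 ≤ H := zero_le_one.trans hH
  have hv2 : |v| ≤ 2 * H := by
    calc |v| = |(v - u) + u| := by rw [sub_add_cancel]
      _ ≤ D * H + H := (abs_add_le _ _).trans (add_le_add hv hu)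
      _ ≤ 2 * H := by nlinarith
  have h1 := abs_pow_sub_pow_le v u (k + 1)
  rw [Nat.add_sub_cancel] at h1
  have hmax : max |v| |u| ≤ 2 * H := max_le hv2 (by linarith)
  calc |v ^ (k + 1) - u ^ (k + 1)| ≤ |v - u| * (k + 1 : ℕ) * max |v| |u| ^ k := h1
    _ ≤ (D * H) * (k + 1 : ℕ) * (2 * H) ^ k := by
        gcongr
    _ = D * ((k + 1 : ℕ) * 2 ^ k) * H ^ (k + 1) := by rw [mul_pow]; ring
    _ ≤ D * ((k + 1 : ℕ) * 2 ^ (k + 1)) * H ^ 8 := by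
        gcongr
        · norm_num
        · exact Nat.le_succ k

/-- The average of `h_t^k`. -/
noncomputable def volAverage (h : ℕ → ℤ → ℝ) (k n : ℕ) : ℝ :=
  (n : ℝ)⁻¹ * ∑ s ∈ Finset.range n, h n ((s : ℤ) + 1) ^ k

lemma abs_lagComb_le_envelope {Ω : Type*} {p : ℕ} (d : Fin p → ℝ) (h : ℕ → ℤ → ℝ) (ε : ℤ → Ω → ℝ)
    (x : ℕ → ℤ → Ω → ℝ) (n s : ℕ) (ω : Ω) :
    |lagComb d (fun t => x n t ω) s| ≤ ‖d‖ * envelope p h ε x n s ω :=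
  (abs_lagComb_le d _ _).trans
    (mul_le_mul_of_nonneg_left (sum_abs_le_envelope p h ε x n s ω) (norm_nonneg d))

variable {Ω : Type*} [mΩ : MeasurableSpace Ω] {μ : Measure Ω} {p : ℕ}
  {a : Fin p → ℝ} {h : ℕ → ℤ → ℝ} {c C : ℝ} {ε : ℤ → Ω → ℝ} {x : ℕ → ℤ → Ω → ℝ}

namespace NullAR

lemma abs_vol_le (H : NullAR μ a h c C ε x) {n : ℕ} {t : ℤ} (h1 : 1 ≤ t) (h2 : t ≤ n) :
    |h n t| ≤ C := by
  rw [abs_of_pos (H.pos.trans_le (H.lower n t h1 h2))]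
  exact H.upper n t h1 h2

lemma inv_mul_sum_inv_mul (H : NullAR μ a h c C ε x) {n : ℕ} (hn : 0 < n) (k : ℕ) :
    (n : ℝ)⁻¹ * ∑ s ∈ Finset.range n, (h n ((s : ℤ) + 1) ^ k)⁻¹ * h n ((s : ℤ) + 1) ^ k = 1 := by
  have hn' : (n : ℝ) ≠ 0 := by exact_mod_cast hn.ne'
  have e : ∀ s ∈ Finset.range n, (h n ((s : ℤ) + 1) ^ k)⁻¹ * h n ((s : ℤ) + 1) ^ k = 1 :=
    fun s hs => inv_mul_cancel₀ (pow_pos (H.pos.trans_le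
      (H.lower n ((s : ℤ) + 1) (by omega) (by have := Finset.mem_range.1 hs; omega))) k).ne'
  rw [Finset.sum_congr rfl e]
  simp [hn']

lemma pow_le_volAverage (H : NullAR μ a h c C ε x) (k : ℕ) {n : ℕ} (hn : 0 < n) :
    c ^ k ≤ volAverage h k n := by
  have hn' : (0 : ℝ) < n := by exact_mod_cast hn
  rw [volAverage, le_inv_mul_iff₀ hn']
  calc (n : ℝ) * c ^ k = ∑ s ∈ Finset.range n, c ^ k := by simp
    _ ≤ _ := Finset.sum_le_sum fun s hs => pow_le_pow_left₀ H.pos.le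
      (H.lower n _ (by omega) (by have := Finset.mem_range.1 hs; omega)) k

lemma glsResid_eq (H : NullAR μ a h c C ε x) {n s : ℕ} (hs : s < n) (ω : Ω) :
    glsResid p h x n ω ((s : ℤ) + 1) = h n ((s : ℤ) + 1) * ε ((s : ℤ) + 1) ω -
      lagComb (glsError a h x n ω) (fun t => x n t ω) s := by
  rw [glsResid, resid, H.observation n _ (by omega) (by omega), lagComb, glsError]
  simp only [add_sub_add_right_eq_sub, Pi.sub_apply, sub_mul, Finset.sum_sub_distrib]
  ring

end NullAR

namespace NullAR

variable [IsProbabilityMeasure μ]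

lemma tendsto_norm_glsError (H : NullAR μ a h c C ε x) :
    Tendsto (fun q : ℕ × Ω => ‖glsError a h x q.1 q.2‖) (inProb μ) (𝓝 0) := by
  refine squeeze_zero' (Eventually.of_forall fun q => norm_nonneg _) ?_ H.tendsto_gls_rate
  filter_upwards [eventually_inProb_of_atTop μ (eventually_ge_atTop 1)] with q hq
  have h1 : (1 : ℝ) ≤ q.1 := by exact_mod_cast hq
  exact le_mul_of_one_le_left (norm_nonneg _)
    (Real.one_le_sqrt.2 (Real.one_le_sqrt.2 h1))

/-- Weighted averages of powers of the residuals. -/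
lemma tendsto_average_glsResid_pow (H : NullAR μ a h c C ε x) {k : ℕ} (hk : k ≤ 8)
    {w : ℕ → ℕ → ℝ} {W : ℝ} (hw : ∀ n, ∀ s < n, |w n s| ≤ W) :
    Tendsto (fun q : ℕ × Ω =>
      (q.1 : ℝ)⁻¹ * ∑ s ∈ Finset.range q.1, w q.1 s * glsResid p h x q.1 q.2 ((s : ℤ) + 1) ^ k -
      (∫ ω, ε 0 ω ^ k ∂μ) * ((q.1 : ℝ)⁻¹ * ∑ s ∈ Finset.range q.1,
        w q.1 s * h q.1 ((s : ℤ) + 1) ^ k)) (inProb μ) (𝓝 0) := by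
  have h1 := H.noise.tendsto_average_pow hk (w := fun n s => w n s * h n ((s : ℤ) + 1) ^ k)
    (W := W * C ^ k) (fun n s hs => by
      rw [abs_mul, abs_pow]
      exact mul_le_mul (hw n s hs) (pow_le_pow_left₀ (abs_nonneg _)
        (H.abs_vol_le (by omega) (by omega)) k) (by positivity) ((abs_nonneg _).trans (hw n s hs)))
  have h2 := H.boundedInProb_average_envelope.mul_tendsto
    (Y := fun n ω => ‖glsError a h x n ω‖) H.tendsto_norm_glsError
  have h3 : Tendsto (fun q : ℕ × Ω =>
      (q.1 : ℝ)⁻¹ * ∑ s ∈ Finset.range q.1, w q.1 s *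
        (glsResid p h x q.1 q.2 ((s : ℤ) + 1) ^ k -
          (h q.1 ((s : ℤ) + 1) * ε ((s : ℤ) + 1) q.2) ^ k)) (inProb μ) (𝓝 0) := by
    refine squeeze_zero_norm' ?_ (by simpa using h2.const_mul (|W| * (k * 2 ^ k)))
    filter_upwards [H.tendsto_norm_glsError.eventually_lt_const zero_lt_one] with q hq
    rw [Real.norm_eq_abs, abs_mul, abs_of_nonneg (by positivity : (0 : ℝ) ≤ (q.1 : ℝ)⁻¹)]
    have hsum : |∑ s ∈ Finset.range q.1, w q.1 s * (glsResid p h x q.1 q.2 ((s : ℤ) + 1) ^ k -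
        (h q.1 ((s : ℤ) + 1) * ε ((s : ℤ) + 1) q.2) ^ k)| ≤ |W| * (‖glsError a h x q.1 q.2‖ *
          (k * 2 ^ k) * ∑ s ∈ Finset.range q.1, envelope p h ε x q.1 s q.2 ^ 8) := by
      rw [Finset.mul_sum, Finset.mul_sum]
      refine (Finset.abs_sum_le_sum_abs _ _).trans (Finset.sum_le_sum fun s hs => ?_)
      have hs' := Finset.mem_range.1 hs
      rw [abs_mul]
      refine mul_le_mul ((hw _ s hs').trans (le_abs_self W)) ?_ (abs_nonneg _) (abs_nonneg _)
      refine abs_pow_sub_pow_le_envelope (one_le_envelope p h ε x q.1 s q.2) (norm_nonneg _) hq.le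
        (abs_innovation_le_envelope p h ε x q.1 s q.2) ?_ hk
      rw [H.glsResid_eq hs', sub_sub_cancel_left, abs_neg]
      exact abs_lagComb_le_envelope _ h ε x q.1 s q.2
    refine (mul_le_mul_of_nonneg_left hsum (by positivity)).trans (le_of_eq ?_)
    ring
  refine (by simpa using h3.add h1 : Tendsto _ _ _).congr fun q => ?_
  rw [← mul_add, ← Finset.sum_add_distrib, mul_left_comm, ← mul_sub]
  congr 1
  rw [Finset.mul_sum, ← Finset.sum_sub_distrib]
  refine Finset.sum_congr rfl fun s _ => ?_
  rw [mul_pow]; ring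

lemma tendsto_omegaBar_div (H : NullAR μ a h c C ε x) {k : ℕ} (hk : k ≤ 8)
    (hm : 0 < ∫ ω, ε 0 ω ^ k ∂μ) :
    Tendsto (fun q : ℕ × Ω => omegaBar k q.1 (h q.1) (glsResid p h x q.1 q.2) /
      volAverage h k q.1) (inProb μ) (𝓝 1) := by
  set mk := ∫ ω, ε 0 ω ^ k ∂μ with hmk
  have hc := H.pos
  have hn0 := eventually_inProb_of_atTop μ (eventually_gt_atTop 0)
  have h1 := H.tendsto_average_glsResid_pow hk (w := fun _ _ => 1) (W := 1) (by simp)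
  have h2 := H.tendsto_average_glsResid_pow hk (w := fun n s => (h n ((s : ℤ) + 1) ^ k)⁻¹)
    (W := (c ^ k)⁻¹) (fun n s hs => by
      have h1 := H.lower n ((s : ℤ) + 1) (by omega) (by omega)
      rw [abs_of_pos (inv_pos.2 (pow_pos (hc.trans_le h1) k))]
      exact inv_anti₀ (pow_pos hc k) (pow_le_pow_left₀ hc.le h1 k))
  have t1 := tendsto_div_of_tendsto_sub (b := mk * c ^ k) (mul_pos hm (pow_pos hc k))
    (hn0.mono fun q hq => ?_) h1
  · have t2 := tendsto_div_of_tendsto_sub (b := mk) hm (hn0.mono fun q hq => ?_) h2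
    · have t3 := t1.div t2 one_ne_zero
      rw [div_one] at t3
      refine t3.congr' ?_
      filter_upwards [hn0] with q hq
      have hG : 0 < volAverage h k q.1 := (pow_pos hc k).trans_le (H.pow_le_volAverage k hq)
      have e1 : (q.1 : ℝ)⁻¹ * ∑ s ∈ Finset.range q.1, (h q.1 ((s : ℤ) + 1) ^ k)⁻¹ *
          h q.1 ((s : ℤ) + 1) ^ k = 1 := H.inv_mul_sum_inv_mul hq k
      rw [omegaBar, noiseMoment, sum_Icc_eq_sum_range (fun t => glsResid p h x q.1 q.2 t ^ k),
        sum_Icc_eq_sum_range (fun t => glsResid p h x q.1 q.2 t ^ k * (h q.1 t ^ k)⁻¹), Pi.div_apply,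
        e1, mul_one]
      simp only [one_mul, mul_comm (_ ^ k) (_)⁻¹]
      rw [show (q.1 : ℝ)⁻¹ * ∑ s ∈ Finset.range q.1, h q.1 ((s : ℤ) + 1) ^ k =
        volAverage h k q.1 from rfl]
      rw [← hmk]
      have := hm.ne'
      field_simp
    · rw [H.inv_mul_sum_inv_mul hq k, mul_one]
  · simp only [one_mul]
    exact mul_le_mul_of_nonneg_left (H.pow_le_volAverage k hq) hm.le

lemma tendsto_gammaHat_zero_div (H : NullAR μ a h c C ε x) :
    Tendsto (fun q : ℕ × Ω => gammaHat q.1 (fun t => h q.1 t ^ 2) (glsResid p h x q.1 q.2) 0 /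
      (((∫ ω, ε 0 ω ^ 4 ∂μ) - 1) * volAverage h 4 q.1)) (inProb μ) (𝓝 1) := by
  have hc := H.pos
  have hm := sub_pos.2 H.noise.fourth
  have hn0 := eventually_inProb_of_atTop μ (eventually_gt_atTop 0)
  have h1 := H.tendsto_average_glsResid_pow (k := 4) (by norm_num) (w := fun _ _ => 1) (W := 1)
    (by simp)
  have h2 := H.tendsto_average_glsResid_pow (k := 2) (by norm_num)
    (w := fun n s => h n ((s : ℤ) + 1) ^ 2) (W := C ^ 2) (fun n s hs => by
      rw [abs_pow]
      exact pow_le_pow_left₀ (abs_nonneg _) (H.abs_vol_le (by omega) (by omega)) 2)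
  refine tendsto_div_of_tendsto_sub (mul_pos hm (pow_pos hc 4)) (hn0.mono fun q hq =>
    mul_le_mul_of_nonneg_left (H.pow_le_volAverage 4 hq) hm.le) ?_
  refine (by simpa using h1.sub (h2.const_mul 2) : Tendsto _ _ _).congr fun q => ?_
  rw [gammaHat, volAverage, H.noise.variance]
  simp only [Nat.cast_zero, add_zero, sub_zero]
  rw [sum_Icc_eq_sum_range (fun t => (glsResid p h x q.1 q.2 t ^ 2 - h q.1 t ^ 2) *
    (glsResid p h x q.1 q.2 t ^ 2 - h q.1 t ^ 2))]
  have e : ∀ s : ℕ, (glsResid p h x q.1 q.2 ((s : ℤ) + 1) ^ 2 - h q.1 ((s : ℤ) + 1) ^ 2) *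
      (glsResid p h x q.1 q.2 ((s : ℤ) + 1) ^ 2 - h q.1 ((s : ℤ) + 1) ^ 2) =
      glsResid p h x q.1 q.2 ((s : ℤ) + 1) ^ 4 - 2 * (h q.1 ((s : ℤ) + 1) ^ 2 *
        glsResid p h x q.1 q.2 ((s : ℤ) + 1) ^ 2) + h q.1 ((s : ℤ) + 1) ^ 4 := fun s => by ring
  have e' : ∀ s : ℕ, h q.1 ((s : ℤ) + 1) ^ 2 * h q.1 ((s : ℤ) + 1) ^ 2 =
      h q.1 ((s : ℤ) + 1) ^ 4 := fun s => by ring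
  simp only [e, e', Finset.sum_add_distrib, Finset.sum_sub_distrib, ← Finset.mul_sum, one_mul]
  ring

end NullAR

end Residuals

section LagSums

lemma sum_Icc_lag_eq_sum_range (f : ℤ → ℝ) (n j : ℕ) :
    ∑ t ∈ Finset.Icc (1 + (j : ℤ)) n, f t =
      ∑ s ∈ Finset.range n, if j ≤ s then f ((s : ℤ) + 1) else 0 := by
  have h1 := sum_Icc_eq_sum_range (fun t => if 1 + (j : ℤ) ≤ t then f t else 0) n
  have e : ∀ s : ℕ, (1 + (j : ℤ) ≤ (s : ℤ) + 1) ↔ j ≤ s := fun s => by omega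
  simp only [e] at h1
  rw [← h1, ← Finset.sum_filter]
  congr 1
  ext t
  simp only [Finset.mem_Icc, Finset.mem_filter]
  omega

lemma sum_lag_le {f : ℕ → ℝ} (hf : ∀ s, 0 ≤ f s) (n k : ℕ) :
    ∑ s ∈ Finset.range n, (if k ≤ s then f (s - k) else 0) ≤ ∑ s ∈ Finset.range n, f s := by
  rcases le_or_gt k n with hk | hk
  · obtain ⟨m, rfl⟩ := Nat.exists_eq_add_of_le hk
    rw [Finset.sum_range_add]
    have e1 : ∑ s ∈ Finset.range k, (if k ≤ s then f (s - k) else 0) = 0 :=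
      Finset.sum_eq_zero fun s hs => if_neg (not_le.2 (Finset.mem_range.1 hs))
    have e2 : ∑ s ∈ Finset.range m, (if k ≤ k + s then f (k + s - k) else 0) =
        ∑ s ∈ Finset.range m, f s :=
      Finset.sum_congr rfl fun s _ => by simp
    rw [e1, zero_add, e2]
    exact Finset.sum_le_sum_of_subset_of_nonneg (Finset.range_subset_range.2 (by omega))
      fun s _ _ => hf s
  · rw [Finset.sum_eq_zero fun s hs => if_neg (by have := Finset.mem_range.1 hs; omega)]
    exact Finset.sum_nonneg fun s _ => hf s

/-- Second order remainder in the product of two perturbed centred squares. -/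
lemma abs_mul_remainder_le {U U' u u' d d' H H' D A : ℝ} (hD0 : 0 ≤ D) (hD : D ≤ 1)
    (hH : 1 ≤ H) (hH' : 1 ≤ H') (hA : 0 ≤ A) (hu : |u| ≤ H) (hu' : |u'| ≤ H')
    (hU : |U| ≤ A * H ^ 2) (hU' : |U'| ≤ A * H' ^ 2)
    (hd : |d| ≤ D * H) (hd' : |d'| ≤ D * H') :
    |U * d' ^ 2 + d ^ 2 * U' + (-2 * u * d + d ^ 2) * (-2 * u' * d' + d' ^ 2)| ≤
      (2 * A + 9) * D ^ 2 * (H ^ 8 + H' ^ 8) := by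
  have hsq : ∀ {d H : ℝ}, |d| ≤ D * H → d ^ 2 ≤ D ^ 2 * H ^ 2 := fun {d H} h => by
    rw [← sq_abs, ← mul_pow]; exact pow_le_pow_left₀ (abs_nonneg _) h 2
  have he : ∀ {u d H : ℝ}, 1 ≤ H → |u| ≤ H → |d| ≤ D * H →
      |-2 * u * d + d ^ 2| ≤ 3 * D * H ^ 2 := fun {u d H} h1 h2 h3 => by
    refine (abs_add_le _ _).trans ?_
    have h4 : |-2 * u * d| ≤ 2 * (H * (D * H)) := by
      rw [mul_assoc, abs_mul, abs_mul]
      norm_num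
      exact mul_le_mul h2 h3 (abs_nonneg _) (by linarith)
    have h5 : |d ^ 2| ≤ D * H ^ 2 := by
      rw [abs_of_nonneg (sq_nonneg _)]
      refine (hsq h3).trans (mul_le_mul_of_nonneg_right ?_ (sq_nonneg _))
      nlinarith
    linarith [show 2 * (H * (D * H)) = 2 * D * H ^ 2 by ring]
  have hHH : H ^ 2 * H' ^ 2 ≤ H ^ 8 + H' ^ 8 := by
    have h1 : H ^ 2 * H' ^ 2 ≤ H ^ 4 + H' ^ 4 := by
      nlinarith [sq_nonneg (H ^ 2 - H' ^ 2), sq_nonneg (H ^ 2 + H' ^ 2)]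
    have h2 := pow_le_pow_right₀ hH (show 4 ≤ 8 by norm_num)
    have h3 := pow_le_pow_right₀ hH' (show 4 ≤ 8 by norm_num)
    linarith
  have t1 : |U * d' ^ 2| ≤ A * D ^ 2 * (H ^ 2 * H' ^ 2) := by
    rw [abs_mul, abs_of_nonneg (sq_nonneg d')]
    calc _ ≤ (A * H ^ 2) * (D ^ 2 * H' ^ 2) :=
          mul_le_mul hU (hsq hd') (sq_nonneg _) (by positivity)
      _ = _ := by ring
  have t2 : |d ^ 2 * U'| ≤ A * D ^ 2 * (H ^ 2 * H' ^ 2) := by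
    rw [abs_mul, abs_of_nonneg (sq_nonneg d)]
    calc _ ≤ (D ^ 2 * H ^ 2) * (A * H' ^ 2) :=
          mul_le_mul (hsq hd) hU' (abs_nonneg _) (by positivity)
      _ = _ := by ring
  have t3 : |(-2 * u * d + d ^ 2) * (-2 * u' * d' + d' ^ 2)| ≤ 9 * D ^ 2 * (H ^ 2 * H' ^ 2) := by
    rw [abs_mul]
    calc _ ≤ (3 * D * H ^ 2) * (3 * D * H' ^ 2) :=
          mul_le_mul (he hH hu hd) (he hH' hu' hd') (abs_nonneg _) (by positivity)
      _ = _ := by ring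
  have t4 := mul_le_mul_of_nonneg_left hHH (show 0 ≤ (2 * A + 9) * D ^ 2 by positivity)
  refine (abs_add_le _ _).trans ?_
  have := abs_add_le (U * d' ^ 2) (d ^ 2 * U')
  linarith

end LagSums

section Covariances

variable {Ω : Type*} [mΩ : MeasurableSpace Ω] {μ : Measure Ω} {p : ℕ}
  {a : Fin p → ℝ} {h : ℕ → ℤ → ℝ} {c C : ℝ} {ε : ℤ → Ω → ℝ} {x : ℕ → ℤ → Ω → ℝ}

namespace NullAR

lemma abs_sq_innovation_le (H : NullAR μ a h c C ε x) {n s : ℕ} (hs : s < n) (ω : Ω) :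
    |h n ((s : ℤ) + 1) ^ 2 * (ε ((s : ℤ) + 1) ω ^ 2 - 1)| ≤
      (1 + C ^ 2) * envelope p h ε x n s ω ^ 2 := by
  have h1 := pow_le_pow_left₀ (abs_nonneg _) (abs_innovation_le_envelope p h ε x n s ω) 2
  have h2 := pow_le_pow_left₀ (abs_nonneg _)
    (H.abs_vol_le (n := n) (t := (s : ℤ) + 1) (by omega) (by omega)) 2
  have h3 := one_le_pow₀ (n := 2) (one_le_envelope p h ε x n s ω)
  rw [sq_abs] at h1 h2
  have h4 : C ^ 2 ≤ C ^ 2 * envelope p h ε x n s ω ^ 2 := le_mul_of_one_le_right (sq_nonneg _) h3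
  rw [abs_le]
  constructor
  · nlinarith [sq_nonneg (h n ((s : ℤ) + 1) * ε ((s : ℤ) + 1) ω)]
  · nlinarith [sq_nonneg (h n ((s : ℤ) + 1))]

variable [IsProbabilityMeasure μ]

lemma boundedInProb_sq_innovation_transform (H : NullAR μ a h c C ε x) (j : ℕ) (k : Fin p) :
    BoundedInProb μ fun n ω => (√(n : ℝ))⁻¹ * ∑ s ∈ Finset.range n, (ε ((s : ℤ) + 1) ω ^ 2 - 1) *
      (if j + 1 ≤ s then h n ((s : ℤ) + 1) ^ 2 *
        (h n (((s - (j + 1) : ℕ) : ℤ) + 1) * ε (((s - (j + 1) : ℕ) : ℤ) + 1) ω *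
          x n (((s - (j + 1) : ℕ) : ℤ) - (k : ℕ)) ω) else 0) := by
  refine H.boundedInProb_transform (φ := fun y => y ^ 2 - 1) (by fun_prop) H.noise.sq_sub_one.1
    H.noise.sq_sub_one.2 (Y := fun n s ω => if j + 1 ≤ s then h n ((s : ℤ) + 1) ^ 2 *
        (h n (((s - (j + 1) : ℕ) : ℤ) + 1) * ε (((s - (j + 1) : ℕ) : ℤ) + 1) ω *
          x n (((s - (j + 1) : ℕ) : ℤ) - (k : ℕ)) ω) else 0) (D₀ := (C ^ 2) ^ 2) ?_ ?_
  · intro n s hs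
    by_cases hj : j + 1 ≤ s
    · simp only [if_pos hj]
      exact ((((measurable_eps_past p ε x n (by omega)).const_mul _).mul
        (H.measurable_x_past n s hs.le _ (by have := k.2; omega) (by omega)))).const_mul _
    · simp only [if_neg hj]
      exact measurable_const
  · intro n s hs
    refine ⟨s - (j + 1), by omega, fun ω => ?_⟩
    have h0 : 0 ≤ envelope p h ε x n s ω ^ 8 := by positivity
    have h1 := one_le_envelope p h ε x n (s - (j + 1)) ω
    by_cases hj : j + 1 ≤ s
    · rw [if_pos hj, mul_pow]
      have e1 : (h n ((s : ℤ) + 1) ^ 2) ^ 2 ≤ (C ^ 2) ^ 2 := by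
        rw [← sq_abs (h n ((s : ℤ) + 1))]
        have := H.abs_vol_le (n := n) (t := (s : ℤ) + 1) (by omega) (by omega)
        gcongr
      have e2 := abs_innovation_le_envelope p h ε x n (s - (j + 1)) ω
      have e3 := abs_le_envelope h ε x n (s - (j + 1)) k ω
      have e4 := pow_le_pow_left₀ (by positivity)
        (mul_le_mul e2 e3 (abs_nonneg _) (zero_le_one.trans h1)) 2
      rw [← abs_mul, sq_abs] at e4
      refine mul_le_mul e1 ?_ (sq_nonneg _) (sq_nonneg _)
      have e5 := pow_le_pow_right₀ h1 (show 4 ≤ 8 by norm_num)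
      refine e4.trans ?_
      linarith [show (envelope p h ε x n (s - (j + 1)) ω * envelope p h ε x n (s - (j + 1)) ω) ^ 2
        = envelope p h ε x n (s - (j + 1)) ω ^ 4 by ring]
    · rw [if_neg hj, zero_pow two_ne_zero]
      positivity

lemma boundedInProb_innovation_transform (H : NullAR μ a h c C ε x) (j : ℕ) (k : Fin p) :
    BoundedInProb μ fun n ω => (√(n : ℝ))⁻¹ * ∑ s ∈ Finset.range n, ε ((s : ℤ) + 1) ω *
      (if j + 1 ≤ s then h n ((s : ℤ) + 1) *
        (h n (((s - (j + 1) : ℕ) : ℤ) + 1) ^ 2 * (ε (((s - (j + 1) : ℕ) : ℤ) + 1) ω ^ 2 - 1) *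
          x n ((s : ℤ) - (k : ℕ)) ω) else 0) := by
  refine H.boundedInProb_transform (φ := id) measurable_id H.noise.memLp_two
    H.noise.mean (Y := fun n s ω => if j + 1 ≤ s then h n ((s : ℤ) + 1) *
        (h n (((s - (j + 1) : ℕ) : ℤ) + 1) ^ 2 * (ε (((s - (j + 1) : ℕ) : ℤ) + 1) ω ^ 2 - 1) *
          x n ((s : ℤ) - (k : ℕ)) ω) else 0) (D₀ := C ^ 2 * (1 + C ^ 2) ^ 2) ?_ ?_
  · intro n s hs
    by_cases hj : j + 1 ≤ s
    · simp only [if_pos hj]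
      refine Measurable.const_mul (Measurable.mul (Measurable.const_mul ?_ _)
        (H.measurable_x_past n s hs.le _ (by have := k.2; omega) (by omega))) _
      exact ((measurable_eps_past p ε x n (by omega)).pow_const 2).sub_const 1
    · simp only [if_neg hj]
      exact measurable_const
  · intro n s hs
    refine ⟨s - (j + 1), by omega, fun ω => ?_⟩
    set H₀ := envelope p h ε x n s ω with hH₀
    set H₁ := envelope p h ε x n (s - (j + 1)) ω with hH₁
    have h0 : 1 ≤ H₀ := one_le_envelope p h ε x n s ω
    have h1 : 1 ≤ H₁ := one_le_envelope p h ε x n (s - (j + 1)) ω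
    by_cases hj : j + 1 ≤ s
    · rw [if_pos hj, mul_pow, mul_assoc (C ^ 2)]
      have e1 : h n ((s : ℤ) + 1) ^ 2 ≤ C ^ 2 := by
        rw [← sq_abs (h n ((s : ℤ) + 1))]
        have := H.abs_vol_le (n := n) (t := (s : ℤ) + 1) (by omega) (by omega)
        gcongr
      have e2 := H.abs_sq_innovation_le (show s - (j + 1) < n by omega) ω
      have e3 : |x n ((s : ℤ) - (k : ℕ)) ω| ≤ H₀ := abs_le_envelope h ε x n s k ω
      have e4 := pow_le_pow_left₀ (by positivity)
        (mul_le_mul e2 e3 (abs_nonneg _) (by positivity)) 2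
      rw [← abs_mul, sq_abs] at e4
      refine mul_le_mul e1 (e4.trans ?_) (sq_nonneg _) (sq_nonneg _)
      rw [mul_pow, mul_pow, mul_assoc]
      refine mul_le_mul_of_nonneg_left ?_ (sq_nonneg _)
      have e5 : H₀ ^ 2 ≤ H₀ ^ 4 := pow_le_pow_right₀ h0 (by norm_num)
      rw [← hH₁]
      nlinarith [sq_nonneg (H₁ ^ 4 - H₀ ^ 4), sq_nonneg (H₁ ^ 4 + H₀ ^ 4), sq_nonneg (H₁ ^ 2),
        mul_le_mul_of_nonneg_left e5 (show 0 ≤ H₁ ^ 4 by positivity)]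
    · rw [if_neg hj, zero_pow two_ne_zero]
      positivity

/-- Replacing the innovations by the residuals does not affect the empirical autocovariances of
the squares. -/
lemma tendsto_gammaHat_sub (H : NullAR μ a h c C ε x) (j : ℕ) :
    Tendsto (fun q : ℕ × Ω =>
      √(q.1 : ℝ) * gammaHat q.1 (fun t => h q.1 t ^ 2) (glsResid p h x q.1 q.2) (j + 1) -
      (√(q.1 : ℝ))⁻¹ * ∑ s ∈ Finset.range q.1, if j + 1 ≤ s then
        (h q.1 ((s : ℤ) + 1) ^ 2 * (ε ((s : ℤ) + 1) q.2 ^ 2 - 1)) *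
        (h q.1 (((s - (j + 1) : ℕ) : ℤ) + 1) ^ 2 *
          (ε (((s - (j + 1) : ℕ) : ℤ) + 1) q.2 ^ 2 - 1)) else 0)
      (inProb μ) (𝓝 0) := by
  set T₁ : Fin p → ℕ → Ω → ℝ := fun k n ω => (√(n : ℝ))⁻¹ * ∑ s ∈ Finset.range n,
    (ε ((s : ℤ) + 1) ω ^ 2 - 1) * (if j + 1 ≤ s then h n ((s : ℤ) + 1) ^ 2 *
        (h n (((s - (j + 1) : ℕ) : ℤ) + 1) * ε (((s - (j + 1) : ℕ) : ℤ) + 1) ω *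
          x n (((s - (j + 1) : ℕ) : ℤ) - (k : ℕ)) ω) else 0) with hT₁
  set T₂ : Fin p → ℕ → Ω → ℝ := fun k n ω => (√(n : ℝ))⁻¹ * ∑ s ∈ Finset.range n,
    ε ((s : ℤ) + 1) ω * (if j + 1 ≤ s then h n ((s : ℤ) + 1) *
        (h n (((s - (j + 1) : ℕ) : ℤ) + 1) ^ 2 * (ε (((s - (j + 1) : ℕ) : ℤ) + 1) ω ^ 2 - 1) *
          x n ((s : ℤ) - (k : ℕ)) ω) else 0) with hT₂
  have hT₁0 : ∀ k, Tendsto (fun q : ℕ × Ω => T₁ k q.1 q.2 * ‖glsError a h x q.1 q.2‖)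
      (inProb μ) (𝓝 0) := fun k => (H.boundedInProb_sq_innovation_transform j k).mul_tendsto
        (Y := fun n ω => ‖glsError a h x n ω‖) H.tendsto_norm_glsError
  have hT₂0 : ∀ k, Tendsto (fun q : ℕ × Ω => T₂ k q.1 q.2 * ‖glsError a h x q.1 q.2‖)
      (inProb μ) (𝓝 0) := fun k => (H.boundedInProb_innovation_transform j k).mul_tendsto
        (Y := fun n ω => ‖glsError a h x n ω‖) H.tendsto_norm_glsError
  have hrate : Tendsto (fun q : ℕ × Ω => (√√(q.1 : ℝ) * ‖glsError a h x q.1 q.2‖) ^ 2)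
      (inProb μ) (𝓝 0) := by
    have h1 := H.tendsto_gls_rate.pow 2
    rwa [zero_pow two_ne_zero] at h1
  have hA := H.boundedInProb_average_envelope.mul_tendsto
    (Y := fun n ω => (√√(n : ℝ) * ‖glsError a h x n ω‖) ^ 2) hrate
  have hbound : Tendsto (fun q : ℕ × Ω =>
      2 * (∑ k, (|T₁ k q.1 q.2 * ‖glsError a h x q.1 q.2‖| +
        |T₂ k q.1 q.2 * ‖glsError a h x q.1 q.2‖|)) + 2 * (2 * (1 + C ^ 2) + 9) *
      (((q.1 : ℝ)⁻¹ * ∑ s ∈ Finset.range q.1, envelope p h ε x q.1 s q.2 ^ 8) *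
        (√√(q.1 : ℝ) * ‖glsError a h x q.1 q.2‖) ^ 2)) (inProb μ) (𝓝 0) := by
    have h1 := ((tendsto_finsetSum Finset.univ fun k _ =>
      (hT₁0 k).abs.add (hT₂0 k).abs).const_mul 2).add (hA.const_mul (2 * (2 * (1 + C ^ 2) + 9)))
    simpa using h1
  refine squeeze_zero_norm' ?_ hbound
  filter_upwards [H.tendsto_norm_glsError.eventually_lt_const zero_lt_one] with q hq
  obtain ⟨n, ω⟩ := q
  dsimp only at hq ⊢
  set δ := glsError a h x n ω with hδ
  set L : ℕ → ℝ := fun s => lagComb δ (fun t => x n t ω) s with hL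
  set u : ℕ → ℝ := fun s => h n ((s : ℤ) + 1) * ε ((s : ℤ) + 1) ω with hu
  set U : ℕ → ℝ := fun s => h n ((s : ℤ) + 1) ^ 2 * (ε ((s : ℤ) + 1) ω ^ 2 - 1) with hU
  have hV : ∀ s < n, glsResid p h x n ω ((s : ℤ) + 1) ^ 2 - h n ((s : ℤ) + 1) ^ 2 =
      U s + (-2 * u s * L s + L s ^ 2) := by
    intro s hs
    rw [H.glsResid_eq hs]
    simp only [hU, hu, hL, hδ]
    ring
  set R : ℕ → ℝ := fun s => if j + 1 ≤ s then U s * L (s - (j + 1)) ^ 2 +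
    L s ^ 2 * U (s - (j + 1)) + (-2 * u s * L s + L s ^ 2) *
      (-2 * u (s - (j + 1)) * L (s - (j + 1)) + L (s - (j + 1)) ^ 2) else 0 with hR
  have hgamma : √(n : ℝ) * gammaHat n (fun t => h n t ^ 2) (glsResid p h x n ω) (j + 1) =
      (√(n : ℝ))⁻¹ * ∑ s ∈ Finset.range n, (if j + 1 ≤ s then U s * U (s - (j + 1)) else 0) +
      -2 * (∑ k, δ k * T₁ k n ω) + -2 * (∑ k, δ k * T₂ k n ω) +
      (√(n : ℝ))⁻¹ * ∑ s ∈ Finset.range n, R s := by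
    have e0 : √(n : ℝ) * (n : ℝ)⁻¹ = (√(n : ℝ))⁻¹ := by
      rw [← div_eq_mul_inv, Real.sqrt_div_self', one_div]
    have e1 : ∑ k, δ k * T₁ k n ω = (√(n : ℝ))⁻¹ * ∑ s ∈ Finset.range n,
        (if j + 1 ≤ s then U s * (u (s - (j + 1)) * L (s - (j + 1))) else 0) := by
      simp only [hT₁, mul_left_comm (δ _), ← Finset.mul_sum]
      congr 1
      simp only [Finset.mul_sum]
      rw [Finset.sum_comm]
      refine Finset.sum_congr rfl fun s _ => ?_
      by_cases hj : j + 1 ≤ s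
      · simp only [if_pos hj, hU, hu, hL, lagComb, Finset.mul_sum]
        exact Finset.sum_congr rfl fun k _ => by ring
      · simp [hj]
    have e2 : ∑ k, δ k * T₂ k n ω = (√(n : ℝ))⁻¹ * ∑ s ∈ Finset.range n,
        (if j + 1 ≤ s then (u s * L s) * U (s - (j + 1)) else 0) := by
      simp only [hT₂, mul_left_comm (δ _), ← Finset.mul_sum]
      congr 1
      simp only [Finset.mul_sum]
      rw [Finset.sum_comm]
      refine Finset.sum_congr rfl fun s _ => ?_
      by_cases hj : j + 1 ≤ s
      · simp only [if_pos hj, hU, hu, hL, lagComb, Finset.mul_sum, Finset.sum_mul]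
        exact Finset.sum_congr rfl fun k _ => by ring
      · simp [hj]
    rw [gammaHat, ← mul_assoc, e0, e1, e2, mul_left_comm (-2), mul_left_comm (-2), ← mul_add,
      ← mul_add, ← mul_add, Finset.mul_sum (a := (-2 : ℝ)), Finset.mul_sum (a := (-2 : ℝ)),
      ← Finset.sum_add_distrib, ← Finset.sum_add_distrib, ← Finset.sum_add_distrib,
      sum_Icc_lag_eq_sum_range]
    congr 1
    refine Finset.sum_congr rfl fun s hs => ?_
    have hs' := Finset.mem_range.1 hs
    by_cases hj : j + 1 ≤ s
    · have e3 : (s : ℤ) + 1 - ((j + 1 : ℕ) : ℤ) = ((s - (j + 1) : ℕ) : ℤ) + 1 := by omega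
      simp only [hR, if_pos hj]
      rw [e3, hV s hs', hV (s - (j + 1)) (by omega)]
      ring
    · simp only [hR, if_neg hj]
      ring
  have hRb : |∑ s ∈ Finset.range n, R s| ≤ 2 * (2 * (1 + C ^ 2) + 9) *
      (‖δ‖ ^ 2 * ∑ s ∈ Finset.range n, envelope p h ε x n s ω ^ 8) := by
    have h1 : ∀ s ∈ Finset.range n, |R s| ≤ (2 * (1 + C ^ 2) + 9) * ‖δ‖ ^ 2 *
        (envelope p h ε x n s ω ^ 8 +
          if j + 1 ≤ s then envelope p h ε x n (s - (j + 1)) ω ^ 8 else 0) := by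
      intro s hs
      have hs' := Finset.mem_range.1 hs
      by_cases hj : j + 1 ≤ s
      · simp only [hR, if_pos hj]
        exact abs_mul_remainder_le (norm_nonneg _) hq.le (one_le_envelope p h ε x n s ω)
          (one_le_envelope p h ε x n _ ω) (by positivity)
          (abs_innovation_le_envelope p h ε x n s ω) (abs_innovation_le_envelope p h ε x n _ ω)
          (H.abs_sq_innovation_le hs' ω) (H.abs_sq_innovation_le (by omega) ω)
          (abs_lagComb_le_envelope _ h ε x n s ω) (abs_lagComb_le_envelope _ h ε x n _ ω)
      · simp only [hR, if_neg hj, abs_zero]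
        positivity
    refine (Finset.abs_sum_le_sum_abs _ _).trans ((Finset.sum_le_sum h1).trans ?_)
    rw [← Finset.mul_sum, Finset.sum_add_distrib]
    have h2 := sum_lag_le (f := fun s => envelope p h ε x n s ω ^ 8) (fun s => by positivity) n
      (j + 1)
    have h3 := mul_le_mul_of_nonneg_left h2
      (show 0 ≤ (2 * (1 + C ^ 2) + 9) * ‖δ‖ ^ 2 by positivity)
    linarith
  have hTb : ∀ T : Fin p → ℕ → Ω → ℝ, |∑ k, δ k * T k n ω| ≤ ∑ k, |T k n ω * ‖δ‖| := by
    intro T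
    refine (Finset.abs_sum_le_sum_abs _ _).trans (Finset.sum_le_sum fun k _ => ?_)
    rw [abs_mul, abs_mul, mul_comm, abs_norm]
    exact mul_le_mul_of_nonneg_left (norm_le_pi_norm δ k) (abs_nonneg _)
  have hfin : (√(n : ℝ))⁻¹ * |∑ s ∈ Finset.range n, R s| ≤ 2 * (2 * (1 + C ^ 2) + 9) *
      (((n : ℝ)⁻¹ * ∑ s ∈ Finset.range n, envelope p h ε x n s ω ^ 8) *
        (√√(n : ℝ) * ‖δ‖) ^ 2) := by
    refine (mul_le_mul_of_nonneg_left hRb (by positivity)).trans (le_of_eq ?_)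
    have e0 : √(n : ℝ) * (n : ℝ)⁻¹ = (√(n : ℝ))⁻¹ := by
      rw [← div_eq_mul_inv, Real.sqrt_div_self', one_div]
    rw [mul_pow, Real.sq_sqrt (Real.sqrt_nonneg _), ← e0]
    ring
  rw [hgamma, Real.norm_eq_abs, Finset.sum_add_distrib]
  have h1 := hTb T₁
  have h2 := hTb T₂
  have h3 : |(√(n : ℝ))⁻¹ * ∑ s ∈ Finset.range n, R s| =
      (√(n : ℝ))⁻¹ * |∑ s ∈ Finset.range n, R s| := by
    rw [abs_mul, abs_of_nonneg (by positivity : 0 ≤ (√(n : ℝ))⁻¹)]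
  rw [← h3] at hfin
  rw [abs_le] at h1 h2 hfin ⊢
  constructor <;> linarith [h1.1, h1.2, h2.1, h2.2, hfin.1, hfin.2]

end NullAR

end Covariances

section Measurability

lemma measurable_matrix_inv_apply {p : ℕ} (i j : Fin p) :
    Measurable fun A : Fin p → Fin p → ℝ => (Matrix.of A)⁻¹ i j := by
  have hof : Continuous fun A : Fin p → Fin p → ℝ => (Matrix.of A : Matrix (Fin p) (Fin p) ℝ) :=
    continuous_id
  have h1 := hof.matrix_det.measurable.inv
  have h2 : Measurable fun A : Fin p → Fin p → ℝ => (Matrix.of A).adjugate i j :=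
    ((continuous_apply_apply i j).comp hof.matrix_adjugate).measurable
  refine (congrArg Measurable ?_).mp (h1.mul h2)
  funext A
  simp [Matrix.inv_def, Ring.inverse_eq_inv']

variable {Ω : Type*} [mΩ : MeasurableSpace Ω] {μ : Measure Ω} {p : ℕ}
  {a : Fin p → ℝ} {h : ℕ → ℤ → ℝ} {c C : ℝ} {ε : ℤ → Ω → ℝ} {x : ℕ → ℤ → Ω → ℝ}

namespace NullAR

lemma sqrt_volAverage_ge (H : NullAR μ a h c C ε x) {n : ℕ} (hn : 0 < n) :
    c ^ 4 ≤ √(volAverage h 8 n) := by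
  refine Real.le_sqrt_of_sq_le ?_
  rw [← pow_mul]
  exact H.pow_le_volAverage 8 hn

lemma measurable_gls (H : NullAR μ a h c C ε x) (n : ℕ) (i : Fin p) :
    Measurable fun ω => gls p (h n) n (fun t => x n t ω) i := by
  have hx : ∀ t ∈ Finset.Icc (1 : ℤ) n, ∀ k : Fin p, Measurable (x n (t - 1 - (k : ℕ))) := by
    intro t ht k
    have := Finset.mem_Icc.1 ht
    exact H.measurable_x n (by have := k.2; omega) (by omega)
  simp only [gls, Matrix.mulVec, dotProduct]
  refine Finset.measurable_sum _ fun j _ => Measurable.mul ?_ ?_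
  · refine (measurable_matrix_inv_apply i j).comp (measurable_pi_iff.2 fun k =>
      measurable_pi_iff.2 fun l => ?_) (f := fun ω => (∑ t ∈ Finset.Icc (1 : ℤ) n,
        (h n t ^ 2)⁻¹ • Matrix.vecMulVec (lagVector p (fun t => x n t ω) (t - 1))
          (lagVector p (fun t => x n t ω) (t - 1)) : Matrix (Fin p) (Fin p) ℝ))
    simp only [Matrix.sum_apply, Matrix.smul_apply, Matrix.vecMulVec_apply, lagVector, smul_eq_mul]
    exact Finset.measurable_sum _ fun t ht => ((hx t ht k).mul (hx t ht l)).const_mul _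
  · simp only [Finset.sum_apply, Pi.smul_apply, smul_eq_mul, lagVector]
    refine Finset.measurable_sum _ fun t ht => Measurable.mul (Measurable.const_mul ?_ _)
      (hx t ht j)
    have := Finset.mem_Icc.1 ht
    exact H.measurable_x n (by omega) (by omega)

lemma measurable_glsResid (H : NullAR μ a h c C ε x) {n : ℕ} {t : ℤ} (h1 : 1 ≤ t) (h2 : t ≤ n) :
    Measurable fun ω => glsResid p h x n ω t := by
  simp only [glsResid, resid]
  refine (H.measurable_x n (by omega) h2).sub (Finset.measurable_sum _ fun i _ =>
    (H.measurable_gls n i).mul (H.measurable_x n ?_ ?_))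
  · have := i.2; omega
  · omega

lemma measurable_gammaHat (H : NullAR μ a h c C ε x) (n : ℕ) (b : ℤ → ℝ) (j : ℕ) :
    Measurable fun ω => gammaHat n b (glsResid p h x n ω) j := by
  simp only [gammaHat]
  refine (Finset.measurable_sum _ fun t ht => ?_).const_mul _
  have := Finset.mem_Icc.1 ht
  exact (((H.measurable_glsResid (by omega) (by omega)).pow_const 2).sub_const _).mul
    (((H.measurable_glsResid (by omega) (by omega)).pow_const 2).sub_const _)

lemma measurable_omegaBar (H : NullAR μ a h c C ε x) (k n : ℕ) :
    Measurable fun ω => omegaBar k n (h n) (glsResid p h x n ω) := by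
  simp only [omegaBar, noiseMoment]
  refine ((Finset.measurable_sum _ fun t ht => ?_).const_mul _).div
    ((Finset.measurable_sum _ fun t ht => Measurable.mul_const ?_ _).const_mul _)
  · have := Finset.mem_Icc.1 ht
    exact (H.measurable_glsResid (by omega) (by omega)).pow_const k
  · have := Finset.mem_Icc.1 ht
    exact (H.measurable_glsResid (by omega) (by omega)).pow_const k

lemma measurable_ljungBox (H : NullAR μ a h c C ε x) (m n : ℕ) (b : ℤ → ℝ) :
    Measurable fun ω => ljungBox m n (h n) b (glsResid p h x n ω) := by
  simp only [ljungBox, rHat]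
  refine ((Finset.measurable_sum _ fun i _ => ?_).const_mul _).mul
    (((H.measurable_omegaBar 4 n).pow_const 2).div (H.measurable_omegaBar 8 n))
  exact (((H.measurable_gammaHat n b i).div (H.measurable_gammaHat n b 0)).pow_const 2).div_const _

end NullAR

end Measurability

section Products

variable {Ω : Type*} [mΩ : MeasurableSpace Ω] {μ : Measure Ω}

lemma tendsto_sq_mul_sub_sq {A B ρ : ℕ → Ω → ℝ} (hA : BoundedInProb μ A)
    (hB : Tendsto (fun q : ℕ × Ω => B q.1 q.2 - A q.1 q.2) (inProb μ) (𝓝 0))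
    (hρ : Tendsto (fun q : ℕ × Ω => ρ q.1 q.2) (inProb μ) (𝓝 1)) :
    Tendsto (fun q : ℕ × Ω => B q.1 q.2 ^ 2 * ρ q.1 q.2 - A q.1 q.2 ^ 2) (inProb μ) (𝓝 0) := by
  have hρ' : Tendsto (fun q : ℕ × Ω => ρ q.1 q.2 - 1) (inProb μ) (𝓝 0) := by
    simpa using hρ.sub_const 1
  have h1 := hA.mul_tendsto (Y := fun n ω => A n ω * (ρ n ω - 1))
    (hA.mul_tendsto (Y := fun n ω => ρ n ω - 1) hρ')
  have h2 := ((hA.mul_tendsto (Y := fun n ω => B n ω - A n ω) hB).mul hρ).const_mul 2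
  have h3 := (hB.pow 2).mul hρ
  have h4 := (h1.add h2).add h3
  simp only [zero_mul, mul_zero, add_zero, zero_pow two_ne_zero] at h4
  exact h4.congr fun q => by ring

end Products

section Limit

variable {Ω : Type*} [mΩ : MeasurableSpace Ω] {μ : Measure Ω} {p : ℕ}
  {a : Fin p → ℝ} {h : ℕ → ℤ → ℝ} {c C : ℝ} {ε : ℤ → Ω → ℝ} {x : ℕ → ℤ → Ω → ℝ}

/-- The centred squares of the noise. -/
def squareNoise (ε : ℤ → Ω → ℝ) (r : ℤ) (ω : Ω) : ℝ := ε (r + 1) ω ^ 2 - 1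

/-- The weights of the limiting autocovariances. -/
noncomputable def limitWeight (m : ℕ) (κ : ℝ) (h : ℕ → ℤ → ℝ) (n s : ℕ) (i : Fin m) : ℝ :=
  (if (i : ℕ) + 1 ≤ s ∧ s < n then
    h n ((s : ℤ) + 1) ^ 2 * h n (((s - ((i : ℕ) + 1) : ℕ) : ℤ) + 1) ^ 2 else 0) /
    (κ * √(volAverage h 8 n))

namespace NullAR

lemma abs_limitWeight_le (H : NullAR μ a h c C ε x) {κ : ℝ} (hκ : 0 < κ) (m n s : ℕ) (i : Fin m) :
    |limitWeight m κ h n s i| ≤ C ^ 4 / (κ * c ^ 4) := by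
  have hc := H.pos
  rw [limitWeight]
  split_ifs with hs
  · have h1 := H.abs_vol_le (n := n) (t := (s : ℤ) + 1) (by omega) (by omega)
    have h2 := H.abs_vol_le (n := n) (t := ((s - ((i : ℕ) + 1) : ℕ) : ℤ) + 1) (by omega) (by omega)
    have h3 := H.sqrt_volAverage_ge (show 0 < n by omega)
    rw [abs_div, abs_of_nonneg (by positivity), abs_of_nonneg (by positivity), ← sq_abs (h n _),
      ← sq_abs (h n (((s - ((i : ℕ) + 1) : ℕ) : ℤ) + 1))]
    have h4 : |h n ((s : ℤ) + 1)| ^ 2 * |h n (((s - ((i : ℕ) + 1) : ℕ) : ℤ) + 1)| ^ 2 ≤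
        C ^ 2 * C ^ 2 := by gcongr
    rw [show C ^ 4 = C ^ 2 * C ^ 2 by ring]
    gcongr
  · rw [zero_div, abs_zero]
    positivity

lemma tendsto_average_limitWeight_sq (H : NullAR μ a h c C ε x) {κ : ℝ} (hκ : 0 < κ) {V : ℝ}
    (hV : ∀ n : ℕ, ∑ r ∈ Finset.range (n - 1),
      |h n (((r + 1 : ℕ) : ℤ) + 1) - h n ((r : ℤ) + 1)| ≤ V) (m : ℕ) (i : Fin m) :
    Tendsto (fun n : ℕ => (n : ℝ)⁻¹ * ∑ s ∈ Finset.range n, κ ^ 2 * limitWeight m κ h n s i ^ 2)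
      atTop (𝓝 1) := by
  have h1 := tendsto_average_lag_pow_sub (a := fun n s => h n ((s : ℤ) + 1)) (C := C)
    (fun n s hs => H.abs_vol_le (by omega) (by omega)) hV ((i : ℕ) + 1)
  have h2 := tendsto_div_of_tendsto_sub (pow_pos H.pos 8)
    ((eventually_gt_atTop 0).mono fun n hn => H.pow_le_volAverage 8 hn) h1
  refine h2.congr' ?_
  filter_upwards [eventually_gt_atTop 0] with n hn
  have hG := (pow_pos H.pos 8).trans_le (H.pow_le_volAverage 8 hn)
  rw [mul_div_assoc, Finset.sum_div]
  congr 1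
  refine Finset.sum_congr rfl fun s hs => ?_
  have hs' := Finset.mem_range.1 hs
  simp only [limitWeight, hs', and_true]
  rw [div_pow, mul_pow, Real.sq_sqrt hG.le]
  field_simp

end NullAR

variable [IsProbabilityMeasure μ]

lemma NoiseAssumption.exists_centeredNoise (H : NoiseAssumption μ ε) :
    ∃ M, CenteredNoise μ (squareNoise ε) ((∫ ω, ε 0 ω ^ 4 ∂μ) - 1) M := by
  have hφ : Measurable fun y : ℝ => y ^ 2 - 1 := by fun_prop
  have hid : ∀ r, IdentDistrib (squareNoise ε r) (fun ω => ε 0 ω ^ 2 - 1) μ μ := fun r =>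
    (H.identDistrib (r + 1)).comp hφ
  have i2 : Integrable (fun ω => ε 0 ω ^ 2) μ := integrable_pow_of_memLp (H.memLp 0) (by norm_num)
  have i4 : Integrable (fun ω => ε 0 ω ^ 4) μ := integrable_pow_of_memLp (H.memLp 0) (by norm_num)
  have i8 : Integrable (fun ω => ε 0 ω ^ 8) μ := integrable_pow_of_memLp (H.memLp 0) (by norm_num)
  have hL : MemLp (fun ω => ε 0 ω ^ 2 - 1) (4 : ℕ) μ := by
    refine MemLp.sub ?_ (memLp_const 1)
    rw [← integrable_norm_rpow_iff ((H.measurable 0).pow_const 2).aestronglyMeasurable (by norm_num)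
      (ENNReal.natCast_ne_top 4)]
    simp only [ENNReal.toReal_natCast, Real.rpow_natCast]
    refine i8.congr (Eventually.of_forall fun ω => ?_)
    simp only [norm_pow, Real.norm_eq_abs, sq_abs]
    ring
  refine ⟨∫ ω, (ε 0 ω ^ 2 - 1) ^ 4 ∂μ, fun r => hφ.comp (H.measurable _), ?_, fun r =>
    (hid r).memLp_iff.2 hL, fun r => (hid r).integral_eq.trans H.sq_sub_one.2, fun r => ?_,
    fun r => le_of_eq ((hid r).comp (u := fun y : ℝ => y ^ 4) (by fun_prop)).integral_eq⟩
  · exact (H.indep.precomp (g := fun r : ℤ => r + 1) (add_left_injective 1)).comp _ fun _ => hφ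
  · have e : ∫ ω, squareNoise ε r ω ^ 2 ∂μ = ∫ ω, (ε 0 ω ^ 2 - 1) ^ 2 ∂μ :=
      ((hid r).comp (u := fun y : ℝ => y ^ 2) (by fun_prop)).integral_eq
    have e2 : ∀ ω, (ε 0 ω ^ 2 - 1) ^ 2 = ε 0 ω ^ 4 - 2 * ε 0 ω ^ 2 + 1 := fun ω => by ring
    rw [e]
    have i42 : Integrable (fun ω => ε 0 ω ^ 4 - 2 * ε 0 ω ^ 2) μ := i4.sub (i2.const_mul 2)
    simp_rw [e2]
    rw [integral_add i42 (integrable_const _), integral_sub i4 (i2.const_mul 2), integral_const_mul, H.variance]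
    simp
    ring

lemma NoiseAssumption.eighth_pos (H : NoiseAssumption μ ε) : 0 < ∫ ω, ε 0 ω ^ 8 ∂μ := by
  have i4 : Integrable (fun ω => ε 0 ω ^ 4) μ := integrable_pow_of_memLp (H.memLp 0) (by norm_num)
  have i8 : Integrable (fun ω => ε 0 ω ^ 8) μ := integrable_pow_of_memLp (H.memLp 0) (by norm_num)
  have h1 : ∫ ω, (2 * ε 0 ω ^ 4 - 1) ∂μ ≤ ∫ ω, ε 0 ω ^ 8 ∂μ :=
    integral_mono ((i4.const_mul 2).sub (integrable_const 1)) i8 fun ω => by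
      change 2 * ε 0 ω ^ 4 - 1 ≤ ε 0 ω ^ 8
      nlinarith [sq_nonneg (ε 0 ω ^ 4 - 1)]
  rw [integral_sub (i4.const_mul 2) (integrable_const 1), integral_const_mul] at h1
  simp only [integral_const, probReal_univ, smul_eq_mul, mul_one] at h1
  linarith [H.fourth]

namespace NullAR

lemma boundedInProb_autocov (H : NullAR μ a h c C ε x) {κ : ℝ} (hκ : 0 < κ) (m : ℕ) (i : Fin m) :
    BoundedInProb μ fun n ω => autocov (limitWeight m κ h) (squareNoise ε) n i ω := by
  have hc := H.pos
  have h1 := H.boundedInProb_transform (φ := fun y => y ^ 2 - 1) (by fun_prop)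
    H.noise.sq_sub_one.1 H.noise.sq_sub_one.2
    (Y := fun n s ω => if (i : ℕ) + 1 ≤ s then limitWeight m κ h n s i *
      (ε (((s - ((i : ℕ) + 1) : ℕ) : ℤ) + 1) ω ^ 2 - 1) else 0)
    (D₀ := (C ^ 4 / (κ * c ^ 4)) ^ 2 * ((c ^ 2)⁻¹ * (1 + C ^ 2)) ^ 2) ?_ ?_
  · refine (congrArg (BoundedInProb μ) ?_).mp h1
    funext n ω
    rw [autocov]
    congr 1
    refine Finset.sum_congr rfl fun s hs => ?_
    by_cases hi : (i : ℕ) + 1 ≤ s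
    · rw [if_pos hi, squareNoise, squareNoise,
        show (s : ℤ) - ((i : ℕ) + 1) = ((s - ((i : ℕ) + 1) : ℕ) : ℤ) by omega]
      ring
    · simp [hi, limitWeight]
  · intro n s hs
    by_cases hi : (i : ℕ) + 1 ≤ s
    · simp only [if_pos hi]
      exact (((measurable_eps_past p ε x n (by omega)).pow_const 2).sub_const 1).const_mul _
    · simp only [if_neg hi]
      exact measurable_const
  · intro n s hs
    refine ⟨s - ((i : ℕ) + 1), by omega, fun ω => ?_⟩
    have h0 : 0 ≤ envelope p h ε x n s ω ^ 8 := by positivity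
    set E := envelope p h ε x n (s - ((i : ℕ) + 1)) ω with hE
    have hE1 : 1 ≤ E := one_le_envelope p h ε x n _ ω
    by_cases hi : (i : ℕ) + 1 ≤ s
    · rw [if_pos hi, mul_pow, mul_assoc]
      have e1 := pow_le_pow_left₀ (abs_nonneg _) (H.abs_limitWeight_le hκ m n s i) 2
      rw [sq_abs] at e1
      refine mul_le_mul e1 ?_ (sq_nonneg _) (sq_nonneg _)
      have e2 := H.abs_sq_innovation_le (show s - ((i : ℕ) + 1) < n by omega) ω
      rw [abs_mul, abs_of_nonneg (sq_nonneg _)] at e2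
      have e3 := pow_le_pow_left₀ hc.le (H.lower n (((s - ((i : ℕ) + 1) : ℕ) : ℤ) + 1) (by omega)
        (by omega)) 2
      have e4 : |ε (((s - ((i : ℕ) + 1) : ℕ) : ℤ) + 1) ω ^ 2 - 1| ≤
          (c ^ 2)⁻¹ * (1 + C ^ 2) * E ^ 2 := by
        rw [mul_assoc, le_inv_mul_iff₀ (pow_pos hc 2)]
        exact (mul_le_mul_of_nonneg_right e3 (abs_nonneg _)).trans e2
      have e5 := pow_le_pow_left₀ (abs_nonneg _) e4 2
      rw [sq_abs, mul_pow, ← pow_mul] at e5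
      refine e5.trans (mul_le_mul_of_nonneg_left ?_ (sq_nonneg _))
      have := pow_le_pow_right₀ hE1 (show 2 * 2 ≤ 8 by norm_num)
      linarith
    · rw [if_neg hi, zero_pow two_ne_zero]
      positivity

lemma tendsto_gammaHat_sub_autocov (H : NullAR μ a h c C ε x) {κ : ℝ} (hκ : 0 < κ) (m : ℕ)
    (i : Fin m) :
    Tendsto (fun q : ℕ × Ω =>
      √(q.1 : ℝ) * gammaHat q.1 (fun t => h q.1 t ^ 2) (glsResid p h x q.1 q.2) ((i : ℕ) + 1) /
        (κ * √(volAverage h 8 q.1)) - autocov (limitWeight m κ h) (squareNoise ε) q.1 i q.2)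
      (inProb μ) (𝓝 0) := by
  have hc := H.pos
  have h1 := (H.tendsto_gammaHat_sub (i : ℕ)).abs.mul_const (κ * c ^ 4)⁻¹
  rw [abs_zero, zero_mul] at h1
  refine squeeze_zero_norm' ?_ h1
  filter_upwards [eventually_inProb_of_atTop μ (eventually_gt_atTop 0)] with q hq
  have hG := H.sqrt_volAverage_ge hq
  have hG0 := (pow_pos hc 4).trans_le hG
  have e : autocov (limitWeight m κ h) (squareNoise ε) q.1 i q.2 =
      ((√(q.1 : ℝ))⁻¹ * ∑ s ∈ Finset.range q.1, if (i : ℕ) + 1 ≤ s then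
        (h q.1 ((s : ℤ) + 1) ^ 2 * (ε ((s : ℤ) + 1) q.2 ^ 2 - 1)) *
        (h q.1 (((s - ((i : ℕ) + 1) : ℕ) : ℤ) + 1) ^ 2 *
          (ε (((s - ((i : ℕ) + 1) : ℕ) : ℤ) + 1) q.2 ^ 2 - 1)) else 0) /
        (κ * √(volAverage h 8 q.1)) := by
    rw [autocov, mul_div_assoc, Finset.sum_div]
    congr 1
    refine Finset.sum_congr rfl fun s hs => ?_
    by_cases hi : (i : ℕ) + 1 ≤ s
    · simp only [limitWeight, hi, Finset.mem_range.1 hs, and_self, if_true, squareNoise,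
        show (s : ℤ) - ((i : ℕ) + 1) = ((s - ((i : ℕ) + 1) : ℕ) : ℤ) by omega]
      ring
    · simp [hi, limitWeight]
  rw [e, ← sub_div, Real.norm_eq_abs, abs_div, div_eq_mul_inv, abs_of_pos (mul_pos hκ hG0)]
  exact mul_le_mul_of_nonneg_left (inv_anti₀ (by positivity)
    (mul_le_mul_of_nonneg_left hG hκ.le)) (abs_nonneg _)

end NullAR

namespace NullAR

lemma tendsto_ljungBox_sub (H : NullAR μ a h c C ε x) (m : ℕ) :
    Tendsto (fun q : ℕ × Ω =>
      ljungBox m q.1 (h q.1) (fun t => h q.1 t ^ 2) (glsResid p h x q.1 q.2) -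
      ∑ i, autocov (limitWeight m ((∫ ω, ε 0 ω ^ 4 ∂μ) - 1) h) (squareNoise ε) q.1 i q.2 ^ 2)
      (inProb μ) (𝓝 0) := by
  have hc := H.pos
  set κ := (∫ ω, ε 0 ω ^ 4 ∂μ) - 1 with hκdef
  have hκ : 0 < κ := sub_pos.2 H.noise.fourth
  have hω4 := H.tendsto_omegaBar_div (k := 4) (by norm_num) (by linarith)
  have hω8 := H.tendsto_omegaBar_div (k := 8) (by norm_num) H.noise.eighth_pos
  have hγ := H.tendsto_gammaHat_zero_div
  rw [← hκdef] at hγ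
  have hfac : ∀ i : Fin m, Tendsto (fun q : ℕ × Ω => ((q.1 : ℝ) + 2) / ((q.1 : ℝ) - ((i : ℕ) + 1)))
      (inProb μ) (𝓝 1) := by
    intro i
    refine tendsto_inProb_of_atTop μ (f := fun n : ℕ => ((n : ℝ) + 2) / ((n : ℝ) - ((i : ℕ) + 1))) ?_
    have hd : Tendsto (fun n : ℕ => (n : ℝ) - ((i : ℕ) + 1)) atTop atTop :=
      tendsto_atTop_add_const_right _ _ tendsto_natCast_atTop_atTop
    have h1 : Tendsto (fun n : ℕ => 1 + (2 + ((i : ℕ) + 1)) * ((n : ℝ) - ((i : ℕ) + 1))⁻¹) atTop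
        (𝓝 (1 + (2 + ((i : ℕ) + 1)) * 0)) :=
      ((tendsto_inv_atTop_zero.comp hd).const_mul _).const_add 1
    rw [mul_zero, add_zero] at h1
    refine h1.congr' ?_
    filter_upwards [hd.eventually_gt_atTop 0] with n hn
    field_simp
    ring
  set ρ : Fin m → ℕ → Ω → ℝ := fun i n ω => ((n : ℝ) + 2) / ((n : ℝ) - ((i : ℕ) + 1)) *
    ((omegaBar 4 n (h n) (glsResid p h x n ω) / volAverage h 4 n) ^ 2 /
      (omegaBar 8 n (h n) (glsResid p h x n ω) / volAverage h 8 n *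
        (gammaHat n (fun t => h n t ^ 2) (glsResid p h x n ω) 0 / (κ * volAverage h 4 n)) ^ 2))
    with hρdef
  have hρ : ∀ i, Tendsto (fun q : ℕ × Ω => ρ i q.1 q.2) (inProb μ) (𝓝 1) := by
    intro i
    have h1 := (hfac i).mul ((hω4.pow 2).div (hω8.mul (hγ.pow 2)) (by norm_num))
    norm_num at h1
    exact h1
  have hsum := tendsto_finsetSum Finset.univ fun (i : Fin m) _ =>
    tendsto_sq_mul_sub_sq (H.boundedInProb_autocov hκ m i)
      (B := fun n ω => √(n : ℝ) * gammaHat n (fun t => h n t ^ 2) (glsResid p h x n ω)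
        ((i : ℕ) + 1) / (κ * √(volAverage h 8 n)))
      (H.tendsto_gammaHat_sub_autocov hκ m i) (hρ i)
  rw [Finset.sum_const_zero] at hsum
  refine hsum.congr' ?_
  filter_upwards [eventually_inProb_of_atTop μ (eventually_gt_atTop m),
    hω8.eventually_const_lt zero_lt_one, hγ.eventually_const_lt zero_lt_one] with q hq h8 h0
  obtain ⟨n, ω⟩ := q
  dsimp only at hq h8 h0 ⊢
  have hn : 0 < n := by omega
  have hn' : (0 : ℝ) < n := by exact_mod_cast hn
  have hG4 := (pow_pos hc 4).trans_le (H.pow_le_volAverage 4 hn)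
  have hG8 := (pow_pos hc 8).trans_le (H.pow_le_volAverage 8 hn)
  have hw8 : omegaBar 8 n (h n) (glsResid p h x n ω) ≠ 0 := fun h => by
    rw [h, zero_div] at h8; exact lt_irrefl _ h8
  have hγ0 : gammaHat n (fun t => h n t ^ 2) (glsResid p h x n ω) 0 ≠ 0 := fun h => by
    rw [h, zero_div] at h0; exact lt_irrefl _ h0
  rw [Finset.sum_sub_distrib, ljungBox]
  congr 1
  have hIcc : ∀ f : ℕ → ℝ, ∑ i ∈ Finset.Icc 1 m, f i = ∑ i : Fin m, f ((i : ℕ) + 1) := fun f => by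
    rw [← Finset.sum_range (fun i => f (i + 1)), Finset.range_eq_Ico, Finset.sum_Ico_add' f 0 m 1]
    rfl
  rw [hIcc, Finset.mul_sum, Finset.sum_mul]
  refine Finset.sum_congr rfl fun i _ => ?_
  have hi : (n : ℝ) - ((i : ℕ) + 1) ≠ 0 := by
    have h1 : ((i : ℕ) + 1 : ℝ) < n := by
      have := i.2
      exact_mod_cast (by omega : (i : ℕ) + 1 < n)
    exact (sub_pos.2 h1).ne'
  simp only [hρdef, rHat]
  rw [div_pow, mul_pow, mul_pow, Real.sq_sqrt hn'.le, Real.sq_sqrt hG8.le]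
  push_cast
  field_simp

/-- The limit law of the Ljung-Box statistic. -/
theorem tendstoInDistribution_ljungBox (H : NullAR μ a h c C ε x) {V : ℝ}
    (hV : ∀ n : ℕ, ∑ r ∈ Finset.range (n - 1),
      |h n (((r + 1 : ℕ) : ℤ) + 1) - h n ((r : ℤ) + 1)| ≤ V) (m : ℕ) :
    TendstoInDistribution (fun (n : ℕ) (ω : Ω) =>
      ljungBox m n (h n) (fun t => h n t ^ 2) (glsResid p h x n ω)) atTop
      (id : ℝ → ℝ) (fun _ => μ) (chiSquared m) := by
  have hκ : 0 < (∫ ω, ε 0 ω ^ 4 ∂μ) - 1 := sub_pos.2 H.noise.fourth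
  obtain ⟨M, hM⟩ := H.noise.exists_centeredNoise
  refine tendstoInDistribution_of_tendstoInMeasure_sub _ _
    (hM.tendstoInDistribution_sum_autocov_sq (fun n s i => H.abs_limitWeight_le hκ m n s i)
      (H.tendsto_average_limitWeight_sq hκ hV m)) ?_
    fun n => (H.measurable_ljungBox m n _).aemeasurable
  exact tendstoInMeasure_of_tendsto_inProb (H.tendsto_ljungBox_sub m)

end NullAR

end Limit

section Reduction

variable {Ω : Type*} [MeasurableSpace Ω] {μ : Measure Ω} {p m : ℕ}
  {g : ℝ → ℝ} {a : Fin p → ℝ} {α : Fin m → ℝ} {ε : ℤ → Ω → ℝ} {x u : ℕ → ℤ → Ω → ℝ}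

lemma int_div_mem_Ioc {n : ℕ} {t : ℤ} (h1 : 1 ≤ t) (h2 : t ≤ n) :
    (t : ℝ) / n ∈ Set.Ioc (0 : ℝ) 1 := by
  obtain ⟨s, rfl⟩ : ∃ s : ℕ, t = (s : ℤ) + 1 := ⟨(t - 1).toNat, by omega⟩
  push_cast
  exact div_mem_Ioc (by omega)

lemma ARModel.innovation_eq (hmodel : ARModel μ g a α ε x u) (hg : VolatilityAssumption g)
    (hH0 : NullHypothesis α) {n : ℕ} {t : ℤ} (h1 : 1 ≤ t) (h2 : t ≤ n) (ω : Ω) :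
    u n t ω = vol g n t * ε t ω := by
  obtain ⟨c, hc, hcg⟩ := hg.lower
  rw [hmodel.innovation n t h1 h2 ω, Finset.sum_eq_zero fun i _ => by rw [hH0 i, zero_mul],
    add_zero, Real.sqrt_sq (show 0 ≤ vol g n t from hc.le.trans (hcg _ (int_div_mem_Ioc h1 h2)))]

lemma ARModel.exists_nullAR (hmodel : ARModel μ g a α ε x u) (hg : VolatilityAssumption g)
    (hε : NoiseAssumption μ ε) (hH0 : NullHypothesis α) :
    ∃ c C, NullAR μ a (vol g) c C ε x := by
  obtain ⟨c, hc, hcg⟩ := hg.lower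
  obtain ⟨C, hCg⟩ := hg.upper
  refine ⟨c, C, hε, hc, fun n t h1 h2 => hcg _ (int_div_mem_Ioc h1 h2),
    fun n t h1 h2 => hCg _ (int_div_mem_Ioc h1 h2), hmodel.stable, fun n t h1 h2 ω => ?_,
    hmodel.init_measurable, hmodel.init_indep, hmodel.init_tight⟩
  rw [hmodel.observation n t h1 h2 ω, hmodel.innovation_eq hg hH0 h1 h2 ω]

lemma VolatilityAssumption.exists_variation_le (hg : VolatilityAssumption g) :
    ∃ V, ∀ n : ℕ, ∑ r ∈ Finset.range (n - 1),
      |vol g n (((r + 1 : ℕ) : ℤ) + 1) - vol g n ((r : ℤ) + 1)| ≤ V := by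
  obtain ⟨c, hc, hcg⟩ := hg.lower
  obtain ⟨C, hCg⟩ := hg.upper
  obtain ⟨V, hV⟩ := hg.piecewiseLipschitz.exists_variation_le (C := C) fun r hr => by
    rw [abs_of_pos (hc.trans_le (hcg r hr))]
    exact hCg r hr
  refine ⟨V, fun n => (le_of_eq ?_).trans (hV n)⟩
  simp only [vol]
  push_cast
  rfl

lemma gammaHat_congr {n : ℕ} {b b' : ℤ → ℝ} (hb : ∀ t : ℤ, 1 ≤ t → t ≤ n → b t = b' t)
    (v : ℤ → ℝ) (j : ℕ) : gammaHat n b v j = gammaHat n b' v j := by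
  rw [gammaHat, gammaHat]
  congr 1
  refine Finset.sum_congr rfl fun t ht => ?_
  have := Finset.mem_Icc.1 ht
  rw [hb t (by omega) (by omega), hb (t - j) (by omega) (by omega)]

lemma ARModel.qStarGLS_eq (hmodel : ARModel μ g a α ε x u) (hg : VolatilityAssumption g)
    (hε : NoiseAssumption μ ε) (hH0 : NullHypothesis α) (n : ℕ) (ω : Ω) :
    qStarGLS μ p m g x u n ω =
      ljungBox m n (vol g n) (fun t => vol g n t ^ 2) (glsResid p (vol g) x n ω) := by
  have hb : ∀ t : ℤ, 1 ≤ t → t ≤ n → ∫ ω', u n t ω' ^ 2 ∂μ = vol g n t ^ 2 := by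
    intro t h1 h2
    simp_rw [hmodel.innovation_eq hg hH0 h1 h2, mul_pow]
    have e : ∫ ω, ε t ω ^ 2 ∂μ = ∫ ω, ε 0 ω ^ 2 ∂μ :=
      ((hε.identDistrib t).comp (u := fun y : ℝ => y ^ 2) (by fun_prop)).integral_eq
    rw [integral_const_mul, e, hε.variance, mul_one]
  simp only [qStarGLS, ljungBox, rHat, gammaHat_congr hb]
  rfl

end Reduction

end SecondOrderDynamics

theorem proposition3 {Ω : Type*} [MeasurableSpace Ω] (μ : Measure Ω) [IsProbabilityMeasure μ]
    (p m : ℕ) (hm : 0 < m) (g : ℝ → ℝ) (a : Fin p → ℝ) (α : Fin m → ℝ)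
    (ε : ℤ → Ω → ℝ) (x u : ℕ → ℤ → Ω → ℝ)
    (hg : VolatilityAssumption g) (hε : NoiseAssumption μ ε)
    (hmodel : ARModel μ g a α ε x u) (hH0 : NullHypothesis α) :
    TendstoInDistribution (fun (n : ℕ) (ω : Ω) => qStarGLS μ p m g x u n ω) atTop
      (id : ℝ → ℝ) (fun _ => μ) (chiSquared m) := by
  obtain ⟨c, C, H⟩ := hmodel.exists_nullAR hg hε hH0
  obtain ⟨V, hV⟩ := hg.exists_variation_le
  simp only [hmodel.qStarGLS_eq hg hε hH0]
  exact H.tendstoInDistribution_ljungBox hV m
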